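/- Let $n\ge 4$, $q=e^{\pi i/n}$ and $[m]=(q^m-q^{-m})/(q-q^{-1})$. **Cells.** Let $\mathcal{G}$ be a finite directed graph (loops and multiple edges allowed), with source and range maps $s,r$ and adjacency matrix $\Delta_{\mathcal{G}}$, where $\Delta_{\mathcal{G}}(i,j)$ is the number of edges $i\to j$, and let $\phi>0$ be a vector with $\Delta_{\mathcal{G}}\phi=[3]\phi$. An Ocneanu cell system on $(\mathcal{G},\phi)$ assigns to every oriented triangle, i.e. closed path $\alpha\beta\gamma$ of length 3 up to cyclic rotation, a number $W(\alpha\beta\gamma)\in\mathbb{C}$ such that (with $W=0$ on triples of edges that are not triangles) (I) $\sum_{\beta,\gamma}W(\alpha\beta\gamma)\overline{W(\alpha'\beta\gamma)}=\delta_{\alpha,\alpha'}[2]\,\phi_{s(\alpha)}\phi_{r(\alpha)}$ for all edges $\alpha,\alpha'$ with the same source and the same range; (II) $\sum_{\beta,\beta',\gamma,\gamma'}\phi_{r(\beta)}^{-1}W(\alpha_1\beta\gamma)\overline{W(\alpha_4\beta'\gamma)}W(\alpha_3\beta'\gamma')\overline{W(\alpha_2\beta\gamma')}=\delta_{\alpha_1,\alpha_2}\delta_{\alpha_3,\alpha_4}\phi_{s(\alpha_1)}\phi_{r(\alpha_1)}\phi_{r(\alpha_4)}+\delta_{\alpha_1,\alpha_4}\delta_{\alpha_2,\alpha_3}\phi_{s(\alpha_1)}\phi_{r(\alpha_1)}\phi_{s(\alpha_2)}$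 for all edges with $s(\alpha_1)=s(\alpha_4)$, $s(\alpha_2)=s(\alpha_3)$, $r(\alpha_1)=r(\alpha_2)$, $r(\alpha_3)=r(\alpha_4)$. **Path algebras.** For a distinguished vertex $\ast$ of $\mathcal{G}$ let $A(\mathcal{G})_k$ be the $*$-algebra with matrix units $(\mu,\mu')$ indexed by the pairs of paths of length $k$ that start at $\ast$ and have a common end vertex, let $A(\mathcal{G})_k\subset A(\mathcal{G})_{k+1}$ by $(\mu,\mu')=\sum_e(\mu e,\mu'e)$, and let $A(\mathcal{G})=\bigcup_kA(\mathcal{G})_k$. The canonical operators of a cell system $W$ are, for $m\ge1$, $$\sum_{\sigma,\beta_i,\gamma_i}\mathcal{U}^{\beta_2,\gamma_2}_{\beta_1,\gamma_1}\,(\sigma\beta_1\gamma_1,\sigma\beta_2\gamma_2)\in A(\mathcal{G})_{m+1},\qquad \mathcal{U}^{\beta_2,\gamma_2}_{\beta_1,\gamma_1}=\sum_\lambda\phi_{s(\beta_2)}^{-1}\phi_{r(\gamma_2)}^{-1}W(\lambda\beta_1\gamma_1)\overline{W(\lambda\beta_2\gamma_2)},$$ the first sum being over the paths $\sigma$ of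 length $m-1$ from $\ast$ and the edges $\beta_i,\gamma_i$ that prolong $\sigma$ to paths with a common end vertex. **The graph $\mathcal{A}^{(n)}$.** Its vertices are the pairs $(\lambda_1,\lambda_2)$ of integers $\ge0$ with $\lambda_1+\lambda_2\le n-3$, its edges go from $(\lambda_1,\lambda_2)$ to those of $(\lambda_1+1,\lambda_2)$, $(\lambda_1-1,\lambda_2+1)$, $(\lambda_1,\lambda_2-1)$ that are vertices, its adjacency matrix is $\Delta_{\mathcal{A}}$, and its distinguished vertex is $\ast_{\mathcal{A}}=(0,0)$. The polynomials $S_{(a,b)}(x,y)\in\mathbb{Z}[x,y]$, $a,b\ge0$, are given by $S_{(0,0)}=1$, $xS_{(a,b)}=S_{(a+1,b)}+S_{(a-1,b+1)}+S_{(a,b-1)}$ and $yS_{(a,b)}=S_{(a-1,b)}+S_{(a+1,b-1)}+S_{(a,b+1)}$, where terms with a negative index are zero. **Proposition.** Let $\mathcal{G}$ be a finite graph in which any two vertices are joined by a directed path, with a distinguished vertex $\ast_{\mathcal{G}}$, a positive vector $\phi$ with $\Delta_{\mathcal{G}}\phi=[3]\phi$ and an Ocneanu cell system (for instance a finite $SU(3)$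 $\mathcal{ADE}$ graph with Coxeter number $n$ and a cell system on it). Let $(W_m)_{m\ge1}$ be the canonical operators in $A(\mathcal{G})$, and let $(U_m)_{m\ge1}$ be the canonical operators in $A(\mathcal{A}^{(n)})$ of any cell system on $\mathcal{A}^{(n)}$. 1. There is exactly one unital algebra homomorphism $\pi:A(\mathcal{A}^{(n)})\to A(\mathcal{G})$ with $\pi(U_m)=W_m$ for all $m\ge1$. It is an injective $*$-homomorphism, it maps $A(\mathcal{A}^{(n)})_k$ into $A(\mathcal{G})_k$ for all $k$, and its range is the algebra generated by $\{\mathbf{1},W_1,W_2,\dots\}$. 2. $\Delta_{\mathcal{G}}$ and $\Delta_{\mathcal{G}}^T$ commute, and there is an integer matrix $V$ with nonnegative entries, with rows indexed by the vertices of $\mathcal{G}$ and columns by the vertices of $\mathcal{A}^{(n)}$, such that (a) $V\Delta_{\mathcal{A}}=\Delta_{\mathcal{G}}V$, (b) $V$ has no zero rows or columns, (c) $V\ast_{\mathcal{A}}=\ast_{\mathcal{G}}$. Its columns are $V_{(\lambda_1,\lambda_2)}=S_{(\lambda_1,\lambda_2)}(\Delta_{\mathcal{G}}^T,\Delta_{\mathcal{G}})V_{(0,0)}$,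 where $V_{(0,0)}$ is the basis vector of $\ast_{\mathcal{G}}$, and $V$ is the only integer matrix that satisfies (a) and (c). -/

import Mathlib

open scoped Matrix ComplexConjugate

universe u v

/-- A directed graph, possibly with loops and multiple edges, with vertex set `V`, edge set `E`,
source map `s` and range map `r`. -/
structure EdgeGraph (V : Type u) (E : Type v) where
  s : E → V
  r : E → V

/-- The quantum integer `[m]_q = (q^m - q^(-m)) / (q - q^(-1))` at `q = exp (π i / n)`. -/
noncomputable def quantumInt (n m : ℕ) : ℝ :=
  Real.sin (m * Real.pi / n) / Real.sin (Real.pi / n)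

namespace EdgeGraph

section basic

variable {V : Type u} {E : Type v} (G : EdgeGraph V E)

/-- Any vertex can be reached from any other one along a directed path. -/
def IsConnected : Prop :=
  ∀ a b : V, Relation.ReflTransGen (fun x y => ∃ e, G.s e = x ∧ G.r e = y) a b

/-- The adjacency matrix: the entry `(i, j)` is the number of edges from `i` to `j`. -/
def adjMat [DecidableEq V] [Fintype E] : Matrix V V ℤ :=
  Matrix.of fun i j => (Fintype.card {e : E // G.s e = i ∧ G.r e = j} : ℤ)

/-- `φ` is a Perron-Frobenius eigenvector of `G` with eigenvalue `[3]_q`, `q = exp (π i / n)`. -/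
structure IsPerronFrobenius [Fintype V] [DecidableEq V] [Fintype E] (n : ℕ) (φ : V → ℝ) :
    Prop where
  pos : ∀ i, 0 < φ i
  eigen : (G.adjMat.map (Int.cast : ℤ → ℝ)) *ᵥ φ = quantumInt n 3 • φ

/-- An Ocneanu cell system. The triangles of `G` are the triples of edges `(a, b, c)`
with `r a = s b`, `r b = s c`, `r c = s a`, up to cyclic rotation; `W` is extended by zero to all
other triples of edges, so that sums over triangles can be written as sums over all edges. -/
structure IsCellSystem [Fintype E] [DecidableEq E] (n : ℕ) (φ : V → ℝ) (W : E → E → E → ℂ) :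
    Prop where
  cyclic : ∀ a b c, W a b c = W b c a
  support : ∀ a b c, W a b c ≠ 0 → G.r a = G.s b ∧ G.r b = G.s c ∧ G.r c = G.s a
  /-- The condition for a pair of edges with common source and common range. -/
  typeI : ∀ a a', G.s a = G.s a' → G.r a = G.r a' →
    ∑ b, ∑ c, W a b c * conj (W a' b c) =
      if a = a' then ((quantumInt n 2 * φ (G.s a) * φ (G.r a) : ℝ) : ℂ) else 0
  /-- The condition for a frame of four edges; the sum is over the ways of filling the frame with
  four triangles around an inner vertex, which is the range of `b`. -/
  typeII : ∀ a₁ a₂ a₃ a₄, G.s a₁ = G.s a₄ → G.s a₂ = G.s a₃ → G.r a₁ = G.r a₂ → G.r a₃ = G.r a₄ →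
    ∑ b, ∑ b', ∑ c, ∑ c', ((φ (G.r b))⁻¹ : ℂ) *
        (W a₁ b c * conj (W a₄ b' c) * W a₃ b' c' * conj (W a₂ b c')) =
      (if a₁ = a₂ ∧ a₃ = a₄ then ((φ (G.s a₁) * φ (G.r a₁) * φ (G.r a₄) : ℝ) : ℂ) else 0) +
      (if a₁ = a₄ ∧ a₂ = a₃ then ((φ (G.s a₁) * φ (G.r a₁) * φ (G.s a₂) : ℝ) : ℂ) else 0)

/-- Paths of length `k` from `x` to `v`. A path of length `k + 1` is its last edge together with
a path of length `k` to the source of that edge. -/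
def PathTo (x : V) : ℕ → V → Type v
  | 0, v => {_p : PUnit.{v + 1} // x = v}
  | k + 1, v => Σ e : {e : E // G.r e = v}, PathTo x k (G.s e.1)

variable {G} in
/-- The last edge of a path of positive length. -/
def PathTo.last {x : V} {k : ℕ} {v : V} (p : G.PathTo x (k + 1) v) : E := p.1.1

variable {G} in
/-- A path of positive length without its last edge. -/
def PathTo.init {x : V} {k : ℕ} {v : V} (p : G.PathTo x (k + 1) v) : G.PathTo x k (G.s p.last) :=
  p.2

instance PathTo.decEq [DecidableEq V] [DecidableEq E] (x : V) :
    (k : ℕ) → (v : V) → DecidableEq (G.PathTo x k v)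
  | 0, v => inferInstanceAs (DecidableEq {_p : PUnit.{v + 1} // x = v})
  | k + 1, v =>
    haveI := fun w => PathTo.decEq x k w
    inferInstanceAs (DecidableEq (Σ e : {e : E // G.r e = v}, G.PathTo x k (G.s e.1)))

instance PathTo.fin [DecidableEq V] [Fintype E] (x : V) :
    (k : ℕ) → (v : V) → Fintype (G.PathTo x k v)
  | 0, v => inferInstanceAs (Fintype {_p : PUnit.{v + 1} // x = v})
  | k + 1, v =>
    haveI := fun w => PathTo.fin x k w
    inferInstanceAs (Fintype (Σ e : {e : E // G.r e = v}, G.PathTo x k (G.s e.1)))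

/-- The `k`-th level of the path algebra: the multi-matrix algebra whose matrix units are the
pairs of paths of length `k` from `x` with a common end vertex. -/
abbrev Level (x : V) (k : ℕ) : Type (max u v) :=
  ∀ v : V, Matrix (G.PathTo x k v) (G.PathTo x k v) ℂ

end basic

section pathAlgebra

variable {V : Type u} {E : Type v} [DecidableEq V] [Fintype E] [DecidableEq E]
  (G : EdgeGraph V E) (x : V)

/-- The inclusion of a level into the next one: the matrix unit `(μ, μ')` is sent to the sum of
all `(μ · e, μ' · e)`. -/
def levelStep (k : ℕ) : G.Level x k →⋆ₐ[ℂ] G.Level x (k + 1) where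
  toFun a := fun v => Matrix.blockDiagonal' fun e : {e : E // G.r e = v} => a (G.s e.1)
  map_one' := by
    funext v
    exact Matrix.blockDiagonal'_one
  map_mul' a b := by
    funext v
    exact Matrix.blockDiagonal'_mul _ _
  map_zero' := by
    funext v
    exact Matrix.blockDiagonal'_zero
  map_add' a b := by
    funext v
    exact Matrix.blockDiagonal'_add _ _
  commutes' c := by
    funext v
    simp only [Pi.algebraMap_apply, Algebra.algebraMap_eq_smul_one]
    exact (Matrix.blockDiagonal'_smul c fun e : {e : E // G.r e = v} =>
      (1 : Matrix (G.PathTo x k (G.s e.1)) (G.PathTo x k (G.s e.1)) ℂ)).trans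
      (congrArg (c • ·) Matrix.blockDiagonal'_one)
  map_star' a := by
    funext v
    exact (Matrix.blockDiagonal'_conjTranspose _).symm

/-- The inclusion of a level into any later one. -/
def levelIncl (i j : ℕ) (h : i ≤ j) : G.Level x i →⋆ₐ[ℂ] G.Level x j :=
  Nat.leRecOn (C := fun j => G.Level x i →⋆ₐ[ℂ] G.Level x j) h
    (fun {k} f => (G.levelStep x k).comp f) (StarAlgHom.id ℂ (G.Level x i))

theorem levelIncl_self (i : ℕ) : G.levelIncl x i i le_rfl = StarAlgHom.id ℂ (G.Level x i) :=
  Nat.leRecOn_self _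

theorem levelIncl_succ (i j : ℕ) (h : i ≤ j) :
    G.levelIncl x i (j + 1) (h.trans (Nat.le_succ j)) =
      (G.levelStep x j).comp (G.levelIncl x i j h) :=
  Nat.leRecOn_succ h _

instance levelSystem : DirectedSystem (G.Level x) (fun i j h => G.levelIncl x i j h) where
  map_self i a := by rw [levelIncl_self]; rfl
  map_map k j i hij hjk a := by
    induction hjk with
    | refl => rw [levelIncl_self]; rfl
    | step hjk ih =>
      rw [levelIncl_succ G x _ _ hjk, levelIncl_succ G x _ _ (hij.trans hjk)]
      simp only [StarAlgHom.comp_apply, ih]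

/-- The path algebra `A(G)` of paths starting at the distinguished vertex `x`: the union of its
levels along the inclusions. -/
def PathAlgebra : Type (max u v) :=
  DirectLimit (G.Level x) (fun i j h => G.levelIncl x i j h)

noncomputable instance pathAlgebraRing : Ring (G.PathAlgebra x) :=
  inferInstanceAs (Ring (DirectLimit (G.Level x) (fun i j h => G.levelIncl x i j h)))

noncomputable instance pathAlgebraAlgebra : Algebra ℂ (G.PathAlgebra x) :=
  letI : Module ℂ (G.PathAlgebra x) :=
    inferInstanceAs (Module ℂ (DirectLimit (G.Level x) (fun i j h => G.levelIncl x i j h)))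
  Algebra.ofModule
    (fun c a b => smul_mul_assoc (β := DirectLimit (G.Level x) (fun i j h => G.levelIncl x i j h))
      c a b)
    (fun c a b => mul_smul_comm (β := DirectLimit (G.Level x) (fun i j h => G.levelIncl x i j h))
      c a b)

noncomputable instance pathAlgebraStarRing : StarRing (G.PathAlgebra x) :=
  letI : StarAddMonoid (DirectLimit (G.Level x) (fun i j h => G.levelIncl x i j h)) :=
    inferInstance
  letI : StarMul (DirectLimit (G.Level x) (fun i j h => G.levelIncl x i j h)) :=
    inferInstance
  { star := fun a => (star a : DirectLimit (G.Level x) (fun i j h => G.levelIncl x i j h))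
    star_involutive := fun a =>
      star_star (R := DirectLimit (G.Level x) (fun i j h => G.levelIncl x i j h)) a
    star_mul := fun a b =>
      star_mul (R := DirectLimit (G.Level x) (fun i j h => G.levelIncl x i j h)) a b
    star_add := fun a b =>
      star_add (R := DirectLimit (G.Level x) (fun i j h => G.levelIncl x i j h)) a b }

/-- The element of the path algebra given by an element of the `k`-th level. -/
def ofLevel (k : ℕ) (a : G.Level x k) : G.PathAlgebra x := ⟦⟨k, a⟩⟧

/-- The coefficient `𝒰^{β₂,γ₂}_{β₁,γ₁}`. -/
noncomputable def heckeCoeff (φ : V → ℝ) (W : E → E → E → ℂ) (b₁ c₁ b₂ c₂ : E) : ℂ :=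
  ∑ l, ((φ (G.s b₂))⁻¹ : ℂ) * ((φ (G.r c₂))⁻¹ : ℂ) * W l b₁ c₁ * conj (W l b₂ c₂)

/-- `∑ 𝒰^{β₂,γ₂}_{β₁,γ₁} (σ · β₁ · γ₁, σ · β₂ · γ₂)`, the sum being over all paths `σ` of length
`k` and pairs of edges that prolong `σ` to paths with a common end vertex. -/
noncomputable def heckeLevel (φ : V → ℝ) (W : E → E → E → ℂ) (k : ℕ) : G.Level x (k + 2) :=
  fun _ => Matrix.of fun p p' =>
    if (⟨_, p.init.init⟩ : Σ w, G.PathTo x k w) = ⟨_, p'.init.init⟩ then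
      G.heckeCoeff φ W p.init.last p.last p'.init.last p'.last
    else 0

/-- The canonical operators of the path algebra, numbered from zero: `heckeOp k` is the operator
`U_{k+1}`, which lies in level `k + 2`. -/
noncomputable def heckeOp (φ : V → ℝ) (W : E → E → E → ℂ) (k : ℕ) : G.PathAlgebra x :=
  G.ofLevel x (k + 2) (G.heckeLevel x φ W k)

end pathAlgebra

end EdgeGraph

/-- The vertices `(λ₁, λ₂)` of the graph `𝒜⁽ⁿ⁾`: `λ₁ + λ₂ ≤ n - 3`. -/
abbrev AVertex (n : ℕ) : Type := {p : ℕ × ℕ // p.1 + p.2 + 3 ≤ n}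

instance AVertex.fin (n : ℕ) : Fintype (AVertex n) :=
  Fintype.subtype ((Finset.range n ×ˢ Finset.range n).filter fun p => p.1 + p.2 + 3 ≤ n) (by
    intro p
    simp only [Finset.mem_filter, Finset.mem_product, Finset.mem_range]
    omega)

/-- The edges of `𝒜⁽ⁿ⁾` go from `(λ₁, λ₂)` to `(λ₁ + 1, λ₂)`, `(λ₁ - 1, λ₂ + 1)` and
`(λ₁, λ₂ - 1)`. -/
abbrev AAdj (p q : ℕ × ℕ) : Prop :=
  q = (p.1 + 1, p.2) ∨ (q.1 + 1, q.2) = (p.1, p.2 + 1) ∨ (q.1, q.2 + 1) = p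

/-- The set of edges of `𝒜⁽ⁿ⁾`. -/
abbrev AEdge (n : ℕ) : Type := {e : AVertex n × AVertex n // AAdj e.1.1 e.2.1}

/-- The graph `𝒜⁽ⁿ⁾`. -/
def graphA (n : ℕ) : EdgeGraph (AVertex n) (AEdge n) where
  s e := e.1.1
  r e := e.1.2

/-- The distinguished vertex `(0, 0)` of `𝒜⁽ⁿ⁾`. -/
def originA (n : ℕ) (hn : 4 ≤ n) : AVertex n := ⟨(0, 0), by simp only; omega⟩

/-- The polynomials `S_{(a, b)}(x, y)` with `x = X 0`, `y = X 1`, determined by `S_{(0,0)} = 1` and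
`x S_{(a,b)} = S_{(a+1,b)} + S_{(a-1,b+1)} + S_{(a,b-1)}`,
`y S_{(a,b)} = S_{(a-1,b)} + S_{(a+1,b-1)} + S_{(a,b+1)}`,
where terms with a negative index are zero. -/
noncomputable def polyS : ℕ → ℕ → MvPolynomial (Fin 2) ℤ
  | 0, 0 => 1
  | 0, 1 => MvPolynomial.X 1 * polyS 0 0
  | 0, b + 2 => MvPolynomial.X 1 * polyS 0 (b + 1) - polyS 1 b
  | 1, 0 => MvPolynomial.X 0 * polyS 0 0
  | 1, b + 1 => MvPolynomial.X 0 * polyS 0 (b + 1) - polyS 0 b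
  | a + 2, 0 => MvPolynomial.X 0 * polyS (a + 1) 0 - polyS a 1
  | a + 2, b + 1 => MvPolynomial.X 0 * polyS (a + 1) (b + 1) - polyS a (b + 2) - polyS (a + 1) b
  termination_by a b => (a + b, a)

/-- The value `p(M, N)` of a polynomial in two variables at two commuting matrices. -/
noncomputable def evalCommuting {ι : Type*} [Fintype ι] [DecidableEq ι]
    (p : MvPolynomial (Fin 2) ℤ) (M N : Matrix ι ι ℤ) : Matrix ι ι ℤ :=
  ∑ d ∈ p.support, p.coeff d • (M ^ d 0 * N ^ d 1)

set_option linter.unusedSectionVars false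
set_option synthInstance.maxSize 512

/-! The canonical operators of every cell system satisfy the same Hecke relations, and they lie in a
path algebra with a faithful Markov trace, so that the traces of words in them do not depend on the
graph. Type I makes each operator [2] times a projection. Type II shows that `U_k U_{k+1} U_k - U_k`
and `U_{k+1} U_k U_{k+1} - U_{k+1}` are the same operator: on the prolongations of each initial path
it has rank one, with the cells of the triangles based at its end as coefficients. The trace of
level k weights the end vertices by φ. The eigenvector equation makes it compatible with the
inclusions, positivity of φ makes it faithful, and type I gives tr(z U_k) = ([2]/[3]) tr(z) for z
generated by the earlier operators. The Hecke relations reduce words to ones with at most one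
occurrence of the last generator, so trace and Markov property fix all values
(`markov_trace_eq_zero`).

Now take the subalgebra of A(𝒜) × A(G) generated by the pairs (U_m, W_m). It is closed under star
and the traces of the two coordinates agree on it, so by faithfulness one coordinate vanishes
exactly when the other does (`fst_eq_zero_iff`). It is therefore the graph of an injective
*-homomorphism, defined on the algebra generated by the U_m. For 𝒜⁽ⁿ⁾ that algebra is everything:
`eq_top_of_step_of_hecke` produces all matrix units of a level from the previous level and one
canonical operator. The necessary nonvanishing of cells follows from types I and II, because 𝒜⁽ⁿ⁾
has no multiple edges and two distinct vertices have at most one common successor.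

For the second part, restrict π to the levels and count multiplicities m_k(j, v) of blocks
(`exists_branching`). Block traces of a U_{k+1}, for a in level k, are [2] times sums of block
traces of a over edges, whence m_{k+2} Δ_𝒜 = Δ_G m_k. Block traces of a (U_{k+1} U_{k+2} U_{k+1} -
U_{k+1}) are [2][3] times those of a, whence m_{k+3} = m_k. The multiplicities thus depend on
vertices only and form the intertwiner V.

Normality of Δ_G comes from reading type II as a Gram identity with positive definite right-hand
side. This gives Δ Δᵀ ≤ Δᵀ Δ entrywise (`card_cospan_le`), and both sides have the same Frobenius
norm. A Fuglede-Putnam argument then shows that every integer intertwiner also intertwines the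
transposes, so its columns obey both recursions of the polynomials S and are determined by the
column of the origin. -/

namespace EdgeGraph

/-! ### Paths and sums over paths -/

section paths

variable {V : Type u} {E : Type v} (G : EdgeGraph V E)

/-- Paths of length `k` from `x`, with any end vertex. -/
abbrev Path (x : V) (k : ℕ) : Type (max u v) := Σ v, G.PathTo x k v

variable {G} {x : V} {k : ℕ}

/-- The path without its last edge. -/
def Path.init (p : G.Path x (k + 1)) : G.Path x k := ⟨_, p.2.init⟩

/-- The last edge. -/
def Path.last (p : G.Path x (k + 1)) : E := p.2.last

theorem Path.r_last (p : G.Path x (k + 1)) : G.r p.last = p.1 := p.2.1.2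

theorem Path.s_last (p : G.Path x (k + 1)) : G.s p.last = p.init.1 := rfl

/-- Prolong a path by an edge. -/
def Path.snoc (p : G.Path x k) (e : E) (h : G.s e = p.1) : G.Path x (k + 1) :=
  ⟨G.r e, ⟨⟨e, rfl⟩, h ▸ p.2⟩⟩

@[simp] theorem Path.last_snoc (p : G.Path x k) (e : E) (h : G.s e = p.1) :
    (p.snoc e h).last = e := rfl

@[simp] theorem Path.init_snoc (p : G.Path x k) (e : E) (h : G.s e = p.1) :
    (p.snoc e h).init = p := by
  obtain ⟨v, p⟩ := p
  change G.s e = v at h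
  subst h
  rfl

theorem Path.snoc_init_last (p : G.Path x (k + 1)) : p.init.snoc p.last rfl = p := by
  obtain ⟨v, ⟨⟨e, rfl⟩, p⟩⟩ := p
  rfl

theorem Path.ext_succ {p q : G.Path x (k + 1)} (h : p.init = q.init) (h' : p.last = q.last) :
    p = q := by
  have key : ∀ (a b : G.Path x k) (e f : E) (ha : G.s e = a.1) (hb : G.s f = b.1), a = b → e = f →
      a.snoc e ha = b.snoc f hb := by
    rintro a b e f ha hb rfl rfl
    rfl
  rw [← p.snoc_init_last, ← q.snoc_init_last]
  exact key _ _ _ _ _ _ h h'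

theorem Path.eq_of_zero (p q : G.Path x 0) : p = q := by
  obtain ⟨v, ⟨_, rfl⟩⟩ := p
  obtain ⟨w, ⟨_, rfl⟩⟩ := q
  rfl

theorem Path.fst_zero (p : G.Path x 0) : p.1 = x := p.2.2.symm

/-- A path of positive length is a path and an edge that prolongs it. -/
def Path.succEquiv (G : EdgeGraph V E) (x : V) (k : ℕ) :
    G.Path x (k + 1) ≃ {a : G.Path x k × E // G.s a.2 = a.1.1} where
  toFun p := ⟨(p.init, p.last), rfl⟩
  invFun a := a.1.1.snoc a.1.2 a.2
  left_inv p := p.snoc_init_last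
  right_inv a := by
    obtain ⟨⟨p, e⟩, h⟩ := a
    simp

variable [Fintype V] [DecidableEq V] [Fintype E]

theorem Path.sum_succ {M : Type*} [AddCommMonoid M] (f : G.Path x k → E → M) :
    ∑ p : G.Path x (k + 1), f p.init p.last =
      ∑ p : G.Path x k, ∑ e, if G.s e = p.1 then f p e else 0 := by
  have h : ∑ p : G.Path x (k + 1), f p.init p.last =
      ∑ a : {a : G.Path x k × E // G.s a.2 = a.1.1}, f a.1.1 a.1.2 :=
    (Path.succEquiv G x k).sum_comp (fun a => f a.1.1 a.1.2)
  rw [h, ← Fintype.sum_prod_type' (fun (p : G.Path x k) e => if G.s e = p.1 then f p e else 0),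
    ← Finset.sum_filter, ← Finset.sum_subtype_eq_sum_filter]
  simp only [Finset.subtype_univ]

/-- Cells vanish off triangles, so the summands met below vanish unless the edge prolongs the path.
Sums over paths then become free sums over edges, to which the cell conditions apply. -/
theorem Path.sum_succ_of_support {M : Type*} [AddCommMonoid M] (f : G.Path x k → E → M)
    (hf : ∀ p e, f p e ≠ 0 → G.s e = p.1) :
    ∑ p : G.Path x (k + 1), f p.init p.last = ∑ p : G.Path x k, ∑ e, f p e := by
  rw [Path.sum_succ]
  refine Finset.sum_congr rfl fun p _ => Finset.sum_congr rfl fun e _ => ?_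
  split_ifs with h
  · rfl
  · by_contra h'
    exact h (hf p e (Ne.symm h'))

theorem Path.sum_succ_succ_of_support {M : Type*} [AddCommMonoid M]
    (f : G.Path x k → E → E → M)
    (hf : ∀ p b c, f p b c ≠ 0 → G.s b = p.1 ∧ G.r b = G.s c) :
    ∑ p : G.Path x (k + 2), f p.init.init p.init.last p.last =
      ∑ p : G.Path x k, ∑ b, ∑ c, f p b c := by
  rw [Path.sum_succ (fun (p : G.Path x (k + 1)) c => f p.init p.last c)]
  have h : ∀ p : G.Path x (k + 1), (∑ c, if G.s c = p.1 then f p.init p.last c else 0) =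
      ∑ c, f p.init p.last c := by
    intro p
    refine Finset.sum_congr rfl fun c _ => ?_
    split_ifs with h
    · rfl
    · by_contra h'
      exact h (((hf _ _ _ (Ne.symm h')).2.symm).trans p.r_last)
  simp only [h]
  refine Path.sum_succ_of_support (fun p b => ∑ c, f p b c) fun p b h => ?_
  obtain ⟨c, -, hc⟩ := Finset.exists_ne_zero_of_sum_ne_zero h
  exact (hf _ _ _ hc).1

end paths

/-! ### Levels as matrices over all paths of a given length -/

section levels

variable {V : Type u} {E : Type v} [Fintype V] [DecidableEq V] [Fintype E] [DecidableEq E]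
  {G : EdgeGraph V E} {x : V} {k : ℕ}

/-- An element of a level as a matrix indexed by all paths of length `k`. -/
def total : G.Level x k →+* Matrix (G.Path x k) (G.Path x k) ℂ :=
  Matrix.blockDiagonal'RingHom _ _

theorem total_apply (a : G.Level x k) (p q : G.Path x k) :
    total a p q = if h : p.1 = q.1 then a p.1 p.2 (cast (congrArg _ h.symm) q.2) else 0 :=
  Matrix.blockDiagonal'_apply a p q

theorem total_apply_mk (a : G.Level x k) (v : V) (p q : G.PathTo x k v) :
    total a ⟨v, p⟩ ⟨v, q⟩ = a v p q :=
  Matrix.blockDiagonal'_apply_eq a v p q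

theorem total_apply_ne (a : G.Level x k) {p q : G.Path x k} (h : p.1 ≠ q.1) : total a p q = 0 := by
  rw [total_apply, dif_neg h]

theorem level_ext {a b : G.Level x k}
    (h : ∀ p q : G.Path x k, p.1 = q.1 → total a p q = total b p q) : a = b := by
  funext v
  ext p q
  simpa only [total_apply_mk] using h ⟨v, p⟩ ⟨v, q⟩ rfl

theorem total_mul_apply (a b : G.Level x k) (p q : G.Path x k) :
    total (a * b) p q = ∑ r, total a p r * total b r q := by
  rw [map_mul, Matrix.mul_apply]

theorem total_star_apply (a : G.Level x k) (p q : G.Path x k) :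
    total (star a) p q = conj (total a q p) := by
  change Matrix.blockDiagonal' (fun v => (a v)ᴴ) p q = _
  rw [← Matrix.blockDiagonal'_conjTranspose]
  rfl

theorem total_one_apply (p q : G.Path x k) :
    total (1 : G.Level x k) p q = if p = q then 1 else 0 := by
  rw [map_one, Matrix.one_apply]

theorem total_smul_apply (c : ℂ) (a : G.Level x k) (p q : G.Path x k) :
    total (c • a) p q = c * total a p q := by
  change Matrix.blockDiagonal' (c • a) p q = _
  rw [Matrix.blockDiagonal'_smul]
  rfl

theorem total_add_apply (a b : G.Level x k) (p q : G.Path x k) :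
    total (a + b) p q = total a p q + total b p q := by
  rw [map_add, Matrix.add_apply]

theorem total_sub_apply (a b : G.Level x k) (p q : G.Path x k) :
    total (a - b) p q = total a p q - total b p q := by
  rw [map_sub, Matrix.sub_apply]

theorem total_levelStep (a : G.Level x k) (p q : G.Path x (k + 1)) :
    total (G.levelStep x k a) p q = if p.last = q.last then total a p.init q.init else 0 := by
  by_cases h : p.1 = q.1
  · obtain ⟨v, ⟨⟨e, he⟩, p⟩⟩ := p
    obtain ⟨w, ⟨⟨f, hf⟩, q⟩⟩ := q
    change v = w at h
    subst h
    refine (total_apply_mk (G.levelStep x k a) v (⟨⟨e, he⟩, p⟩ : G.PathTo x (k + 1) v)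
      (⟨⟨f, hf⟩, q⟩ : G.PathTo x (k + 1) v)).trans ?_
    change Matrix.blockDiagonal' (fun e : {e : E // G.r e = v} => a (G.s e.1)) ⟨⟨e, he⟩, p⟩
      ⟨⟨f, hf⟩, q⟩ = if e = f then total a ⟨G.s e, p⟩ ⟨G.s f, q⟩ else 0
    by_cases hef : e = f
    · subst hef
      rw [if_pos rfl, Matrix.blockDiagonal'_apply_eq, total_apply_mk]
    · rw [if_neg hef, Matrix.blockDiagonal'_apply_ne]
      simpa using hef
  · rw [total_apply_ne _ h, if_neg]
    intro h'
    exact h (by rw [← p.r_last, ← q.r_last, h'])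

theorem trace_block (a : G.Level x k) (j : V) :
    (a j).trace = ∑ p : G.Path x k, if p.1 = j then total a p p else 0 := by
  rw [Fintype.sum_sigma, Finset.sum_eq_single j]
  · simp only [if_true, total_apply_mk]
    rfl
  · intro v _ hv
    simp [hv]
  · simp

theorem sum_trace_block (a : G.Level x k) (c : V → ℂ) :
    ∑ j, c j * (a j).trace = ∑ p : G.Path x k, c p.1 * total a p p := by
  rw [Fintype.sum_sigma]
  refine Finset.sum_congr rfl fun v _ => ?_
  rw [Matrix.trace, Finset.mul_sum]
  refine Finset.sum_congr rfl fun p _ => ?_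
  rw [total_apply_mk]
  rfl

end levels

end EdgeGraph

namespace EdgeGraph

/-! ### Reordering of iterated sums -/

section reindex

variable {ι M : Type*} [Fintype ι] [AddCommMonoid M]

theorem sum_reindex_four (F : ι → ι → ι → ι → M) :
    ∑ b, ∑ c, ∑ l, ∑ l', F b c l l' = ∑ l, ∑ l', ∑ b, ∑ c, F b c l l' := by
  have h1 : ∀ b, ∑ c, ∑ l, ∑ l', F b c l l' = ∑ l, ∑ l', ∑ c, F b c l l' := by
    intro b
    rw [Finset.sum_comm]
    exact Finset.sum_congr rfl fun l _ => Finset.sum_comm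
  simp only [h1]
  rw [Finset.sum_comm]
  exact Finset.sum_congr rfl fun l _ => Finset.sum_comm

theorem sum_reindex_three (F : ι → ι → ι → M) :
    ∑ a, ∑ b, ∑ c, F a b c = ∑ c, ∑ a, ∑ b, F a b c := by
  rw [Finset.sum_comm' (t' := Finset.univ) (s' := fun _ => Finset.univ) (by simp)]
  have h1 : ∀ b, ∑ a, ∑ c, F a b c = ∑ c, ∑ a, F a b c := fun b => Finset.sum_comm
  simp only [h1]
  rw [Finset.sum_comm]
  exact Finset.sum_congr rfl fun c _ => Finset.sum_comm

theorem sum_reindex_six (F : ι → ι → ι → ι → ι → ι → M) :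
    ∑ p, ∑ q', ∑ q, ∑ l, ∑ m, ∑ l', F p q' q l m l' =
      ∑ l, ∑ l', ∑ p, ∑ m, ∑ q', ∑ q, F p q' q l m l' := by
  have h1 : ∀ p, ∑ q', ∑ q, ∑ l, ∑ m, ∑ l', F p q' q l m l' =
      ∑ l, ∑ m, ∑ q', ∑ q, ∑ l', F p q' q l m l' := fun p => sum_reindex_four _
  simp only [h1]
  rw [Finset.sum_comm]
  refine Finset.sum_congr rfl fun l _ => ?_
  have h2 : ∀ p m, ∑ q', ∑ q, ∑ l', F p q' q l m l' = ∑ l', ∑ q', ∑ q, F p q' q l m l' :=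
    fun p m => sum_reindex_three _
  simp only [h2]
  exact sum_reindex_three _

theorem sum_reindex_six' (F : ι → ι → ι → ι → ι → ι → M) :
    ∑ q', ∑ z, ∑ q, ∑ l, ∑ m, ∑ l', F q' z q l m l' =
      ∑ l, ∑ l', ∑ q', ∑ q, ∑ z, ∑ m, F q' z q l m l' := by
  rw [sum_reindex_six]
  refine Finset.sum_congr rfl fun l _ => Finset.sum_congr rfl fun l' _ =>
    Finset.sum_congr rfl fun q' _ => ?_
  rw [sum_reindex_three]
  exact Finset.sum_congr rfl fun q _ => Finset.sum_comm

end reindex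

/-! ### Kernels of the canonical operators -/

section cells

variable {V : Type u} {E : Type v} [DecidableEq V] [Fintype E] [DecidableEq E]
  {G : EdgeGraph V E} {n : ℕ} {φ : V → ℝ} {W : E → E → E → ℂ}

/-- The weight `1 / (φ_{r(l)} φ_{s(l)})` of an edge. -/
noncomputable def edgeWeight (G : EdgeGraph V E) (φ : V → ℝ) (l : E) : ℂ :=
  ((φ (G.r l))⁻¹ : ℂ) * ((φ (G.s l))⁻¹ : ℂ)

/-- The Hecke coefficients, with weights that depend on the inner edge only. -/
noncomputable def cellKernel (G : EdgeGraph V E) (φ : V → ℝ) (W : E → E → E → ℂ)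
    (b c b' c' : E) : ℂ :=
  ∑ l, G.edgeWeight φ l * W l b c * conj (W l b' c')

theorem edgeWeight_mul (hpos : ∀ i, 0 < φ i) (l : E) :
    G.edgeWeight φ l * ((φ (G.s l) : ℂ) * (φ (G.r l) : ℂ)) = 1 := by
  have h1 : (φ (G.s l) : ℂ) ≠ 0 := by exact_mod_cast (hpos _).ne'
  have h2 : (φ (G.r l) : ℂ) ≠ 0 := by exact_mod_cast (hpos _).ne'
  rw [edgeWeight]
  field_simp

theorem conj_edgeWeight (l : E) : conj (G.edgeWeight φ l) = G.edgeWeight φ l := by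
  simp [edgeWeight]

theorem cellKernel_ne_zero {b c b' c' : E} (h : G.cellKernel φ W b c b' c' ≠ 0) :
    ∃ l, W l b c ≠ 0 ∧ W l b' c' ≠ 0 := by
  obtain ⟨l, -, hl⟩ := Finset.exists_ne_zero_of_sum_ne_zero h
  refine ⟨l, ?_, ?_⟩
  · rintro h
    simp [h] at hl
  · rintro h
    simp [h] at hl

namespace IsCellSystem

variable (hW : G.IsCellSystem n φ W)
include hW

theorem support_kernel {b c b' c' : E} (h : G.cellKernel φ W b c b' c' ≠ 0) :
    G.r b = G.s c ∧ G.r b' = G.s c' ∧ G.r c = G.r c' ∧ G.s b = G.s b' := by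
  obtain ⟨l, h1, h2⟩ := cellKernel_ne_zero h
  obtain ⟨h3, h4, h5⟩ := hW.support _ _ _ h1
  obtain ⟨h3', h4', h5'⟩ := hW.support _ _ _ h2
  exact ⟨h4, h4', h5.trans h5'.symm, h3.symm.trans h3'⟩

/-- A nonzero cell `W l b' c'` closes a triangle, so the weight of the coefficient only involves the
two ends of `l`. In this form the kernel is visibly Hermitian, a weighted sum of rank one terms over
`l`. -/
theorem heckeCoeff_eq (b c b' c' : E) :
    G.heckeCoeff φ W b c b' c' = G.cellKernel φ W b c b' c' := by
  refine Finset.sum_congr rfl fun l _ => ?_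
  by_cases h : W l b' c' = 0
  · simp [h]
  · obtain ⟨h1, -, h2⟩ := hW.support _ _ _ h
    rw [edgeWeight, h1, h2]

theorem conj_cellKernel (b c b' c' : E) :
    conj (G.cellKernel φ W b c b' c') = G.cellKernel φ W b' c' b c := by
  simp only [cellKernel, map_sum, map_mul, conj_edgeWeight, Complex.conj_conj]
  exact Finset.sum_congr rfl fun l _ => by ring

theorem sum_mul_conj (a a' : E) :
    ∑ b, ∑ c, W a b c * conj (W a' b c) =
      if a = a' then (quantumInt n 2 : ℂ) * ((φ (G.s a) : ℂ) * (φ (G.r a) : ℂ)) else 0 := by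
  by_cases h : G.s a = G.s a' ∧ G.r a = G.r a'
  · rw [hW.typeI a a' h.1 h.2]
    split_ifs
    · push_cast
      ring
    · rfl
  · rw [if_neg (by rintro rfl; exact h ⟨rfl, rfl⟩)]
    refine Finset.sum_eq_zero fun b _ => Finset.sum_eq_zero fun c _ => ?_
    by_contra h'
    obtain ⟨h1, h2⟩ := mul_ne_zero_iff.1 h'
    obtain ⟨h3, -, h5⟩ := hW.support _ _ _ h1
    obtain ⟨h3', -, h5'⟩ := hW.support a' b c fun h => h2 (by rw [h, map_zero])
    exact h ⟨h5.symm.trans h5', h3.trans h3'.symm⟩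

/-- By type I the vectors `W l` are orthogonal, and the square of the norm of `W l` is [2] divided
by the weight of `l`. The kernel is therefore [2] times the projection onto their span. -/
theorem sum_cellKernel_mul (hpos : ∀ i, 0 < φ i) (b₁ c₁ b₂ c₂ : E) :
    ∑ b, ∑ c, G.cellKernel φ W b₁ c₁ b c * G.cellKernel φ W b c b₂ c₂ =
      (quantumInt n 2 : ℂ) * G.cellKernel φ W b₁ c₁ b₂ c₂ := by
  have h : ∀ l l', ∑ b, ∑ c, conj (W l b c) * W l' b c =
      if l' = l then (quantumInt n 2 : ℂ) * ((φ (G.s l') : ℂ) * (φ (G.r l') : ℂ)) else 0 := by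
    intro l l'
    rw [← hW.sum_mul_conj]
    simp only [mul_comm]
  calc _ = ∑ b, ∑ c, ∑ l, ∑ l', G.edgeWeight φ l * W l b₁ c₁ *
        (G.edgeWeight φ l' * conj (W l' b₂ c₂)) * (conj (W l b c) * W l' b c) := by
        simp only [cellKernel, Finset.sum_mul_sum]
        refine Finset.sum_congr rfl fun b _ => Finset.sum_congr rfl fun c _ =>
          Finset.sum_congr rfl fun l _ => Finset.sum_congr rfl fun l' _ => by ring
    _ = ∑ l, ∑ l', ∑ b, ∑ c, G.edgeWeight φ l * W l b₁ c₁ *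
        (G.edgeWeight φ l' * conj (W l' b₂ c₂)) * (conj (W l b c) * W l' b c) := by
        exact sum_reindex_four _
    _ = _ := by
        simp only [← Finset.mul_sum, h, mul_ite, mul_zero, Finset.sum_ite_eq', Finset.mem_univ,
          if_true]
        rw [cellKernel, Finset.mul_sum]
        refine Finset.sum_congr rfl fun l _ => ?_
        linear_combination ((quantumInt n 2 : ℂ) * G.edgeWeight φ l * W l b₁ c₁ * conj (W l b₂ c₂)) *
          edgeWeight_mul hpos l

/-- Rotating the triangles until `b` and `b'` come first turns the weighted sum over `c` into type I
for this pair. The Markov property of the trace rests on this partial trace. -/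
theorem sum_range_cellKernel (hpos : ∀ i, 0 < φ i) (b b' : E) :
    ∑ c, (φ (G.r c) : ℂ) * G.cellKernel φ W b c b' c =
      if b = b' then (quantumInt n 2 : ℂ) * (φ (G.r b) : ℂ) else 0 := by
  have hne : ∀ i, (φ i : ℂ) ≠ 0 := fun i => by exact_mod_cast (hpos i).ne'
  calc _ = ((φ (G.s b))⁻¹ : ℂ) * ∑ c, ∑ l, W b c l * conj (W b' c l) := by
        rw [Finset.mul_sum]
        refine Finset.sum_congr rfl fun c _ => ?_
        rw [cellKernel, Finset.mul_sum, Finset.mul_sum]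
        refine Finset.sum_congr rfl fun l _ => ?_
        rw [← hW.cyclic l b c, ← hW.cyclic l b' c]
        by_cases h : W l b c = 0
        · simp [h]
        · obtain ⟨h1, -, h2⟩ := hW.support _ _ _ h
          rw [edgeWeight, h1, h2]
          field_simp [hne]
    _ = _ := by
        rw [hW.sum_mul_conj]
        split_ifs
        · field_simp [hne]
        · simp

/-- The kernel of `U_k U_{k+1} U_k - U_k`. -/
theorem braid_left (hpos : ∀ i, 0 < φ i) {a b c a' b' c' : E} (hbc : G.r b = G.s c)
    (hbc' : G.r b' = G.s c') (hs : G.s a = G.s a') (hr : G.r c = G.r c') :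
    ∑ p, ∑ q', ∑ q, G.cellKernel φ W a b p q * G.cellKernel φ W q c q' c' *
        G.cellKernel φ W p q' a' b' =
      (if c = c' then G.cellKernel φ W a b a' b' else 0) +
        ((φ (G.s a))⁻¹ : ℂ) ^ 2 * (W a b c * conj (W a' b' c')) := by
  have hne : ∀ i, (φ i : ℂ) ≠ 0 := fun i => by exact_mod_cast (hpos i).ne'
  -- For fixed `l` and `l'` the inner sum is type II for the frame `l'`, `l`, `c`, `c'`. The weight
  -- of `m` splits into the constant at the range of `c` and the type II weight of the inner vertex.
  -- Of the two delta terms the first will reproduce U_k and the second is the triangle term.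
  have h2 : ∀ l l', W l a b * conj (W l' a' b') * (∑ p, ∑ m, ∑ q', ∑ q,
        G.edgeWeight φ m * (conj (W l p q) * W m q c * conj (W m q' c') * W l' p q')) =
      W l a b * conj (W l' a' b') * (((φ (G.r c))⁻¹ : ℂ) *
        ((if l' = l ∧ c = c' then ((φ (G.s l') * φ (G.r l') * φ (G.r c') : ℝ) : ℂ) else 0) +
        (if l' = c' ∧ l = c then ((φ (G.s l') * φ (G.r l') * φ (G.s l) : ℝ) : ℂ) else 0))) := by
    intro l l'
    by_cases h : W l a b = 0
    · simp [h]
    by_cases h' : W l' a' b' = 0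
    · simp [h']
    obtain ⟨h3, h4, h5⟩ := hW.support _ _ _ h
    obtain ⟨h3', h4', h5'⟩ := hW.support _ _ _ h'
    congr 1
    rw [← hW.typeII l' l c c' (h5'.symm.trans hbc') (h5.symm.trans hbc)
      (h3'.trans (hs.symm.trans h3.symm)) hr, Finset.mul_sum]
    refine Finset.sum_congr rfl fun p _ => ?_
    rw [Finset.mul_sum]
    refine Finset.sum_congr rfl fun m _ => ?_
    rw [Finset.mul_sum]
    refine Finset.sum_congr rfl fun q' _ => ?_
    rw [Finset.mul_sum]
    refine Finset.sum_congr rfl fun q _ => ?_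
    rw [hW.cyclic m q c, hW.cyclic q c m, hW.cyclic m q' c', hW.cyclic q' c' m]
    by_cases hz : W c m q = 0
    · simp [hz]
    by_cases hz' : W l p q = 0
    · simp [hz']
    obtain ⟨h6, h7, h8⟩ := hW.support _ _ _ hz
    obtain ⟨h9, h10, h11⟩ := hW.support _ _ _ hz'
    rw [edgeWeight, h7, ← h10, ← h6]
    ring
  calc _ = ∑ p, ∑ q', ∑ q, ∑ l, ∑ m, ∑ l', G.edgeWeight φ l * G.edgeWeight φ l' *
        (W l a b * conj (W l' a' b') *
        (G.edgeWeight φ m * (conj (W l p q) * W m q c * conj (W m q' c') * W l' p q'))) := by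
        refine Finset.sum_congr rfl fun p _ => Finset.sum_congr rfl fun q' _ =>
          Finset.sum_congr rfl fun q _ => ?_
        simp only [cellKernel]
        rw [Finset.sum_mul_sum, Finset.sum_mul]
        refine Finset.sum_congr rfl fun l _ => ?_
        rw [Finset.sum_mul]
        refine Finset.sum_congr rfl fun m _ => ?_
        rw [Finset.mul_sum]
        exact Finset.sum_congr rfl fun l' _ => by ring
    _ = ∑ l, ∑ l', ∑ p, ∑ m, ∑ q', ∑ q, G.edgeWeight φ l * G.edgeWeight φ l' *
        (W l a b * conj (W l' a' b') *
        (G.edgeWeight φ m * (conj (W l p q) * W m q c * conj (W m q' c') * W l' p q'))) := by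
        exact sum_reindex_six _
    _ = ∑ l, ∑ l', ((if l' = l then (if c = c' then
          G.edgeWeight φ l * W l a b * conj (W l a' b') else 0) else 0) +
          (if l' = c' then (if l = c then
            ((φ (G.r c))⁻¹ : ℂ) ^ 2 * (W l a b * conj (W l' a' b')) else 0) else 0)) := by
        refine Finset.sum_congr rfl fun l _ => Finset.sum_congr rfl fun l' _ => ?_
        simp only [← Finset.mul_sum] at h2 ⊢
        rw [h2, mul_add, mul_add, mul_add]
        congr 1
        · by_cases e1 : l' = l
          · by_cases e2 : c = c'
            · subst e1 e2
              simp only [and_self, if_true]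
              push_cast
              have := edgeWeight_mul (G := G) hpos l'
              have h3 : ((φ (G.r c))⁻¹ : ℂ) * (φ (G.r c) : ℂ) = 1 := inv_mul_cancel₀ (hne _)
              linear_combination (G.edgeWeight φ l' * W l' a b * conj (W l' a' b') *
                (((φ (G.r c))⁻¹ : ℂ) * (φ (G.r c) : ℂ))) * this +
                (G.edgeWeight φ l' * W l' a b * conj (W l' a' b')) * h3
            · simp [e2]
          · simp [e1]
        · by_cases e1 : l' = c'
          · by_cases e2 : l = c
            · subst e1 e2
              simp only [and_self, if_true]
              push_cast
              rw [edgeWeight, edgeWeight, ← hr]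
              field_simp [hne]
            · simp [e2]
          · simp [e1]
    _ = _ := by
        simp only [Finset.sum_add_distrib, Finset.sum_ite_eq', Finset.mem_univ, if_true]
        congr 1
        · split_ifs
          · rfl
          · simp
        · rw [hW.cyclic c a b, hW.cyclic c' a' b']
          by_cases hz : W a b c = 0
          · simp [hz]
          · rw [(hW.support _ _ _ hz).2.2]

/-- The kernel of `U_{k+1} U_k U_{k+1} - U_{k+1}`. -/
theorem braid_right (hpos : ∀ i, 0 < φ i) {a b c a' b' c' : E} (hab : G.r a = G.s b)
    (hab' : G.r a' = G.s b') (hs : G.s a = G.s a') (hr : G.r c = G.r c') :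
    ∑ q', ∑ z, ∑ q, G.cellKernel φ W b c q z * G.cellKernel φ W a q a' q' *
        G.cellKernel φ W q' z b' c' =
      (if a = a' then G.cellKernel φ W b c b' c' else 0) +
        ((φ (G.s a))⁻¹ : ℂ) ^ 2 * (W a b c * conj (W a' b' c')) := by
  have hne : ∀ i, (φ i : ℂ) ≠ 0 := fun i => by exact_mod_cast (hpos i).ne'
  -- The frame is now `l'`, `a'`, `a`, `l`, which exchanges the roles of the delta terms: the first
  -- gives the triangle term, the second reproduces U_{k+1}.
  have h2 : ∀ l l', W l b c * conj (W l' b' c') * (∑ q', ∑ q, ∑ z, ∑ m,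
        G.edgeWeight φ m * (conj (W l q z) * W m a q * conj (W m a' q') * W l' q' z)) =
      W l b c * conj (W l' b' c') * (((φ (G.s a))⁻¹ : ℂ) *
        ((if l' = a' ∧ a = l then ((φ (G.s l') * φ (G.r l') * φ (G.r l) : ℝ) : ℂ) else 0) +
        (if l' = l ∧ a' = a then ((φ (G.s l') * φ (G.r l') * φ (G.s a') : ℝ) : ℂ) else 0))) := by
    intro l l'
    by_cases h : W l b c = 0
    · simp [h]
    by_cases h' : W l' b' c' = 0
    · simp [h']
    obtain ⟨h3, h4, h5⟩ := hW.support _ _ _ h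
    obtain ⟨h3', h4', h5'⟩ := hW.support _ _ _ h'
    congr 1
    rw [← hW.typeII l' a' a l (h5'.symm.trans (hr.symm.trans h5)) hs.symm
      (h3'.trans hab'.symm) (hab.trans h3.symm), Finset.mul_sum]
    refine Finset.sum_congr rfl fun q' _ => ?_
    rw [Finset.mul_sum]
    refine Finset.sum_congr rfl fun q _ => ?_
    rw [Finset.mul_sum]
    refine Finset.sum_congr rfl fun z _ => ?_
    rw [Finset.mul_sum]
    refine Finset.sum_congr rfl fun m _ => ?_
    rw [hW.cyclic m a q, hW.cyclic m a' q']
    by_cases hz : W a q m = 0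
    · simp [hz]
    by_cases hz' : W a' q' m = 0
    · simp [hz']
    obtain ⟨h6, h7, h8⟩ := hW.support _ _ _ hz
    obtain ⟨h9, h10, h11⟩ := hW.support _ _ _ hz'
    rw [edgeWeight, h10, ← h8]
    ring
  calc _ = ∑ q', ∑ z, ∑ q, ∑ l, ∑ m, ∑ l', G.edgeWeight φ l * G.edgeWeight φ l' *
        (W l b c * conj (W l' b' c') *
        (G.edgeWeight φ m * (conj (W l q z) * W m a q * conj (W m a' q') * W l' q' z))) := by
        refine Finset.sum_congr rfl fun q' _ => Finset.sum_congr rfl fun z _ =>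
          Finset.sum_congr rfl fun q _ => ?_
        simp only [cellKernel]
        rw [Finset.sum_mul_sum, Finset.sum_mul]
        refine Finset.sum_congr rfl fun l _ => ?_
        rw [Finset.sum_mul]
        refine Finset.sum_congr rfl fun m _ => ?_
        rw [Finset.mul_sum]
        exact Finset.sum_congr rfl fun l' _ => by ring
    _ = ∑ l, ∑ l', ∑ q', ∑ q, ∑ z, ∑ m, G.edgeWeight φ l * G.edgeWeight φ l' *
        (W l b c * conj (W l' b' c') *
        (G.edgeWeight φ m * (conj (W l q z) * W m a q * conj (W m a' q') * W l' q' z))) := by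
        exact sum_reindex_six' _
    _ = ∑ l, ∑ l', ((if l' = l then (if a = a' then
          G.edgeWeight φ l * W l b c * conj (W l b' c') else 0) else 0) +
          (if l' = a' then (if l = a then
            ((φ (G.s a))⁻¹ : ℂ) ^ 2 * (W l b c * conj (W l' b' c')) else 0) else 0)) := by
        refine Finset.sum_congr rfl fun l _ => Finset.sum_congr rfl fun l' _ => ?_
        simp only [← Finset.mul_sum] at h2 ⊢
        rw [h2, mul_add, mul_add, mul_add, add_comm]
        congr 1
        · by_cases e1 : l' = l
          · by_cases e2 : a = a'
            · subst e1 e2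
              simp only [and_self, if_true]
              push_cast
              have := edgeWeight_mul (G := G) hpos l'
              have h3 : ((φ (G.s a))⁻¹ : ℂ) * (φ (G.s a) : ℂ) = 1 := inv_mul_cancel₀ (hne _)
              linear_combination (G.edgeWeight φ l' * W l' b c * conj (W l' b' c') *
                (((φ (G.s a))⁻¹ : ℂ) * (φ (G.s a) : ℂ))) * this +
                (G.edgeWeight φ l' * W l' b c * conj (W l' b' c')) * h3
            · simp [e2, Ne.symm e2]
          · simp [e1]
        · by_cases e1 : l' = a'
          · by_cases e2 : l = a
            · subst e1 e2
              simp only [and_self, if_true]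
              push_cast
              rw [edgeWeight, edgeWeight, ← hs]
              field_simp [hne]
            · simp [e2, Ne.symm e2]
          · simp [e1]
    _ = _ := by
        simp only [Finset.sum_add_distrib, Finset.sum_ite_eq', Finset.mem_univ, if_true]
        congr 1
        split_ifs
        · rfl
        · simp

end IsCellSystem

end cells

end EdgeGraph

namespace EdgeGraph

/-! ### The Hecke relations in the levels -/

section hecke

variable {V : Type u} {E : Type v} [Fintype V] [DecidableEq V] [Fintype E] [DecidableEq E]
  {G : EdgeGraph V E} {n : ℕ} {φ : V → ℝ} {W : E → E → E → ℂ} {x : V} {k : ℕ}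

/-- A level element that acts on the last three edges only. -/
def IsTailThree (a : G.Level x (k + 3)) (K : E → E → E → E → E → E → ℂ) : Prop :=
  ∀ p q : G.Path x (k + 3), total a p q = if p.init.init.init = q.init.init.init then
    K p.init.init.last p.init.last p.last q.init.init.last q.init.last q.last else 0

theorem Path.sum_succ_three_of_support {M : Type*} [AddCommMonoid M]
    (f : G.Path x k → E → E → E → M)
    (hf : ∀ p a b c, f p a b c ≠ 0 → G.s a = p.1 ∧ G.r a = G.s b ∧ G.r b = G.s c) :
    ∑ p : G.Path x (k + 3), f p.init.init.init p.init.init.last p.init.last p.last =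
      ∑ p : G.Path x k, ∑ a, ∑ b, ∑ c, f p a b c := by
  rw [Path.sum_succ_succ_of_support
    (fun (p : G.Path x (k + 1)) b c => f p.init p.last b c)]
  · exact Path.sum_succ_of_support (fun p a => ∑ b, ∑ c, f p a b c) fun p a h => by
      obtain ⟨b, -, hb⟩ := Finset.exists_ne_zero_of_sum_ne_zero h
      obtain ⟨c, -, hc⟩ := Finset.exists_ne_zero_of_sum_ne_zero hb
      exact (hf _ _ _ _ hc).1
  · intro p b c h
    obtain ⟨-, h1, h2⟩ := hf _ _ _ _ h
    exact ⟨h1.symm.trans p.r_last, h2⟩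

theorem Path.composable (p : G.Path x (k + 2)) : G.r p.init.last = G.s p.last :=
  p.init.r_last

/-- A kernel that relates a composable triple of edges only to composable ones with the same
source. -/
def PreservesComposable (G : EdgeGraph V E) (K : E → E → E → E → E → E → ℂ) : Prop :=
  ∀ a b c a' b' c', K a b c a' b' c' ≠ 0 → G.r a = G.s b → G.r b = G.s c →
    G.s a = G.s a' ∧ G.r a' = G.s b' ∧ G.r b' = G.s c'

/-- The product of two kernels on triples of edges. -/
noncomputable def kernelMul (K L : E → E → E → E → E → E → ℂ) (a b c a'' b'' c'' : E) : ℂ :=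
  ∑ a', ∑ b', ∑ c', K a b c a' b' c' * L a' b' c' a'' b'' c''

theorem PreservesComposable.mul {K L : E → E → E → E → E → E → ℂ}
    (hK : PreservesComposable G K) (hL : PreservesComposable G L) :
    PreservesComposable G (kernelMul K L) := by
  intro a b c a'' b'' c'' h h1 h2
  obtain ⟨a', -, h⟩ := Finset.exists_ne_zero_of_sum_ne_zero h
  obtain ⟨b', -, h⟩ := Finset.exists_ne_zero_of_sum_ne_zero h
  obtain ⟨c', -, h⟩ := Finset.exists_ne_zero_of_sum_ne_zero h
  obtain ⟨h3, h4⟩ := mul_ne_zero_iff.1 h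
  obtain ⟨h5, h6, h7⟩ := hK _ _ _ _ _ _ h3 h1 h2
  obtain ⟨h8, h9⟩ := hL _ _ _ _ _ _ h4 h6 h7
  exact ⟨h5.trans h8, h9⟩

/-- Since `K` leads from composable triples to composable triples only, the sum over intermediate
paths is a free sum over triples of edges. Cubic relations between operators thereby reduce to
identities between kernels. -/
theorem IsTailThree.mul {a b : G.Level x (k + 3)} {K L : E → E → E → E → E → E → ℂ}
    (ha : IsTailThree a K) (hb : IsTailThree b L) (hK : PreservesComposable G K) :
    IsTailThree (a * b) (kernelMul K L) := by
  intro p q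
  rw [total_mul_apply]
  simp only [ha p, hb _ q]
  rw [Path.sum_succ_three_of_support (fun r a b c =>
    (if p.init.init.init = r then
      K p.init.init.last p.init.last p.last a b c else 0) *
    (if r = q.init.init.init then L a b c q.init.init.last q.init.last q.last else 0))]
  · by_cases h : p.init.init.init = q.init.init.init
    · simp only [h, if_true]
      rw [Finset.sum_eq_single q.init.init.init]
      · simp only [if_true]
        rfl
      · intro r _ hr
        simp [hr]
      · simp
    · rw [if_neg h]
      refine Finset.sum_eq_zero fun r _ => Finset.sum_eq_zero fun a _ =>
        Finset.sum_eq_zero fun b _ => Finset.sum_eq_zero fun c _ => ?_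
      by_cases h' : p.init.init.init = r
      · rw [if_neg (fun h'' => h (h'.trans h'')), mul_zero]
      · rw [if_neg h', zero_mul]
  · intro r a b c h
    obtain ⟨h1, h2⟩ := mul_ne_zero_iff.1 h
    obtain ⟨h3, h4⟩ := ite_ne_right_iff.1 h1
    obtain ⟨h5, h6, h7⟩ := hK _ _ _ _ _ _ h4 p.init.composable p.composable
    exact ⟨by rw [← h5, ← h3]; rfl, h6, h7⟩

namespace IsCellSystem

variable (hW : G.IsCellSystem n φ W)
include hW

theorem total_heckeLevel (p q : G.Path x (k + 2)) :
    total (G.heckeLevel x φ W k) p q = if p.init.init = q.init.init then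
      G.cellKernel φ W p.init.last p.last q.init.last q.last else 0 := by
  by_cases h : p.1 = q.1
  · obtain ⟨v, p⟩ := p
    obtain ⟨w, q⟩ := q
    change v = w at h
    subst h
    rw [total_apply_mk, ← hW.heckeCoeff_eq]
    rfl
  · rw [total_apply_ne _ h, eq_comm]
    refine ite_eq_right_iff.2 fun _ => ?_
    by_contra h'
    obtain ⟨-, -, h3, -⟩ := hW.support_kernel h'
    exact h (by rw [← p.r_last, ← q.r_last, h3])

theorem star_heckeLevel : star (G.heckeLevel x φ W k) = G.heckeLevel x φ W k := by
  refine level_ext fun p q _ => ?_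
  rw [total_star_apply, hW.total_heckeLevel, hW.total_heckeLevel]
  simp only [eq_comm (a := q.init.init)]
  split_ifs
  · rw [hW.conj_cellKernel]
  · rw [map_zero]

theorem heckeLevel_mul_self (hpos : ∀ i, 0 < φ i) :
    G.heckeLevel x φ W k * G.heckeLevel x φ W k =
      (quantumInt n 2 : ℂ) • G.heckeLevel x φ W k := by
  refine level_ext fun p q _ => ?_
  rw [total_mul_apply, total_smul_apply]
  simp only [hW.total_heckeLevel]
  rw [Path.sum_succ_succ_of_support (fun r b c =>
    (if p.init.init = r then G.cellKernel φ W p.init.last p.last b c else 0) *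
    (if r = q.init.init then G.cellKernel φ W b c q.init.last q.last else 0))]
  · by_cases h : p.init.init = q.init.init
    · simp only [h, if_true]
      rw [Finset.sum_eq_single q.init.init]
      · simp only [if_true]
        exact hW.sum_cellKernel_mul hpos _ _ _ _
      · intro r _ hr
        simp [hr]
      · simp
    · rw [if_neg h, mul_zero]
      refine Finset.sum_eq_zero fun r _ => Finset.sum_eq_zero fun b _ =>
        Finset.sum_eq_zero fun c _ => ?_
      by_cases h' : p.init.init = r
      · rw [if_neg (fun h'' => h (h'.trans h'')), mul_zero]
      · rw [if_neg h', zero_mul]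
  · intro r b c h
    obtain ⟨h1, h2⟩ := mul_ne_zero_iff.1 h
    obtain ⟨h3, h4⟩ := ite_ne_right_iff.1 h1
    obtain ⟨-, h5, -, h6⟩ := hW.support_kernel h4
    exact ⟨by rw [← h6, ← h3]; rfl, h5⟩

theorem total_incl_mul_heckeLevel (a : G.Level x k) (p q : G.Path x (k + 2)) :
    total (G.levelStep x (k + 1) (G.levelStep x k a) * G.heckeLevel x φ W k) p q =
      total a p.init.init q.init.init *
        G.cellKernel φ W p.init.last p.last q.init.last q.last := by
  rw [total_mul_apply]
  simp only [hW.total_heckeLevel, total_levelStep]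
  rw [Path.sum_succ_succ_of_support (fun r b c =>
    (if p.last = c then if p.init.last = b then total a p.init.init r else 0 else 0) *
    (if r = q.init.init then G.cellKernel φ W b c q.init.last q.last else 0))]
  · simp
  · intro r b c h
    obtain ⟨h1, h2⟩ := mul_ne_zero_iff.1 h
    obtain ⟨h3, h4⟩ := ite_ne_right_iff.1 h2
    obtain ⟨h5, -, -, -⟩ := hW.support_kernel h4
    obtain ⟨-, h1⟩ := ite_ne_right_iff.1 h1
    obtain ⟨rfl, h6⟩ := ite_ne_right_iff.1 h1
    refine ⟨?_, h5⟩
    by_contra h'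
    exact h6 (total_apply_ne _ h')

theorem total_heckeLevel_mul_incl (a : G.Level x k) (p q : G.Path x (k + 2)) :
    total (G.heckeLevel x φ W k * G.levelStep x (k + 1) (G.levelStep x k a)) p q =
      total a p.init.init q.init.init *
        G.cellKernel φ W p.init.last p.last q.init.last q.last := by
  rw [total_mul_apply]
  simp only [hW.total_heckeLevel, total_levelStep]
  rw [Path.sum_succ_succ_of_support (fun r b c =>
    (if p.init.init = r then G.cellKernel φ W p.init.last p.last b c else 0) *
    (if c = q.last then if b = q.init.last then total a r q.init.init else 0 else 0))]
  · simp [mul_comm]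
  · intro r b c h
    obtain ⟨h1, -⟩ := mul_ne_zero_iff.1 h
    obtain ⟨h3, h4⟩ := ite_ne_right_iff.1 h1
    obtain ⟨-, h5, -, h6⟩ := hW.support_kernel h4
    exact ⟨by rw [← h6, ← h3]; rfl, h5⟩

theorem commute_heckeLevel (a : G.Level x k) :
    Commute (G.levelStep x (k + 1) (G.levelStep x k a)) (G.heckeLevel x φ W k) :=
  level_ext fun p q _ => by
    rw [hW.total_incl_mul_heckeLevel, hW.total_heckeLevel_mul_incl]

theorem isTailThree_heckeLevel :
    IsTailThree (G.heckeLevel x φ W (k + 1)) fun a b c a' b' c' =>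
      if a = a' then G.cellKernel φ W b c b' c' else 0 := by
  intro p q
  rw [hW.total_heckeLevel]
  by_cases h : p.init.init = q.init.init
  · simp [h]
  · rw [if_neg h]
    by_cases h1 : p.init.init.init = q.init.init.init
    · have h2 : p.init.init.last ≠ q.init.init.last := fun h2 => h (Path.ext_succ h1 h2)
      simp [h2]
    · rw [if_neg h1]

theorem isTailThree_levelStep_heckeLevel :
    IsTailThree (G.levelStep x (k + 2) (G.heckeLevel x φ W k)) fun a b c a' b' c' =>
      if c = c' then G.cellKernel φ W a b a' b' else 0 := by
  intro p q
  rw [total_levelStep, hW.total_heckeLevel]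
  by_cases h : p.last = q.last
  · simp only [h, if_true]
  · simp [h]

theorem preservesComposable_right :
    PreservesComposable G fun a b c a' b' c' =>
      if a = a' then G.cellKernel φ W b c b' c' else 0 := by
  intro a b c a' b' c' h h1 h2
  obtain ⟨rfl, h'⟩ := ite_ne_right_iff.1 h
  obtain ⟨-, h3, -, h4⟩ := hW.support_kernel h'
  exact ⟨rfl, h1.trans h4, h3⟩

theorem preservesComposable_left :
    PreservesComposable G fun a b c a' b' c' =>
      if c = c' then G.cellKernel φ W a b a' b' else 0 := by
  intro a b c a' b' c' h h1 h2
  obtain ⟨rfl, h'⟩ := ite_ne_right_iff.1 h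
  obtain ⟨-, h3, h5, h4⟩ := hW.support_kernel h'
  exact ⟨h4, h3, h5.symm.trans h2⟩

/-- This is `braid_left` transported to paths. The explicit form serves twice: it agrees with the
other side of the braid relation, and it gives the block traces that prove the period 3 of the
multiplicities. -/
theorem total_braid_left (hpos : ∀ i, 0 < φ i) (p q : G.Path x (k + 3)) :
    total (G.levelStep x (k + 2) (G.heckeLevel x φ W k) * G.heckeLevel x φ W (k + 1) *
      G.levelStep x (k + 2) (G.heckeLevel x φ W k) -
      G.levelStep x (k + 2) (G.heckeLevel x φ W k)) p q =
    if p.init.init.init = q.init.init.init then ((φ (G.s p.init.init.last))⁻¹ : ℂ) ^ 2 *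
      (W p.init.init.last p.init.last p.last *
        conj (W q.init.init.last q.init.last q.last)) else 0 := by
  by_cases h : p.init.init.init = q.init.init.init
  · have hs : G.s p.init.init.last = G.s q.init.init.last := congrArg Sigma.fst h
    rw [if_pos h]
    by_cases hr : p.1 = q.1
    · have h1 := hW.isTailThree_levelStep_heckeLevel (x := x) (k := k)
      rw [total_sub_apply,
        ((h1.mul hW.isTailThree_heckeLevel hW.preservesComposable_left).mul h1
          (hW.preservesComposable_left.mul hW.preservesComposable_right)) p q, h1 p q,
        if_pos h, if_pos h, sub_eq_iff_eq_add', ← hW.braid_left hpos p.composable q.composable hs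
          (by rw [p.r_last, q.r_last, hr])]
      simp only [kernelMul, ite_mul, mul_ite, zero_mul, mul_zero, Finset.sum_ite_eq,
        Finset.sum_ite_eq', Finset.mem_univ, if_true, Finset.sum_mul, Finset.sum_ite_irrel,
        Finset.sum_const_zero]
    -- If the right-hand side were nonzero, both triangles would close at the vertex where the
    -- common initial path ends, and the ends of `p` and `q` would coincide.
    · rw [total_apply_ne _ hr]
      by_contra h'
      obtain ⟨h1, h2⟩ := mul_ne_zero_iff.1 (right_ne_zero_of_mul (Ne.symm h'))
      have h3 := (hW.support _ _ _ h1).2.2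
      have h4 := (hW.support _ _ _ ((map_ne_zero _).1 h2)).2.2
      rw [p.r_last] at h3
      rw [q.r_last] at h4
      exact hr (h3.trans (hs.trans h4.symm))
  · have h1 := hW.isTailThree_levelStep_heckeLevel (x := x) (k := k)
    rw [total_sub_apply,
      ((h1.mul hW.isTailThree_heckeLevel hW.preservesComposable_left).mul h1
        (hW.preservesComposable_left.mul hW.preservesComposable_right)) p q, h1 p q,
      if_neg h, if_neg h, if_neg h, sub_zero]

theorem total_braid_right (hpos : ∀ i, 0 < φ i) {p q : G.Path x (k + 3)} (hr : p.1 = q.1) :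
    total (G.heckeLevel x φ W (k + 1) * G.levelStep x (k + 2) (G.heckeLevel x φ W k) *
      G.heckeLevel x φ W (k + 1) - G.heckeLevel x φ W (k + 1)) p q =
    if p.init.init.init = q.init.init.init then ((φ (G.s p.init.init.last))⁻¹ : ℂ) ^ 2 *
      (W p.init.init.last p.init.last p.last *
        conj (W q.init.init.last q.init.last q.last)) else 0 := by
  have h1 := hW.isTailThree_heckeLevel (x := x) (k := k)
  by_cases h : p.init.init.init = q.init.init.init
  · have hs : G.s p.init.init.last = G.s q.init.init.last := congrArg Sigma.fst h
    rw [if_pos h, total_sub_apply,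
      ((h1.mul hW.isTailThree_levelStep_heckeLevel hW.preservesComposable_right).mul h1
        (hW.preservesComposable_right.mul hW.preservesComposable_left)) p q, h1 p q,
      if_pos h, if_pos h, sub_eq_iff_eq_add', ← hW.braid_right hpos p.init.composable
        q.init.composable hs (by rw [p.r_last, q.r_last, hr])]
    simp only [kernelMul, ite_mul, mul_ite, zero_mul, mul_zero, Finset.sum_ite_eq,
      Finset.sum_ite_eq', Finset.mem_univ, if_true, Finset.sum_mul, Finset.sum_ite_irrel,
      Finset.sum_const_zero]
  · rw [total_sub_apply,
      ((h1.mul hW.isTailThree_levelStep_heckeLevel hW.preservesComposable_right).mul h1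
        (hW.preservesComposable_right.mul hW.preservesComposable_left)) p q, h1 p q,
      if_neg h, if_neg h, if_neg h, sub_zero]

theorem heckeLevel_braid (hpos : ∀ i, 0 < φ i) :
    G.levelStep x (k + 2) (G.heckeLevel x φ W k) * G.heckeLevel x φ W (k + 1) *
      G.levelStep x (k + 2) (G.heckeLevel x φ W k) -
      G.levelStep x (k + 2) (G.heckeLevel x φ W k) =
    G.heckeLevel x φ W (k + 1) * G.levelStep x (k + 2) (G.heckeLevel x φ W k) *
      G.heckeLevel x φ W (k + 1) - G.heckeLevel x φ W (k + 1) :=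
  level_ext fun p q h => by rw [hW.total_braid_left hpos, hW.total_braid_right hpos h]

end IsCellSystem

end hecke

end EdgeGraph

/-! ### Hecke relations determine a Markov trace -/

section heckeTrace

variable {R : Type*} [Ring R] [Algebra ℂ R] (g : ℕ → R)

/-- The algebra generated by the first `k` generators. -/
noncomputable def initialAlgebra (k : ℕ) : Subalgebra ℂ R := Algebra.adjoin ℂ (g '' {i | i < k})

theorem gen_mem_initialAlgebra {i k : ℕ} (h : i < k) : g i ∈ initialAlgebra g k :=
  Algebra.subset_adjoin ⟨i, h, rfl⟩

theorem initialAlgebra_mono {i k : ℕ} (h : i ≤ k) : initialAlgebra g i ≤ initialAlgebra g k :=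
  Algebra.adjoin_mono (Set.image_mono fun _ hj => lt_of_lt_of_le hj h)

theorem initialAlgebra_zero : initialAlgebra g 0 = ⊥ := by
  simp [initialAlgebra]

theorem exists_mem_initialAlgebra {x : R} (hx : x ∈ Algebra.adjoin ℂ (Set.range g)) :
    ∃ k, x ∈ initialAlgebra g k := by
  induction hx using Algebra.adjoin_induction with
  | mem x hx =>
    obtain ⟨i, rfl⟩ := hx
    exact ⟨i + 1, gen_mem_initialAlgebra g (Nat.lt_succ_self i)⟩
  | algebraMap r => exact ⟨0, algebraMap_mem _ r⟩
  | add x y _ _ hx hy =>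
    obtain ⟨i, hi⟩ := hx
    obtain ⟨j, hj⟩ := hy
    exact ⟨max i j, add_mem (initialAlgebra_mono g (le_max_left i j) hi)
      (initialAlgebra_mono g (le_max_right i j) hj)⟩
  | mul x y _ _ hx hy =>
    obtain ⟨i, hi⟩ := hx
    obtain ⟨j, hj⟩ := hy
    exact ⟨max i j, mul_mem (initialAlgebra_mono g (le_max_left i j) hi)
      (initialAlgebra_mono g (le_max_right i j) hj)⟩

/-- The span of `B` and `B g B`, where `B` is generated by the first `k` generators and `g` is the
next one. -/
noncomputable def singleUse (k : ℕ) : Submodule ℂ R :=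
  Subalgebra.toSubmodule (initialAlgebra g k) ⊔
    Submodule.span ℂ {z | ∃ a ∈ initialAlgebra g k, ∃ b ∈ initialAlgebra g k, z = a * g k * b}

variable {g}

theorem mem_singleUse_of_mem {k : ℕ} {x : R} (h : x ∈ initialAlgebra g k) : x ∈ singleUse g k :=
  Submodule.mem_sup_left h

theorem mul_gen_mul_mem_singleUse {k : ℕ} {a b : R} (ha : a ∈ initialAlgebra g k)
    (hb : b ∈ initialAlgebra g k) : a * g k * b ∈ singleUse g k :=
  Submodule.mem_sup_right (Submodule.subset_span ⟨a, ha, b, hb, rfl⟩)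

theorem singleUse_induction {k : ℕ} {S : Submodule ℂ R}
    (h1 : ∀ x ∈ initialAlgebra g k, x ∈ S)
    (h2 : ∀ a ∈ initialAlgebra g k, ∀ b ∈ initialAlgebra g k, a * g k * b ∈ S) :
    singleUse g k ≤ S := by
  refine sup_le h1 (Submodule.span_le.2 ?_)
  rintro _ ⟨a, ha, b, hb, rfl⟩
  exact h2 a ha b hb

theorem mul_mem_singleUse_left {k : ℕ} {a x : R} (ha : a ∈ initialAlgebra g k)
    (hx : x ∈ singleUse g k) : a * x ∈ singleUse g k := by
  refine singleUse_induction (S := (singleUse g k).comap (LinearMap.mulLeft ℂ a)) ?_ ?_ hx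
  · intro x hx
    exact mem_singleUse_of_mem (mul_mem ha hx)
  · intro b hb c hc
    have := mul_gen_mul_mem_singleUse (mul_mem ha hb) hc
    simpa [mul_assoc] using this

theorem mul_mem_singleUse_right {k : ℕ} {a x : R} (ha : a ∈ initialAlgebra g k)
    (hx : x ∈ singleUse g k) : x * a ∈ singleUse g k := by
  refine singleUse_induction (S := (singleUse g k).comap (LinearMap.mulRight ℂ a)) ?_ ?_ hx
  · intro x hx
    exact mem_singleUse_of_mem (mul_mem hx ha)
  · intro b hb c hc
    have := mul_gen_mul_mem_singleUse hb (mul_mem hc ha)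
    simpa [mul_assoc] using this

/-- It suffices that right multiplication by each of the first k + 1 generators preserves
`singleUse`. Only `g k` could create a second occurrence, and the hypothesis removes it. -/
theorem initialAlgebra_succ_le_of_conj {k : ℕ}
    (h : ∀ b ∈ initialAlgebra g k, g k * b * g k ∈ singleUse g k) {x : R}
    (hx : x ∈ initialAlgebra g (k + 1)) : x ∈ singleUse g k := by
  suffices hs : ∀ m ∈ singleUse g k, m * x ∈ singleUse g k by
    simpa using hs 1 (mem_singleUse_of_mem (one_mem _))
  induction hx using Algebra.adjoin_induction with
  | mem x hx =>
    obtain ⟨i, hi, rfl⟩ := hx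
    rcases Nat.lt_succ_iff_lt_or_eq.1 hi with hi | rfl
    · exact fun m hm => mul_mem_singleUse_right (gen_mem_initialAlgebra g hi) hm
    · intro m hm
      refine singleUse_induction (S := (singleUse g i).comap (LinearMap.mulRight ℂ (g i)))
        ?_ ?_ hm
      · intro x hx
        simpa using mul_gen_mul_mem_singleUse hx (one_mem _)
      · intro a ha b hb
        have := mul_mem_singleUse_left ha (h b hb)
        simpa [mul_assoc] using this
  | algebraMap r =>
    intro m hm
    rw [← Algebra.commutes, ← Algebra.smul_def]
    exact Submodule.smul_mem _ _ hm
  | add x y _ _ hx hy =>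
    intro m hm
    rw [mul_add]
    exact add_mem (hx m hm) (hy m hm)
  | mul x y _ _ hx hy =>
    intro m hm
    rw [← mul_assoc]
    exact hy _ (hx m hm)

theorem gen_commute_of_mem {k : ℕ} (hcomm : ∀ i j, i + 2 ≤ j → Commute (g i) (g j)) {x : R}
    (hx : x ∈ initialAlgebra g k) : Commute x (g (k + 1)) := by
  induction hx using Algebra.adjoin_induction with
  | mem x hx =>
    obtain ⟨i, hi, rfl⟩ := hx
    exact hcomm i (k + 1) (Nat.succ_le_succ hi)
  | algebraMap r => exact Algebra.commutes r _
  | add x y _ _ hx hy => exact hx.add_left hy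
  | mul x y _ _ hx hy => exact hx.mul_left hy

/-- By induction `b` is a combination of elements x and a g_k c with x, a, c generated before g_k.
These commute with g_{k+1}, so only g_{k+1}² and g_{k+1} g_k g_{k+1} arise; the quadratic and the
braid relation rewrite them with a single g_{k+1}. -/
theorem conj_gen_mem_singleUse {δ : ℂ} (hsq : ∀ k, g k * g k = δ • g k)
    (hbraid : ∀ k, g k * g (k + 1) * g k - g k = g (k + 1) * g k * g (k + 1) - g (k + 1))
    (hcomm : ∀ i j, i + 2 ≤ j → Commute (g i) (g j)) (k : ℕ) :
    ∀ b ∈ initialAlgebra g k, g k * b * g k ∈ singleUse g k := by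
  have hgen : ∀ k, g k ∈ singleUse g k := fun k => by
    simpa using mul_gen_mul_mem_singleUse (g := g) (k := k) (one_mem _) (one_mem _)
  induction k with
  | zero =>
    intro b hb
    rw [initialAlgebra_zero, Algebra.mem_bot] at hb
    obtain ⟨c, rfl⟩ := hb
    rw [← Algebra.commutes, mul_assoc, hsq, ← Algebra.smul_def]
    exact Submodule.smul_mem _ _ (Submodule.smul_mem _ _ (hgen 0))
  | succ k ih =>
    intro b hb
    refine singleUse_induction (S := (singleUse g (k + 1)).comap
      ((LinearMap.mulRight ℂ (g (k + 1))).comp (LinearMap.mulLeft ℂ (g (k + 1))))) ?_ ?_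
      (initialAlgebra_succ_le_of_conj ih hb)
    · intro x hx
      have h := gen_commute_of_mem hcomm hx
      change g (k + 1) * x * g (k + 1) ∈ singleUse g (k + 1)
      rw [← h.eq, mul_assoc, hsq]
      exact mul_mem_singleUse_left (initialAlgebra_mono g (Nat.le_succ k) hx)
        (Submodule.smul_mem _ _ (hgen _))
    · intro a ha c hc
      have h1 := gen_commute_of_mem hcomm ha
      have h2 := gen_commute_of_mem hcomm hc
      change g (k + 1) * (a * g k * c) * g (k + 1) ∈ singleUse g (k + 1)
      have h3 : g (k + 1) * (a * g k * c) * g (k + 1) =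
          a * ((g k * g (k + 1) * g k - g k + g (k + 1)) * c) := by
        rw [hbraid, sub_add_cancel, mul_assoc a, ← mul_assoc (g (k + 1)) a, ← h1.eq]
        simp only [mul_assoc]
        rw [h2.eq]
      rw [h3]
      have ha' := initialAlgebra_mono g (Nat.le_succ k) ha
      have hc' := initialAlgebra_mono g (Nat.le_succ k) hc
      have hk := gen_mem_initialAlgebra g (Nat.lt_succ_self k)
      refine mul_mem_singleUse_left ha' (mul_mem_singleUse_right hc' ?_)
      exact add_mem (sub_mem (mul_gen_mul_mem_singleUse hk hk) (mem_singleUse_of_mem hk)) (hgen _)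

/-- A tracial functional with the Markov property on an algebra generated by elements that satisfy
the Hecke relations is determined by its value at `1`. -/
theorem markov_trace_eq_zero {δ η : ℂ} (hsq : ∀ k, g k * g k = δ • g k)
    (hbraid : ∀ k, g k * g (k + 1) * g k - g k = g (k + 1) * g k * g (k + 1) - g (k + 1))
    (hcomm : ∀ i j, i + 2 ≤ j → Commute (g i) (g j)) (t : R →ₗ[ℂ] ℂ)
    (htr : ∀ x y, t (x * y) = t (y * x))
    (hmarkov : ∀ k, ∀ x ∈ initialAlgebra g k, t (x * g k) = η * t x) (h1 : t 1 = 0) {x : R}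
    (hx : x ∈ Algebra.adjoin ℂ (Set.range g)) : t x = 0 := by
  obtain ⟨k, hk⟩ := exists_mem_initialAlgebra g hx
  clear hx
  induction k generalizing x with
  | zero =>
    rw [initialAlgebra_zero, Algebra.mem_bot] at hk
    obtain ⟨c, rfl⟩ := hk
    rw [Algebra.algebraMap_eq_smul_one, map_smul, h1, smul_zero]
  | succ k ih =>
    refine singleUse_induction (S := LinearMap.ker t) (fun x hx => ih hx) ?_
      (initialAlgebra_succ_le_of_conj (conj_gen_mem_singleUse hsq hbraid hcomm k) hk)
    intro a ha b hb
    rw [LinearMap.mem_ker, htr, ← mul_assoc, hmarkov k _ (mul_mem hb ha), ih (mul_mem hb ha),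
      mul_zero]

end heckeTrace

theorem quantumInt_three_pos {n : ℕ} (hn : 4 ≤ n) : 0 < quantumInt n 3 := by
  have hn' : (4 : ℝ) ≤ n := by exact_mod_cast hn
  have hπ := Real.pi_pos
  refine div_pos (Real.sin_pos_of_pos_of_lt_pi (by positivity) ?_)
    (Real.sin_pos_of_pos_of_lt_pi (by positivity) ?_)
  · rw [div_lt_iff₀ (by linarith)]
    push_cast
    nlinarith
  · rw [div_lt_iff₀ (by linarith)]
    nlinarith

theorem quantumInt_two_pos {n : ℕ} (hn : 4 ≤ n) : 0 < quantumInt n 2 := by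
  have hn' : (4 : ℝ) ≤ n := by exact_mod_cast hn
  have hπ := Real.pi_pos
  refine div_pos (Real.sin_pos_of_pos_of_lt_pi (by positivity) ?_)
    (Real.sin_pos_of_pos_of_lt_pi (by positivity) ?_)
  · rw [div_lt_iff₀ (by linarith)]
    push_cast
    nlinarith
  · rw [div_lt_iff₀ (by linarith)]
    nlinarith

namespace EdgeGraph

/-! ### The path algebra as the union of its levels -/

section pathAlgebra

variable {V : Type u} {E : Type v} [DecidableEq V] [Fintype E] [DecidableEq E]
  (G : EdgeGraph V E) (x : V)

/-- A level as a subalgebra of the path algebra. -/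
noncomputable def ofLevelHom (k : ℕ) : G.Level x k →ₐ[ℂ] G.PathAlgebra x where
  toFun := G.ofLevel x k
  map_one' := (DirectLimit.one_def (f := fun i j h => G.levelIncl x i j h) k).symm
  map_mul' a b := (DirectLimit.mul_def (f := fun i j h => G.levelIncl x i j h) k a b).symm
  map_zero' := (DirectLimit.zero_def (f := fun i j h => G.levelIncl x i j h) k).symm
  map_add' a b := (DirectLimit.add_def (f := fun i j h => G.levelIncl x i j h) k a b).symm
  commutes' c := by
    rw [Algebra.algebraMap_eq_smul_one, Algebra.algebraMap_eq_smul_one]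
    have h : G.ofLevel x k 1 = 1 :=
      (DirectLimit.one_def (f := fun i j h => G.levelIncl x i j h) k).symm
    rw [← h]
    rfl

theorem star_ofLevelHom (k : ℕ) (a : G.Level x k) :
    star (G.ofLevelHom x k a) = G.ofLevelHom x k (star a) := rfl

theorem ofLevelHom_incl {i j : ℕ} (h : i ≤ j) (a : G.Level x i) :
    G.ofLevelHom x j (G.levelIncl x i j h a) = G.ofLevelHom x i a :=
  DirectLimit.mk_apply (f := fun i j h => G.levelIncl x i j h) i j a h

theorem ofLevelHom_step (k : ℕ) (a : G.Level x k) :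
    G.ofLevelHom x (k + 1) (G.levelStep x k a) = G.ofLevelHom x k a := by
  rw [← G.ofLevelHom_incl x (Nat.le_succ k) a, G.levelIncl_succ x k k le_rfl, levelIncl_self]
  rfl

theorem ofLevelHom_range_mono {i j : ℕ} (h : i ≤ j) :
    (G.ofLevelHom x i).range ≤ (G.ofLevelHom x j).range := by
  rintro _ ⟨a, rfl⟩
  exact ⟨G.levelIncl x i j h a, G.ofLevelHom_incl x h a⟩

theorem exists_ofLevelHom (z : G.PathAlgebra x) : ∃ k a, G.ofLevelHom x k a = z := by
  obtain ⟨k, a, h⟩ := DirectLimit.exists_eq_mk (fun i j h => G.levelIncl x i j h) z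
  exact ⟨k, a, h.symm⟩

theorem exists_ofLevelHom₂ (z w : G.PathAlgebra x) :
    ∃ k a b, G.ofLevelHom x k a = z ∧ G.ofLevelHom x k b = w := by
  obtain ⟨k, a, b, h, h'⟩ :=
    DirectLimit.exists_eq_mk₂ (fun i j h => G.levelIncl x i j h) z w
  exact ⟨k, a, b, h.symm, h'.symm⟩

end pathAlgebra

/-! ### The Markov trace and block traces -/

section trace

variable {V : Type u} {E : Type v} [Fintype V] [DecidableEq V] [Fintype E] [DecidableEq E]
  {G : EdgeGraph V E} {n : ℕ} {φ : V → ℝ} {x : V} {k : ℕ}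

/-- The trace of a level, weighted by a vector. -/
noncomputable def weightedTrace (φ : V → ℝ) (a : G.Level x k) : ℂ :=
  ∑ p : G.Path x k, (φ p.1 : ℂ) * total a p p

/-- The normalized Markov trace of a level. -/
noncomputable def levelTrace (G : EdgeGraph V E) (n : ℕ) (φ : V → ℝ) (x : V) (k : ℕ) :
    G.Level x k →ₗ[ℂ] ℂ where
  toFun a := ((quantumInt n 3 : ℂ) ^ k * (φ x : ℂ))⁻¹ * weightedTrace φ a
  map_add' a b := by
    simp only [weightedTrace, total_add_apply, mul_add, Finset.sum_add_distrib]
  map_smul' c a := by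
    simp only [weightedTrace, total_smul_apply, RingHom.id_apply, smul_eq_mul,
      Finset.mul_sum]
    exact Finset.sum_congr rfl fun _ _ => by ring

theorem weightedTrace_mul_comm (a b : G.Level x k) :
    weightedTrace φ (a * b) = weightedTrace φ (b * a) := by
  rw [weightedTrace, weightedTrace, ← sum_trace_block _ fun j => (φ j : ℂ),
    ← sum_trace_block _ fun j => (φ j : ℂ)]
  exact Finset.sum_congr rfl fun j _ => by
    rw [Pi.mul_apply, Pi.mul_apply, Matrix.trace_mul_comm]

theorem weightedTrace_star_mul_self (a : G.Level x k) :
    weightedTrace φ (star a * a) =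
      ((∑ p : G.Path x k, ∑ q, φ p.1 * Complex.normSq (total a q p) : ℝ) : ℂ) := by
  simp only [weightedTrace, total_mul_apply, total_star_apply, Finset.mul_sum]
  push_cast
  refine Finset.sum_congr rfl fun p _ => Finset.sum_congr rfl fun q _ => ?_
  rw [Complex.normSq_eq_conj_mul_self]

theorem eq_zero_of_weightedTrace (hpos : ∀ i, 0 < φ i) {a : G.Level x k}
    (h : weightedTrace φ (star a * a) = 0) : a = 0 := by
  rw [weightedTrace_star_mul_self, Complex.ofReal_eq_zero] at h
  refine level_ext fun q p _ => ?_
  have hnn : ∀ p q : G.Path x k, 0 ≤ φ p.1 * Complex.normSq (total a q p) := fun p q =>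
    mul_nonneg (hpos _).le (Complex.normSq_nonneg _)
  have h1 := (Finset.sum_eq_zero_iff_of_nonneg fun p _ =>
    Finset.sum_nonneg fun q _ => hnn p q).1 h p (Finset.mem_univ _)
  have h2 := (Finset.sum_eq_zero_iff_of_nonneg fun q _ => hnn p q).1 h1 q (Finset.mem_univ _)
  have h3 := (mul_eq_zero.1 h2).resolve_left (hpos _).ne'
  rw [Complex.normSq_eq_zero.1 h3, map_zero, Matrix.zero_apply]

namespace IsPerronFrobenius

variable (hφ : G.IsPerronFrobenius n φ)
include hφ

theorem sum_out (i : V) :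
    ∑ e, (if G.s e = i then (φ (G.r e) : ℂ) else 0) = (quantumInt n 3 : ℂ) * (φ i : ℂ) := by
  have h := congrFun hφ.eigen i
  rw [Pi.smul_apply, smul_eq_mul] at h
  rw [← Complex.ofReal_mul, ← h]
  simp only [Matrix.mulVec, dotProduct, Matrix.map_apply, adjMat, Matrix.of_apply]
  push_cast
  have h1 : ∀ e, (if G.s e = i then (φ (G.r e) : ℂ) else 0) =
      ∑ j, if G.s e = i ∧ G.r e = j then (φ j : ℂ) else 0 := by
    intro e
    by_cases he : G.s e = i <;> simp [he]
  simp only [h1]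
  rw [Finset.sum_comm]
  refine Finset.sum_congr rfl fun j _ => ?_
  rw [← Finset.sum_filter, Finset.sum_const, nsmul_eq_mul, Fintype.card_subtype]

theorem weightedTrace_levelStep (a : G.Level x k) :
    weightedTrace φ (G.levelStep x k a) = (quantumInt n 3 : ℂ) * weightedTrace φ a := by
  have h : ∀ p : G.Path x (k + 1), (φ p.1 : ℂ) * total (G.levelStep x k a) p p =
      (φ (G.r p.last) : ℂ) * total a p.init p.init := by
    intro p
    rw [total_levelStep, if_pos rfl, p.r_last]
  simp only [weightedTrace, h]
  rw [Path.sum_succ fun (p : G.Path x k) e => (φ (G.r e) : ℂ) * total a p p, Finset.mul_sum]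
  refine Finset.sum_congr rfl fun p _ => ?_
  rw [← mul_assoc, ← hφ.sum_out, Finset.sum_mul]
  exact Finset.sum_congr rfl fun e _ => by rw [ite_mul, zero_mul]

theorem levelTrace_levelStep (hn : 4 ≤ n) (a : G.Level x k) :
    G.levelTrace n φ x (k + 1) (G.levelStep x k a) = G.levelTrace n φ x k a := by
  have h3 : (quantumInt n 3 : ℂ) ≠ 0 := by exact_mod_cast (quantumInt_three_pos hn).ne'
  have hx : (φ x : ℂ) ≠ 0 := by exact_mod_cast (hφ.pos x).ne'
  change _ * weightedTrace φ _ = _ * weightedTrace φ _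
  rw [hφ.weightedTrace_levelStep]
  field_simp
  ring

theorem levelTrace_levelIncl (hn : 4 ≤ n) {i j : ℕ} (h : i ≤ j) (a : G.Level x i) :
    G.levelTrace n φ x j (G.levelIncl x i j h a) = G.levelTrace n φ x i a := by
  induction h with
  | refl =>
    rw [levelIncl_self]
    rfl
  | step h ih =>
    rw [levelIncl_succ G x _ _ h, StarAlgHom.comp_apply, hφ.levelTrace_levelStep hn, ih]

/-- The Markov trace of the path algebra. -/
noncomputable def trace (hφ : G.IsPerronFrobenius n φ) (hn : 4 ≤ n) (x : V) :
    G.PathAlgebra x →ₗ[ℂ] ℂ where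
  toFun := DirectLimit.lift (fun i j h => G.levelIncl x i j h)
    (fun k a => G.levelTrace n φ x k a) fun _ _ h a => (hφ.levelTrace_levelIncl hn h a).symm
  map_add' z w := by
    obtain ⟨k, a, b, rfl, rfl⟩ := G.exists_ofLevelHom₂ x z w
    rw [← map_add]
    exact map_add (G.levelTrace n φ x k) a b
  map_smul' c z := by
    obtain ⟨k, a, rfl⟩ := G.exists_ofLevelHom x z
    rw [← map_smul]
    exact map_smul (G.levelTrace n φ x k) c a

theorem trace_ofLevelHom (hn : 4 ≤ n) (a : G.Level x k) :
    hφ.trace hn x (G.ofLevelHom x k a) = G.levelTrace n φ x k a := rfl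

theorem trace_mul_comm (hn : 4 ≤ n) (z w : G.PathAlgebra x) :
    hφ.trace hn x (z * w) = hφ.trace hn x (w * z) := by
  obtain ⟨k, a, b, rfl, rfl⟩ := G.exists_ofLevelHom₂ x z w
  rw [← map_mul, ← map_mul, hφ.trace_ofLevelHom, hφ.trace_ofLevelHom]
  change _ * weightedTrace φ _ = _ * weightedTrace φ _
  rw [weightedTrace_mul_comm]

theorem levelTrace_faithful (hn : 4 ≤ n) {a : G.Level x k}
    (h : G.levelTrace n φ x k (star a * a) = 0) : a = 0 := by
  have h3 : (quantumInt n 3 : ℂ) ≠ 0 := by exact_mod_cast (quantumInt_three_pos hn).ne'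
  have hx : (φ x : ℂ) ≠ 0 := by exact_mod_cast (hφ.pos x).ne'
  refine eq_zero_of_weightedTrace hφ.pos ((mul_eq_zero.1 h).resolve_left ?_)
  exact inv_ne_zero (mul_ne_zero (pow_ne_zero _ h3) hx)

theorem trace_faithful (hn : 4 ≤ n) {z : G.PathAlgebra x}
    (h : hφ.trace hn x (star z * z) = 0) : z = 0 := by
  obtain ⟨k, a, rfl⟩ := G.exists_ofLevelHom x z
  rw [star_ofLevelHom, ← map_mul, hφ.trace_ofLevelHom] at h
  rw [hφ.levelTrace_faithful hn h, map_zero]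

/-- The trace of the path algebra restricts to a faithful trace on each level, so nothing nonzero
can become zero in the limit. -/
theorem ofLevelHom_injective (hn : 4 ≤ n) : Function.Injective (G.ofLevelHom x k) := by
  rw [injective_iff_map_eq_zero]
  intro a ha
  refine hφ.levelTrace_faithful hn ?_
  rw [← hφ.trace_ofLevelHom hn, map_mul, ha, mul_zero, map_zero]

theorem trace_one (hn : 4 ≤ n) : hφ.trace hn x 1 = 1 := by
  have hx : (φ x : ℂ) ≠ 0 := by exact_mod_cast (hφ.pos x).ne'
  rw [← map_one (G.ofLevelHom x 0), hφ.trace_ofLevelHom]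
  change _ * weightedTrace φ _ = _
  let p₀ : G.Path x 0 := ⟨x, ⟨PUnit.unit, rfl⟩⟩
  rw [weightedTrace, Finset.sum_eq_single p₀ (fun p _ hp => absurd (p.eq_of_zero p₀) hp)
    (fun h => absurd (Finset.mem_univ _) h), total_one_apply, if_pos rfl]
  simp [p₀, hx]

/-- As `a` ignores the last edge, that edge can be summed out first. `sum_range_cellKernel` turns
the kernel into [2] times the identity on the edge before it. -/
theorem weightedTrace_mul_heckeLevel {W : E → E → E → ℂ} (hW : G.IsCellSystem n φ W)
    (a : G.Level x (k + 1)) :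
    weightedTrace φ (G.levelStep x (k + 1) a * G.heckeLevel x φ W k) =
      (quantumInt n 2 : ℂ) * weightedTrace φ a := by
  have key : ∀ p : G.Path x (k + 2),
      (φ p.1 : ℂ) * total (G.levelStep x (k + 1) a * G.heckeLevel x φ W k) p p =
      ∑ q : G.Path x (k + 1), if p.init.init = q.init then total a p.init q *
        ((φ (G.r p.last) : ℂ) * G.cellKernel φ W q.last p.last p.init.last p.last) else 0 := by
    intro p
    rw [total_mul_apply]
    simp only [hW.total_heckeLevel, total_levelStep]
    rw [Path.sum_succ_of_support (fun (q : G.Path x (k + 1)) c =>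
      (if p.last = c then total a p.init q else 0) * (if q.init = p.init.init then
        G.cellKernel φ W q.last c p.init.last p.last else 0)), Finset.mul_sum]
    · refine Finset.sum_congr rfl fun q _ => ?_
      simp only [ite_mul, zero_mul, Finset.sum_ite_eq, Finset.mem_univ, if_true, p.r_last]
      by_cases h : q.init = p.init.init
      · rw [if_pos h, if_pos h.symm]
        ring
      · rw [if_neg h, if_neg (Ne.symm h), mul_zero, mul_zero]
    · intro q c h
      obtain ⟨-, h2⟩ := mul_ne_zero_iff.1 h
      obtain ⟨-, h4⟩ := ite_ne_right_iff.1 h2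
      exact (hW.support_kernel h4).1.symm.trans q.r_last
  rw [weightedTrace]
  simp only [key]
  rw [Path.sum_succ_of_support (fun (p : G.Path x (k + 1)) c => ∑ q : G.Path x (k + 1),
    if p.init = q.init then total a p q *
        ((φ (G.r c) : ℂ) * G.cellKernel φ W q.last c p.last c) else 0), weightedTrace,
    Finset.mul_sum]
  · refine Finset.sum_congr rfl fun p _ => ?_
    rw [Finset.sum_comm]
    simp only [Finset.sum_ite_irrel, ← Finset.mul_sum, Finset.sum_const_zero,
      hW.sum_range_cellKernel hφ.pos]
    rw [Finset.sum_eq_single p]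
    · rw [if_pos rfl, if_pos rfl, p.r_last]
      ring
    · intro q _ hq
      by_cases h : p.init = q.init
      · rw [if_pos h, if_neg fun h' => hq (Path.ext_succ h.symm h'), mul_zero]
      · rw [if_neg h]
    · simp
  · intro p c h
    obtain ⟨q, -, hq⟩ := Finset.exists_ne_zero_of_sum_ne_zero h
    obtain ⟨-, h1⟩ := ite_ne_right_iff.1 hq
    have h2 := right_ne_zero_of_mul (right_ne_zero_of_mul h1)
    exact (hW.support_kernel h2).2.1.symm.trans p.r_last

end IsPerronFrobenius

namespace IsCellSystem

variable {W : E → E → E → ℂ} (hW : G.IsCellSystem n φ W)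
include hW

/-- On the paths of length two from `i` to `j` the kernel is [2] times a projection whose range has
a basis labelled by the edges that close the triangle, from `j` back to `i`. The sum is the trace of
this operator. -/
theorem sum_diag_cellKernel (hpos : ∀ i, 0 < φ i) (i j : V) :
    ∑ b, ∑ c, (if G.s b = i ∧ G.r c = j then G.cellKernel φ W b c b c else 0) =
      (quantumInt n 2 : ℂ) * ∑ l, if G.s l = j ∧ G.r l = i then 1 else 0 := by
  have h1 : ∀ b c, (if G.s b = i ∧ G.r c = j then G.cellKernel φ W b c b c else 0) =
      ∑ l, if G.s l = j ∧ G.r l = i then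
        G.edgeWeight φ l * (W l b c * conj (W l b c)) else 0 := by
    intro b c
    rw [cellKernel]
    have h2 : ∀ l, (if G.s l = j ∧ G.r l = i then
        G.edgeWeight φ l * (W l b c * conj (W l b c)) else 0) =
        if G.s b = i ∧ G.r c = j then G.edgeWeight φ l * W l b c * conj (W l b c) else 0 := by
      intro l
      by_cases h : W l b c = 0
      · simp [h]
      · obtain ⟨h3, -, h4⟩ := hW.support _ _ _ h
        simp only [← h3, ← h4, and_comm, mul_assoc]
    simp only [h2]
    split_ifs
    · rfl
    · simp
  simp only [h1]
  rw [sum_reindex_three, Finset.mul_sum]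
  refine Finset.sum_congr rfl fun l _ => ?_
  split_ifs
  · simp only [← Finset.mul_sum]
    rw [hW.sum_mul_conj, if_pos rfl]
    linear_combination (quantumInt n 2 : ℂ) * edgeWeight_mul hpos l
  · simp

/-- The block traces of `a U_{k+1}`, for `a` in level `k`. -/
theorem trace_block_mul_heckeLevel (hpos : ∀ i, 0 < φ i) (a : G.Level x k) (j : V) :
    ((G.levelStep x (k + 1) (G.levelStep x k a) * G.heckeLevel x φ W k) j).trace =
      (quantumInt n 2 : ℂ) * ∑ e, if G.s e = j then (a (G.r e)).trace else 0 := by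
  have h1 : ∀ p : G.Path x (k + 2), (if p.1 = j then total (G.levelStep x (k + 1)
      (G.levelStep x k a) * G.heckeLevel x φ W k) p p else 0) =
      if G.s p.init.last = p.init.init.1 ∧ G.r p.last = j then
        total a p.init.init p.init.init *
          G.cellKernel φ W p.init.last p.last p.init.last p.last else 0 := by
    intro p
    simp only [hW.total_incl_mul_heckeLevel, Path.s_last, p.r_last, true_and]
  rw [trace_block]
  simp only [h1]
  rw [Path.sum_succ_succ_of_support (fun (p : G.Path x k) b c =>
    if G.s b = p.1 ∧ G.r c = j then total a p p * G.cellKernel φ W b c b c else 0)]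
  · have h2 : ∀ p : G.Path x k, ∑ b, ∑ c, (if G.s b = p.1 ∧ G.r c = j then
        total a p p * G.cellKernel φ W b c b c else 0) = total a p p *
        ((quantumInt n 2 : ℂ) * ∑ l, if G.s l = j ∧ G.r l = p.1 then 1 else 0) := by
      intro p
      rw [← hW.sum_diag_cellKernel hpos]
      simp only [Finset.mul_sum, mul_ite, mul_zero]
    simp only [h2, trace_block, Finset.mul_sum, mul_ite, mul_zero, mul_one]
    rw [Finset.sum_comm]
    refine Finset.sum_congr rfl fun l _ => ?_
    by_cases hl : G.s l = j
    · simp only [hl, true_and, if_true, eq_comm (a := G.r l)]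
      exact Finset.sum_congr rfl fun p _ => by split_ifs <;> ring
    · simp [hl]
  · intro p b c h
    obtain ⟨⟨h3, -⟩, h4⟩ := ite_ne_right_iff.1 h
    exact ⟨h3, (hW.support_kernel (right_ne_zero_of_mul h4)).1⟩

theorem total_incl_mul_braid (hpos : ∀ i, 0 < φ i) (a : G.Level x k) (p q : G.Path x (k + 3)) :
    total (G.levelStep x (k + 2) (G.levelStep x (k + 1) (G.levelStep x k a)) *
      (G.levelStep x (k + 2) (G.heckeLevel x φ W k) * G.heckeLevel x φ W (k + 1) *
        G.levelStep x (k + 2) (G.heckeLevel x φ W k) -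
        G.levelStep x (k + 2) (G.heckeLevel x φ W k))) p q =
      total a p.init.init.init q.init.init.init * (((φ (G.s p.init.init.last))⁻¹ : ℂ) ^ 2 *
      (W p.init.init.last p.init.last p.last *
        conj (W q.init.init.last q.init.last q.last))) := by
  rw [total_mul_apply]
  simp only [hW.total_braid_left hpos, total_levelStep]
  rw [Path.sum_succ_three_of_support (fun r a' b c =>
    (if p.last = c then if p.init.last = b then if p.init.init.last = a' then
      total a p.init.init.init r else 0 else 0 else 0) *
    (if r = q.init.init.init then ((φ (G.s a'))⁻¹ : ℂ) ^ 2 * (W a' b c *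
        conj (W q.init.init.last q.init.last q.last)) else 0))]
  · simp
  · intro r a' b c h
    obtain ⟨h1, h2⟩ := mul_ne_zero_iff.1 h
    obtain ⟨-, h4⟩ := ite_ne_right_iff.1 h2
    obtain ⟨h5, h6, -⟩ := hW.support _ _ _ (left_ne_zero_of_mul (right_ne_zero_of_mul h4))
    obtain ⟨-, h7⟩ := ite_ne_right_iff.1 h1
    obtain ⟨-, h8⟩ := ite_ne_right_iff.1 h7
    obtain ⟨rfl, h9⟩ := ite_ne_right_iff.1 h8
    refine ⟨?_, h5, h6⟩
    by_contra h'
    exact h9 (total_apply_ne _ h')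

/-- The block traces of `a (U_{k+1} U_{k+2} U_{k+1} - U_{k+1})`, for `a` in level `k`. -/
theorem trace_block_mul_braid (hφ : G.IsPerronFrobenius n φ) (a : G.Level x k) (j : V) :
    ((G.levelStep x (k + 2) (G.levelStep x (k + 1) (G.levelStep x k a)) *
      (G.levelStep x (k + 2) (G.heckeLevel x φ W k) * G.heckeLevel x φ W (k + 1) *
        G.levelStep x (k + 2) (G.heckeLevel x φ W k) -
        G.levelStep x (k + 2) (G.heckeLevel x φ W k))) j).trace =
      (quantumInt n 2 : ℂ) * (quantumInt n 3 : ℂ) * (a j).trace := by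
  have h1 : ∀ p : G.Path x (k + 3), (if p.1 = j then total (G.levelStep x (k + 2)
      (G.levelStep x (k + 1) (G.levelStep x k a)) *
      (G.levelStep x (k + 2) (G.heckeLevel x φ W k) * G.heckeLevel x φ W (k + 1) *
        G.levelStep x (k + 2) (G.heckeLevel x φ W k) -
        G.levelStep x (k + 2) (G.heckeLevel x φ W k))) p p else 0) =
      if p.init.init.init.1 = j ∧ G.s p.init.init.last = p.init.init.init.1 then
        total a p.init.init.init p.init.init.init * (((φ j)⁻¹ : ℂ) ^ 2 *
        (W p.init.init.last p.init.last p.last *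
          conj (W p.init.init.last p.init.last p.last))) else 0 := by
    intro p
    rw [hW.total_incl_mul_braid hφ.pos]
    by_cases h : W p.init.init.last p.init.last p.last = 0
    · simp [h]
    · have h2 := (hW.support _ _ _ h).2.2
      rw [p.r_last, Path.s_last] at h2
      by_cases h3 : p.1 = j
      · rw [if_pos h3, if_pos ⟨h2.symm.trans h3, rfl⟩, Path.s_last, ← h2, h3]
      · rw [if_neg h3, if_neg fun h4 => h3 (h2.trans h4.1)]
  rw [trace_block]
  simp only [h1]
  rw [Path.sum_succ_three_of_support (fun (p : G.Path x k) a' b c =>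
    if p.1 = j ∧ G.s a' = p.1 then total a p p * (((φ j)⁻¹ : ℂ) ^ 2 *
        (W a' b c * conj (W a' b c))) else 0), trace_block, Finset.mul_sum]
  · refine Finset.sum_congr rfl fun p _ => ?_
    by_cases hp : p.1 = j
    · have hne : (φ j : ℂ) ≠ 0 := by exact_mod_cast (hφ.pos j).ne'
      have h3 := hφ.sum_out j
      -- For each edge from `j`, type I evaluates the sum of |W|² over the other two edges. The
      -- eigenvector equation then sums φ over the ranges of these edges, which yields the factor
      -- [3].
      simp only [hp, true_and, if_true, Finset.sum_ite_irrel, ← Finset.mul_sum,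
        hW.sum_mul_conj, Finset.sum_const_zero]
      have h4 : ∀ e, (if G.s e = j then total a p p * (((φ j)⁻¹ : ℂ) ^ 2 *
          ((quantumInt n 2 : ℂ) * ((φ (G.s e) : ℂ) * (φ (G.r e) : ℂ)))) else 0) =
          total a p p * ((φ j)⁻¹ : ℂ) * (quantumInt n 2 : ℂ) *
            (if G.s e = j then (φ (G.r e) : ℂ) else 0) := by
        intro e
        split_ifs with he
        · rw [he]
          field_simp
        · rw [mul_zero]
      simp only [h4]
      rw [← Finset.mul_sum, h3]
      field_simp
    · simp [hp]
  · intro p a' b c h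
    obtain ⟨⟨-, h3⟩, h4⟩ := ite_ne_right_iff.1 h
    obtain ⟨h5, h6, -⟩ := hW.support _ _ _
      (left_ne_zero_of_mul (right_ne_zero_of_mul (right_ne_zero_of_mul h4)))
    exact ⟨h3, h5, h6⟩

end IsCellSystem

end trace

/-! ### Hecke relations and Markov property in the path algebra -/

section heckeOp

variable {V : Type u} {E : Type v} [Fintype V] [DecidableEq V] [Fintype E] [DecidableEq E]
  {G : EdgeGraph V E} {n : ℕ} {φ : V → ℝ} {x : V} {k : ℕ} {W : E → E → E → ℂ}
  (hW : G.IsCellSystem n φ W)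

theorem heckeOp_eq (k : ℕ) :
    G.heckeOp x φ W k = G.ofLevelHom x (k + 2) (G.heckeLevel x φ W k) := rfl

theorem initialAlgebra_heckeOp_le (k : ℕ) :
    initialAlgebra (G.heckeOp x φ W) k ≤ (G.ofLevelHom x (k + 1)).range := by
  refine Algebra.adjoin_le ?_
  rintro _ ⟨i, hi, rfl⟩
  exact G.ofLevelHom_range_mono x (Nat.succ_le_succ hi) ⟨_, rfl⟩

namespace IsCellSystem

include hW

theorem star_heckeOp (k : ℕ) : star (G.heckeOp x φ W k) = G.heckeOp x φ W k := by
  rw [heckeOp_eq, star_ofLevelHom, hW.star_heckeLevel]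

theorem heckeOp_mul_self (hpos : ∀ i, 0 < φ i) (k : ℕ) :
    G.heckeOp x φ W k * G.heckeOp x φ W k = (quantumInt n 2 : ℂ) • G.heckeOp x φ W k := by
  rw [heckeOp_eq, ← map_mul, hW.heckeLevel_mul_self hpos, map_smul]

theorem heckeOp_braid (hpos : ∀ i, 0 < φ i) (k : ℕ) :
    G.heckeOp x φ W k * G.heckeOp x φ W (k + 1) * G.heckeOp x φ W k - G.heckeOp x φ W k =
      G.heckeOp x φ W (k + 1) * G.heckeOp x φ W k * G.heckeOp x φ W (k + 1) -
        G.heckeOp x φ W (k + 1) := by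
  rw [heckeOp_eq, heckeOp_eq, ← ofLevelHom_step]
  simp only [← map_mul, ← map_sub]
  rw [hW.heckeLevel_braid hpos]

theorem commute_ofLevelHom_heckeOp (a : G.Level x k) :
    Commute (G.ofLevelHom x k a) (G.heckeOp x φ W k) := by
  rw [heckeOp_eq, ← ofLevelHom_step, ← ofLevelHom_step]
  exact (hW.commute_heckeLevel a).map _

theorem heckeOp_commute (i j : ℕ) (h : i + 2 ≤ j) :
    Commute (G.heckeOp x φ W i) (G.heckeOp x φ W j) := by
  rw [heckeOp_eq i, ← G.ofLevelHom_incl x h]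
  exact hW.commute_ofLevelHom_heckeOp _

theorem trace_mul_heckeOp (hφ : G.IsPerronFrobenius n φ) (hn : 4 ≤ n) (k : ℕ)
    {z : G.PathAlgebra x} (hz : z ∈ initialAlgebra (G.heckeOp x φ W) k) :
    hφ.trace hn x (z * G.heckeOp x φ W k) =
      ((quantumInt n 2 : ℂ) / (quantumInt n 3 : ℂ)) * hφ.trace hn x z := by
  have h3 : (quantumInt n 3 : ℂ) ≠ 0 := by exact_mod_cast (quantumInt_three_pos hn).ne'
  have hx : (φ x : ℂ) ≠ 0 := by exact_mod_cast (hφ.pos x).ne'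
  obtain ⟨a, rfl⟩ := initialAlgebra_heckeOp_le k hz
  change hφ.trace hn x (G.ofLevelHom x (k + 1) a * _) =
    _ * hφ.trace hn x (G.ofLevelHom x (k + 1) a)
  rw [hφ.trace_ofLevelHom hn a, heckeOp_eq, ← ofLevelHom_step, ← map_mul, hφ.trace_ofLevelHom]
  change _ * weightedTrace φ _ = _ * (_ * weightedTrace φ _)
  rw [hφ.weightedTrace_mul_heckeLevel hW]
  field_simp
  ring

end IsCellSystem

end heckeOp

end EdgeGraph

namespace EdgeGraph

/-! ### Matrix units -/

section matrixUnits

variable {V : Type u} {E : Type v} [Fintype V] [DecidableEq V] [Fintype E] [DecidableEq E]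
  {G : EdgeGraph V E} {n : ℕ} {φ : V → ℝ} {x : V} {k : ℕ} {W : E → E → E → ℂ}

/-- The matrix unit of two paths with a common end vertex. -/
def matUnit (p q : G.Path x k) : G.Level x k :=
  fun v => Matrix.of fun r s => if (⟨v, r⟩ : G.Path x k) = p ∧ (⟨v, s⟩ : G.Path x k) = q then 1 else 0

/-- The matrix unit of `μ · e` and `ν · f`. -/
def edgeUnit (μ : G.Path x k) (e : E) (ν : G.Path x k) (f : E) : G.Level x (k + 1) :=
  fun v => Matrix.of fun r s => if Path.init ⟨v, r⟩ = μ ∧ Path.last ⟨v, r⟩ = e ∧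
    Path.init ⟨v, s⟩ = ν ∧ Path.last ⟨v, s⟩ = f then 1 else 0

theorem total_matUnit (p q : G.Path x k) {r s : G.Path x k} (h : r.1 = s.1) :
    total (matUnit p q) r s = if r = p ∧ s = q then 1 else 0 := by
  obtain ⟨v, r⟩ := r
  obtain ⟨w, s⟩ := s
  change v = w at h
  subst h
  rw [total_apply_mk]
  rfl

theorem total_matUnit' {p q : G.Path x k} (hpq : p.1 = q.1) (r s : G.Path x k) :
    total (matUnit p q) r s = if r = p ∧ s = q then 1 else 0 := by
  by_cases h : r.1 = s.1
  · exact total_matUnit p q h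
  · rw [total_apply_ne _ h, if_neg]
    rintro ⟨rfl, rfl⟩
    exact h hpq

theorem total_edgeUnit (μ : G.Path x k) (e : E) (ν : G.Path x k) (f : E)
    {r s : G.Path x (k + 1)} (h : r.1 = s.1) :
    total (edgeUnit μ e ν f) r s =
      if r.init = μ ∧ r.last = e ∧ s.init = ν ∧ s.last = f then 1 else 0 := by
  obtain ⟨v, r⟩ := r
  obtain ⟨w, s⟩ := s
  change v = w at h
  subst h
  rw [total_apply_mk]
  rfl

theorem total_sum_apply {ι : Type*} (t : Finset ι) (f : ι → G.Level x k) (p q : G.Path x k) :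
    total (∑ i ∈ t, f i) p q = ∑ i ∈ t, total (f i) p q := by
  rw [map_sum, Matrix.sum_apply]

theorem level_eq_sum_edgeUnit (a : G.Level x (k + 1)) :
    a = ∑ p : G.Path x (k + 1), ∑ q : G.Path x (k + 1),
      total a p q • edgeUnit p.init p.last q.init q.last := by
  refine level_ext fun r s h => ?_
  have h1 : ∀ p q : G.Path x (k + 1), total (total a p q • edgeUnit p.init p.last q.init q.last) r s =
      if r = p then (if s = q then total a p q else 0) else 0 := by
    intro p q
    rw [total_smul_apply, total_edgeUnit _ _ _ _ h]
    by_cases h2 : r = p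
    · by_cases h3 : s = q
      · simp [h2, h3]
      · rw [if_pos h2, if_neg h3, if_neg, mul_zero]
        exact fun h4 => h3 (Path.ext_succ h4.2.2.1 h4.2.2.2)
    · rw [if_neg h2, if_neg, mul_zero]
      exact fun h4 => h2 (Path.ext_succ h4.1 h4.2.1)
  simp only [total_sum_apply, h1, Finset.sum_ite_irrel, Finset.sum_ite_eq, Finset.mem_univ,
    if_true, Finset.sum_const_zero]

theorem eq_top_of_edgeUnit_mem {B : Subalgebra ℂ (G.Level x (k + 1))}
    (h : ∀ p q : G.Path x (k + 1), p.1 = q.1 → edgeUnit p.init p.last q.init q.last ∈ B) :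
    B = ⊤ := by
  refine Algebra.eq_top_iff.2 fun a => ?_
  rw [level_eq_sum_edgeUnit a]
  refine sum_mem fun p _ => sum_mem fun q _ => ?_
  by_cases hpq : p.1 = q.1
  · exact B.smul_mem (h p q hpq) _
  · rw [total_apply_ne _ hpq, zero_smul]
    exact zero_mem _

theorem edgeUnit_mul_edgeUnit {μ ν ρ : G.Path x k} {e f g : E} (he : G.s f = ν.1)
    (hr : G.r e = G.r f) :
    edgeUnit μ e ν f * edgeUnit ν f ρ g = edgeUnit μ e ρ g := by
  refine level_ext fun p q h => ?_
  rw [total_mul_apply, total_edgeUnit _ _ _ _ h]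
  have h1 : ∀ r : G.Path x (k + 1), total (edgeUnit μ e ν f) p r * total (edgeUnit ν f ρ g) r q =
      if r = ν.snoc f he then
        (if p.init = μ ∧ p.last = e ∧ q.init = ρ ∧ q.last = g then 1 else 0) else 0 := by
    intro r
    by_cases hrp : p.1 = r.1
    · rw [total_edgeUnit _ _ _ _ hrp, total_edgeUnit _ _ _ _ (hrp.symm.trans h)]
      by_cases h2 : r = ν.snoc f he
      · subst h2
        simp only [Path.init_snoc, Path.last_snoc, if_true, true_and, and_true]
        split_ifs <;> simp_all
      · rw [if_neg h2, if_neg, zero_mul]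
        exact fun h3 => h2 (Path.ext_succ (by simpa using h3.2.2.1) (by simpa using h3.2.2.2))
    · rw [total_apply_ne _ hrp, zero_mul]
      split_ifs with h2 h3
      · refine absurd ?_ hrp
        rw [h2, ← p.r_last, h3.2.1, hr]
        rfl
      · rfl
      · rfl
  simp only [h1, Finset.sum_ite_eq', Finset.mem_univ, if_true]

theorem levelStep_matUnit {μ ν : G.Path x k} (h : μ.1 = ν.1) :
    G.levelStep x k (matUnit μ ν) = ∑ e, edgeUnit μ e ν e := by
  refine level_ext fun p q hpq => ?_
  rw [total_levelStep, total_matUnit' h, total_sum_apply]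
  simp only [total_edgeUnit _ _ _ _ hpq]
  rw [Finset.sum_eq_single p.last]
  · by_cases h1 : p.last = q.last
    · simp [h1]
    · simp [h1, Ne.symm h1]
  · intro e _ he
    exact if_neg fun h1 => he h1.2.1.symm
  · simp

namespace IsCellSystem

variable (hW : G.IsCellSystem n φ W)
include hW

/-- Sandwiching a canonical operator between matrix units of the previous level fixes the first
edges of the kernel and leaves the last ones free. This is the tool that extracts single matrix
units below. -/
theorem total_conj_heckeLevel {μ μ' ν ν' : G.Path x (k + 1)} (h : μ.1 = μ'.1) (h' : ν.1 = ν'.1)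
    (p q : G.Path x (k + 2)) :
    total (G.levelStep x (k + 1) (matUnit μ μ') * G.heckeLevel x φ W k *
      G.levelStep x (k + 1) (matUnit ν ν')) p q =
      if p.init = μ ∧ q.init = ν' ∧ μ'.init = ν.init then
        G.cellKernel φ W μ'.last p.last ν.last q.last else 0 := by
  have h1 : ∀ r, total (G.levelStep x (k + 1) (matUnit μ μ') * G.heckeLevel x φ W k) p r =
      if p.init = μ ∧ μ'.init = r.init.init then
        G.cellKernel φ W μ'.last p.last r.init.last r.last else 0 := by
    intro r
    rw [total_mul_apply]
    simp only [total_levelStep, total_matUnit' h, hW.total_heckeLevel]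
    rw [Path.sum_succ_of_support (fun (s : G.Path x (k + 1)) c =>
      (if p.last = c then if p.init = μ ∧ s = μ' then 1 else 0 else 0) *
      (if s.init = r.init.init then G.cellKernel φ W s.last c r.init.last r.last else 0))]
    · by_cases hp : p.init = μ
      · simp only [hp, true_and, ite_mul, one_mul, zero_mul, Finset.sum_ite_eq, Finset.mem_univ,
          if_true]
        rw [Finset.sum_eq_single μ' (fun s _ hs => if_neg hs) (by simp), if_pos rfl]
      · simp [hp]
    · intro s c hs
      have h2 := (ite_ne_right_iff.1 (right_ne_zero_of_mul hs)).2
      exact (hW.support_kernel h2).1.symm.trans s.r_last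
  rw [total_mul_apply]
  simp only [h1, total_levelStep, total_matUnit' h']
  rw [Path.sum_succ_of_support (fun (s : G.Path x (k + 1)) c =>
    (if p.init = μ ∧ μ'.init = s.init then
      G.cellKernel φ W μ'.last p.last s.last c else 0) *
    (if c = q.last then if s = ν ∧ q.init = ν' then 1 else 0 else 0))]
  · by_cases hp : p.init = μ
    · by_cases hq : q.init = ν'
      · simp [hp, hq]
      · simp [hq]
    · simp [hp]
  · intro s c hs
    have h2 := (ite_ne_right_iff.1 (left_ne_zero_of_mul hs)).2
    exact (hW.support_kernel h2).2.1.symm.trans s.r_last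

end IsCellSystem

end matrixUnits

end EdgeGraph

/-! ### Combinatorics of the graph 𝒜⁽ⁿ⁾ -/

section graphA

variable {n : ℕ}

theorem graphA_edge_ext {e f : AEdge n} (hs : (graphA n).s e = (graphA n).s f)
    (hr : (graphA n).r e = (graphA n).r f) : e = f :=
  Subtype.ext (Prod.ext hs hr)

theorem AAdj_edge (e : AEdge n) : AAdj ((graphA n).s e).1 ((graphA n).r e).1 := e.2

/-- The edge between two adjacent vertices. -/
def edgeA {v w : AVertex n} (h : AAdj v.1 w.1) : AEdge n := ⟨(v, w), h⟩

/-- Write ε₁ = (1, 0), ε₂ = (-1, 1), ε₃ = (0, -1) for the three steps. A nonzero difference ε_i -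
ε_j determines i and j, so the difference of the two vertices fixes the steps to a common successor.
-/
theorem AAdj_unique {w w' v v' : ℕ × ℕ} (h1 : AAdj w v) (h2 : AAdj w' v) (h3 : AAdj w v')
    (h4 : AAdj w' v') (h : w ≠ w') : v = v' := by
  obtain ⟨w1, w2⟩ := w
  obtain ⟨w1', w2'⟩ := w'
  obtain ⟨v1, v2⟩ := v
  obtain ⟨v1', v2'⟩ := v'
  simp only [AAdj, Prod.mk.injEq, ne_eq] at *
  omega

/-- The three steps add up to zero, so two different steps in a row are closed by the third. Without
an edge back, the second step must repeat the first. -/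
theorem AAdj_back {u w v v' : ℕ × ℕ} (h : AAdj u w) (h1 : AAdj w v) (h2 : AAdj w v')
    (h3 : ¬ AAdj v u) (h4 : ¬ AAdj v' u) : v = v' := by
  obtain ⟨w1, w2⟩ := w
  obtain ⟨u1, u2⟩ := u
  obtain ⟨v1, v2⟩ := v
  obtain ⟨v1', v2'⟩ := v'
  simp only [AAdj, Prod.mk.injEq, not_or] at *
  obtain ⟨h3, h3', h3''⟩ := h3
  obtain ⟨h4, h4', h4''⟩ := h4
  rcases h with h | h | h <;> rcases h1 with h1 | h1 | h1 <;> rcases h2 with h2 | h2 | h2 <;>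
    omega

/-- Put λ₀ = n - 3 - λ₁ - λ₂ and read indices mod 3: the step ε_i moves one unit from λ_{i-1} to
λ_i. Let ε_i lead from `u` to `w`; then `v` and `v'` arise by the two other steps. One of these is
ε_{i-1}, which takes its unit from a coordinate that ε_i does not change. It can thus be made first,
and its result is the witness. -/
theorem AAdj_detour {u w v v' : AVertex n} (h : AAdj u.1 w.1) (h1 : AAdj w.1 v.1)
    (h2 : AAdj w.1 v'.1) (h3 : AAdj v.1 u.1) (h4 : AAdj v'.1 u.1) (hne : v ≠ v') :
    ∃ w' : AVertex n, w' ≠ w ∧ AAdj u.1 w'.1 ∧ (AAdj w'.1 v.1 ∨ AAdj w'.1 v'.1) := by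
  obtain ⟨⟨w1, w2⟩, hw⟩ := w
  obtain ⟨⟨u1, u2⟩, hu⟩ := u
  obtain ⟨⟨v1, v2⟩, hv⟩ := v
  obtain ⟨⟨v1', v2'⟩, hv'⟩ := v'
  simp only [AAdj, Prod.mk.injEq, ne_eq, Subtype.mk.injEq] at *
  rcases h with h | h | h
  · have h5 : v1 = w1 ∧ v2 + 1 = w2 ∨ v1' = w1 ∧ v2' + 1 = w2 := by
      clear hw hu hv hv'
      rcases h1 with h1 | h1 | h1 <;> rcases h2 with h2 | h2 | h2 <;> omega
    clear h1 h2 h3 h4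
    refine ⟨⟨(u1, u2 - 1), by simp only; omega⟩, ?_, ?_, ?_⟩
    · simp only [Subtype.mk.injEq, Prod.mk.injEq]
      omega
    · simp only [Prod.mk.injEq, true_and]
      omega
    · simp only [Prod.mk.injEq]
      rcases h5 with h5 | h5
      · left
        omega
      · right
        omega
  · have h5 : v1 = w1 + 1 ∧ v2 = w2 ∨ v1' = w1 + 1 ∧ v2' = w2 := by
      clear hw hu hv hv'
      rcases h1 with h1 | h1 | h1 <;> rcases h2 with h2 | h2 | h2 <;> omega
    clear h1 h2 h3 h4
    refine ⟨⟨(u1 + 1, u2), by simp only; omega⟩, ?_, ?_, ?_⟩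
    · simp only [Subtype.mk.injEq, Prod.mk.injEq]
      omega
    · exact Or.inl rfl
    · simp only [Prod.mk.injEq]
      rcases h5 with h5 | h5
      · left
        omega
      · right
        omega
  · have h5 : v1 + 1 = w1 ∧ v2 = w2 + 1 ∨ v1' + 1 = w1 ∧ v2' = w2 + 1 := by
      clear hw hu hv hv'
      rcases h1 with h1 | h1 | h1 <;> rcases h2 with h2 | h2 | h2 <;> omega
    clear h1 h2 h3 h4
    refine ⟨⟨(u1 - 1, u2 + 1), by simp only; omega⟩, ?_, ?_, ?_⟩
    · simp only [Subtype.mk.injEq, Prod.mk.injEq]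
      omega
    · simp only [Prod.mk.injEq, and_true]
      omega
    · simp only [Prod.mk.injEq]
      rcases h5 with h5 | h5
      · left
        omega
      · right
        omega

/-- If `w` and `w'` are v - ε_i and v - ε_j, the witness is u = v - ε_i - ε_j, which is v + ε_k for
the third step and hence a successor of `v`. The steps from `u` to `w` and `w'` differ, so at least
one of them is not ε₃ and raises λ₁ + 2 λ₂ by exactly one; the corresponding `t` or `t'` can be
kept. -/
theorem AAdj_common_pred {w w' v : AVertex n} (h1 : AAdj w.1 v.1) (h2 : AAdj w'.1 v.1)
    (hne : w ≠ w') {m t t' : ℕ} (ht : m + 1 = w.1.1 + 2 * w.1.2 + 3 * t)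
    (ht' : m + 1 = w'.1.1 + 2 * w'.1.2 + 3 * t') :
    ∃ u : AVertex n, AAdj u.1 w.1 ∧ AAdj u.1 w'.1 ∧ AAdj v.1 u.1 ∧
      ∃ t'', m = u.1.1 + 2 * u.1.2 + 3 * t'' := by
  obtain ⟨⟨w1, w2⟩, hw⟩ := w
  obtain ⟨⟨w1', w2'⟩, hw'⟩ := w'
  obtain ⟨⟨v1, v2⟩, hv⟩ := v
  simp only [AAdj, Prod.mk.injEq, ne_eq, Subtype.mk.injEq] at *
  have key : ∀ u1 u2, u1 + u2 + 3 ≤ n → (w1 = u1 + 1 ∧ w2 = u2 ∨ w1 + 1 = u1 ∧ w2 = u2 + 1 ∨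
      w1 = u1 ∧ w2 + 1 = u2) → (w1' = u1 + 1 ∧ w2' = u2 ∨ w1' + 1 = u1 ∧ w2' = u2 + 1 ∨
      w1' = u1 ∧ w2' + 1 = u2) → (u1 = v1 + 1 ∧ u2 = v2 ∨ u1 + 1 = v1 ∧ u2 = v2 + 1 ∨
      u1 = v1 ∧ u2 + 1 = v2) → (m = u1 + 2 * u2 + 3 * t ∨ m = u1 + 2 * u2 + 3 * t') →
      ∃ u : AVertex n, (w1 = u.1.1 + 1 ∧ w2 = u.1.2 ∨ w1 + 1 = u.1.1 ∧ w2 = u.1.2 + 1 ∨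
        (w1, w2 + 1) = u.1) ∧ (w1' = u.1.1 + 1 ∧ w2' = u.1.2 ∨ w1' + 1 = u.1.1 ∧ w2' = u.1.2 + 1 ∨
        (w1', w2' + 1) = u.1) ∧ (u.1 = (v1 + 1, v2) ∨ u.1.1 + 1 = v1 ∧ u.1.2 = v2 + 1 ∨
        u.1.1 = v1 ∧ u.1.2 + 1 = v2) ∧ ∃ t'', m = u.1.1 + 2 * u.1.2 + 3 * t'' := by
    intro u1 u2 hu h3 h4 h5 h6
    refine ⟨⟨(u1, u2), hu⟩, ?_, ?_, ?_, ?_⟩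
    · simpa only [Prod.mk.injEq] using h3
    · simpa only [Prod.mk.injEq] using h4
    · simpa only [Prod.mk.injEq] using h5
    · rcases h6 with h6 | h6
      · exact ⟨t, h6⟩
      · exact ⟨t', h6⟩
  rcases h1 with h1 | h1 | h1 <;> rcases h2 with h2 | h2 | h2
  · omega
  · exact key v1 (v2 - 1) (by omega) (by omega) (by omega) (by omega) (by omega)
  · exact key (v1 - 1) (v2 + 1) (by omega) (by omega) (by omega) (by omega) (by omega)
  · exact key v1 (v2 - 1) (by omega) (by omega) (by omega) (by omega) (by omega)
  · omega
  · exact key (v1 + 1) v2 (by omega) (by omega) (by omega) (by omega) (by omega)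
  · exact key (v1 - 1) (v2 + 1) (by omega) (by omega) (by omega) (by omega) (by omega)
  · exact key (v1 + 1) v2 (by omega) (by omega) (by omega) (by omega) (by omega)
  · omega

/-- The height λ₁ + 2 λ₂ changes by 1, 1 or -2 along the three kinds of edges, so length minus
height grows by 0 or 3. Conversely, a path is found by stepping backwards to smaller height, and
from the origin around a triangle. -/
theorem nonempty_pathTo_graphA (hn : 4 ≤ n) (k : ℕ) (v : AVertex n) :
    Nonempty ((graphA n).PathTo (originA n hn) k v) ↔ ∃ t, k = v.1.1 + 2 * v.1.2 + 3 * t := by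
  constructor
  · rintro ⟨p⟩
    suffices h : ∀ p : (graphA n).Path (originA n hn) k,
        ∃ t, k = p.1.1.1 + 2 * p.1.1.2 + 3 * t from h ⟨v, p⟩
    clear p
    induction k with
    | zero => 
      intro p
      rw [p.fst_zero]
      exact ⟨0, rfl⟩
    | succ k ih =>
      intro p
      obtain ⟨t, ht⟩ := ih p.init
      have h := AAdj_edge p.last
      rw [p.r_last, p.s_last] at h
      simp only [AAdj, Prod.ext_iff] at h
      rcases h with h | h | h
      · exact ⟨t, by omega⟩
      · exact ⟨t, by omega⟩
      · exact ⟨t + 1, by omega⟩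
  · suffices h : ∀ k (v : AVertex n), (∃ t, k = v.1.1 + 2 * v.1.2 + 3 * t) →
        ∃ p : (graphA n).Path (originA n hn) k, p.1 = v by
      intro hk
      obtain ⟨p, rfl⟩ := h k v hk
      exact ⟨p.2⟩
    clear v k
    have step : ∀ k (v w : AVertex n), AAdj w.1 v.1 →
        (∃ p : (graphA n).Path (originA n hn) k, p.1 = w) →
        ∃ p : (graphA n).Path (originA n hn) (k + 1), p.1 = v := by
      rintro k v w h ⟨p, rfl⟩
      exact ⟨p.snoc (edgeA h) rfl, rfl⟩
    intro k
    induction k with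
    | zero =>
      rintro ⟨⟨a, b⟩, hv⟩ ⟨t, ht⟩
      have h : a = 0 ∧ b = 0 := by simp only at ht; omega
      obtain ⟨rfl, rfl⟩ := h
      exact ⟨⟨originA n hn, ⟨PUnit.unit, rfl⟩⟩, rfl⟩
    | succ k ih =>
      rintro ⟨⟨a, b⟩, hv⟩ ⟨t, ht⟩
      simp only at ht hv
      rcases a with _ | a
      · rcases b with _ | b
        -- At the origin `k + 1 = 3 * t` forces t ≥ 1. The predecessor (0, 1) has height 2 and uses
        -- up one of the `t` rounds.
        · refine step k _ ⟨(0, 1), by simp only; omega⟩ (by simp [AAdj]) (ih _ ⟨t - 1, ?_⟩)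
          simp only
          omega
        · refine step k _ ⟨(1, b), by simp only; omega⟩ (by simp [AAdj]) (ih _ ⟨t, ?_⟩)
          simp only
          omega
      · refine step k _ ⟨(a, b), by simp only; omega⟩ (by simp [AAdj]) (ih _ ⟨t, ?_⟩)
        simp only
        omega

/-! ### The canonical operators generate the path algebra of 𝒜⁽ⁿ⁾ -/

section generation

open EdgeGraph

variable {φ : AVertex n → ℝ} {W : AEdge n → AEdge n → AEdge n → ℂ}
  (hpos : ∀ i, 0 < φ i) (hW : (graphA n).IsCellSystem n φ W)
include hpos hW

/-- In a graph without multiple edges two edges of a triangle determine the third, so the sum over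
inner edges has one term. -/
theorem cellKernel_graphA_eq {l b c b' c' : AEdge n} (h : W l b c ≠ 0) :
    (graphA n).cellKernel φ W b c b' c' =
      (graphA n).edgeWeight φ l * W l b c * conj (W l b' c') := by
  refine Finset.sum_eq_single l (fun m _ hm => ?_) (by simp)
  have h0 : W m b c = 0 := by
    by_contra h1
    obtain ⟨h2, -, h3⟩ := hW.support _ _ _ h
    obtain ⟨h4, -, h5⟩ := hW.support _ _ _ h1
    exact hm (graphA_edge_ext (h5.symm.trans h3) (h4.trans h2.symm))
  rw [h0, mul_zero, zero_mul]

theorem edgeWeight_ne_zero (l : AEdge n) : (graphA n).edgeWeight φ l ≠ 0 := fun h => by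
  simpa [h] using edgeWeight_mul (G := graphA n) hpos l

/-- Two paths of length two between the same vertices, with different middle vertices, are related
by a nonzero Hecke coefficient if their ends are joined by an edge. -/
theorem cellKernel_graphA_ne_zero {b e b' e' : AEdge n}
    (hs : (graphA n).s b = (graphA n).s b') (hne : (graphA n).r b ≠ (graphA n).r b')
    (he : (graphA n).s e = (graphA n).r b) (he' : (graphA n).s e' = (graphA n).r b')
    (hr : (graphA n).r e = (graphA n).r e') :
    (graphA n).cellKernel φ W b e b' e' ≠ 0 := by
  have hne' : b ≠ b' := fun h => hne (by rw [h])
  -- For this frame only the first delta term survives and it is positive, so some product of cells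
  -- is nonzero. Its triangles pass through a common successor of the ranges of `b` and `b'`; that
  -- successor is unique, hence it is the range of `e`.
  have h2 := hW.typeII b b b' b' hs hs rfl rfl
  rw [if_pos ⟨rfl, rfl⟩, if_neg fun h => hne' h.1, add_zero] at h2
  have h3 : ((φ ((graphA n).s b) * φ ((graphA n).r b) * φ ((graphA n).r b') : ℝ) : ℂ) ≠ 0 :=
    Complex.ofReal_ne_zero.2 (mul_pos (mul_pos (hpos _) (hpos _)) (hpos _)).ne'
  rw [← h2] at h3
  obtain ⟨f, -, h3⟩ := Finset.exists_ne_zero_of_sum_ne_zero h3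
  obtain ⟨f', -, h3⟩ := Finset.exists_ne_zero_of_sum_ne_zero h3
  obtain ⟨c, -, h3⟩ := Finset.exists_ne_zero_of_sum_ne_zero h3
  obtain ⟨c', -, h3⟩ := Finset.exists_ne_zero_of_sum_ne_zero h3
  have h4 := left_ne_zero_of_mul (left_ne_zero_of_mul (right_ne_zero_of_mul h3))
  have h5 : W b f c ≠ 0 := left_ne_zero_of_mul h4
  have h6 : W b' f' c ≠ 0 := (map_ne_zero _).1 (right_ne_zero_of_mul h4)
  obtain ⟨h7, h8, -⟩ := hW.support _ _ _ h5
  obtain ⟨h7', h8', -⟩ := hW.support _ _ _ h6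
  have hv : (graphA n).r f = (graphA n).r e := by
    have a1 := AAdj_edge f
    have a2 := AAdj_edge f'
    have a3 := AAdj_edge e
    have a4 := AAdj_edge e'
    rw [← h7] at a1
    rw [← h7', h8', ← h8] at a2
    rw [he] at a3
    rw [he', ← hr] at a4
    exact Subtype.ext (AAdj_unique a1 a2 a3 a4 fun h => hne (Subtype.ext h))
  have hf : f = e := graphA_edge_ext (h7.symm.trans he.symm) hv
  have hf' : f' = e' := graphA_edge_ext (h7'.symm.trans he'.symm)
    ((h8'.trans h8.symm).trans (hv.trans hr))
  subst hf hf'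
  rw [← hW.cyclic] at h5 h6
  rw [cellKernel_graphA_eq hpos hW h5]
  exact mul_ne_zero (mul_ne_zero (edgeWeight_ne_zero hpos hW c) h5) ((map_ne_zero _).2 h6)

section step

variable (hn : 4 ≤ n) {m : ℕ} {B : Subalgebra ℂ ((graphA n).Level (originA n hn) (m + 2))}
  (hstep : ∀ a, (graphA n).levelStep (originA n hn) (m + 1) a ∈ B)
  (hU : (graphA n).heckeLevel (originA n hn) φ W m ∈ B)
include hstep hU

/-- The sandwich of the canonical operator between (μ, σ b) and (σ b', ν) only sees pairs of edges
from the ends of μ and ν to a common successor. There is one such pair, so the result is a nonzero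
multiple of a single matrix unit. -/
theorem edgeUnit_mem_of_common_pred {μ ν : (graphA n).Path (originA n hn) (m + 1)} {e f : AEdge n}
    {σ : (graphA n).Path (originA n hn) m} {b b' : AEdge n}
    (hb : (graphA n).s b = σ.1) (hb' : (graphA n).s b' = σ.1)
    (hbμ : (graphA n).r b = μ.1) (hbν : (graphA n).r b' = ν.1)
    (he : (graphA n).s e = μ.1) (hf : (graphA n).s f = ν.1) (hne : μ.1 ≠ ν.1)
    (hr : (graphA n).r e = (graphA n).r f) : edgeUnit μ e ν f ∈ B := by
  have hK : (graphA n).cellKernel φ W b e b' f ≠ 0 :=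
    cellKernel_graphA_ne_zero hpos hW (hb.trans hb'.symm) (by rwa [hbμ, hbν]) (he.trans hbμ.symm)
      (hf.trans hbν.symm) hr
  have hX : (graphA n).levelStep (originA n hn) (m + 1) (matUnit μ (σ.snoc b hb)) *
      (graphA n).heckeLevel (originA n hn) φ W m *
      (graphA n).levelStep (originA n hn) (m + 1) (matUnit (σ.snoc b' hb') ν) =
      (graphA n).cellKernel φ W b e b' f • edgeUnit μ e ν f := by
    refine level_ext fun p q hpq => ?_
    rw [hW.total_conj_heckeLevel hbμ.symm hbν, total_smul_apply, total_edgeUnit _ _ _ _ hpq]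
    simp only [Path.init_snoc, Path.last_snoc, and_true]
    by_cases h : p.init = μ ∧ q.init = ν
    · obtain ⟨rfl, rfl⟩ := h
      have hv : p.1 = (graphA n).r e := by
        have a1 := AAdj_edge p.last
        have a2 := AAdj_edge q.last
        have a3 := AAdj_edge e
        have a4 := AAdj_edge f
        rw [p.r_last] at a1
        rw [q.r_last, ← hpq] at a2
        rw [he] at a3
        rw [hf, ← hr] at a4
        exact Subtype.ext (AAdj_unique a1 a2 a3 a4 fun h => hne (Subtype.ext h))
      have h1 : p.last = e := graphA_edge_ext he.symm (p.r_last.trans hv)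
      have h2 : q.last = f := graphA_edge_ext hf.symm (q.r_last.trans (hpq.symm.trans (hv.trans hr)))
      simp [h1, h2]
    · rw [if_neg h, if_neg, mul_zero]
      exact fun h' => h ⟨h'.1, h'.2.2.1⟩
  have hmem := mul_mem (mul_mem (hstep (matUnit μ (σ.snoc b hb))) hU)
    (hstep (matUnit (σ.snoc b' hb') ν))
  rw [hX] at hmem
  have := B.smul_mem hmem ((graphA n).cellKernel φ W b e b' f)⁻¹
  rwa [smul_smul, inv_mul_cancel₀ hK, one_smul] at this

theorem exists_mem_of_ne {μ ν : (graphA n).Path (originA n hn) (m + 1)} {e f : AEdge n}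
    (he : (graphA n).s e = μ.1) (hf : (graphA n).s f = ν.1) (hne : μ.1 ≠ ν.1)
    (hr : (graphA n).r e = (graphA n).r f) : edgeUnit μ e ν f ∈ B := by
  obtain ⟨t, ht⟩ := (nonempty_pathTo_graphA hn (m + 1) μ.1).1 ⟨μ.2⟩
  obtain ⟨t', ht'⟩ := (nonempty_pathTo_graphA hn (m + 1) ν.1).1 ⟨ν.2⟩
  have a1 := AAdj_edge e
  have a2 := AAdj_edge f
  rw [he] at a1
  rw [hf, ← hr] at a2
  obtain ⟨u, h1, h2, -, h3⟩ := AAdj_common_pred a1 a2 hne ht ht'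
  obtain ⟨σ⟩ := (nonempty_pathTo_graphA hn m u).2 h3
  exact edgeUnit_mem_of_common_pred hpos hW hn hstep hU (σ := ⟨u, σ⟩) (b := edgeA h1)
    (b' := edgeA h2) rfl rfl rfl rfl he hf hne hr

/-- The matrix units of `μ · e` and `ν · e` lie in `B` if the range of `e` has another
predecessor that can be reached from the last but one vertex of `μ`. -/
theorem edgeUnit_mem_of_detour {μ₀ μ ν : (graphA n).Path (originA n hn) (m + 1)} {e : AEdge n}
    (hμ : μ.1 = μ₀.1) (hν : ν.1 = μ₀.1) (he : (graphA n).s e = μ₀.1) {w : AVertex n}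
    (hw : w ≠ μ₀.1) (h1 : AAdj μ₀.init.1.1 w.1) (h2 : AAdj w.1 ((graphA n).r e).1) :
    edgeUnit μ e ν e ∈ B := by
  let ρ := μ₀.init.snoc (edgeA h1) rfl
  have hρ : ρ.1 = w := rfl
  have hf : (graphA n).s (edgeA h2) = ρ.1 := rfl
  have hr : (graphA n).r e = (graphA n).r (edgeA h2) := rfl
  rw [← edgeUnit_mul_edgeUnit (ν := ρ) (f := edgeA h2) hf hr]
  refine mul_mem ?_ ?_
  · exact exists_mem_of_ne hpos hW hn hstep hU (he.trans hμ.symm) hf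
      (fun h => hw (hρ.symm.trans (h.symm.trans hμ))) hr
  · exact exists_mem_of_ne hpos hW hn hstep hU hf (he.trans hν.symm)
      (fun h => hw (hρ.symm.trans (h.trans hν))) hr.symm

theorem sum_edgeUnit_mem {μ₀ μ ν : (graphA n).Path (originA n hn) (m + 1)}
    (hμ : μ.1 = μ₀.1) (hν : ν.1 = μ₀.1) :
    ∑ e, (graphA n).cellKernel φ W μ₀.last e μ₀.last e • edgeUnit μ e ν e ∈ B := by
  have hX : (graphA n).levelStep (originA n hn) (m + 1) (matUnit μ μ₀) *
      (graphA n).heckeLevel (originA n hn) φ W m *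
      (graphA n).levelStep (originA n hn) (m + 1) (matUnit μ₀ ν) =
      ∑ e, (graphA n).cellKernel φ W μ₀.last e μ₀.last e • edgeUnit μ e ν e := by
    refine level_ext fun p q hpq => ?_
    rw [hW.total_conj_heckeLevel hμ hν.symm, total_sum_apply]
    simp only [total_smul_apply, total_edgeUnit _ _ _ _ hpq]
    by_cases h : p.init = μ ∧ q.init = ν
    · obtain ⟨rfl, rfl⟩ := h
      have h1 : q.last = p.last := graphA_edge_ext (hν.trans hμ.symm)
        (q.r_last.trans (hpq.symm.trans p.r_last.symm))
      simp [h1]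
    · rw [if_neg fun h' => h ⟨h'.1, h'.2.1⟩]
      refine (Finset.sum_eq_zero fun e _ => ?_).symm
      rw [if_neg, mul_zero]
      exact fun h' => h ⟨h'.1, h'.2.2.1⟩
  rw [← hX]
  exact mul_mem (mul_mem (hstep _) hU) (hstep _)

theorem edgeUnit_eq_zero {μ ν : (graphA n).Path (originA n hn) (m + 1)} {e : AEdge n}
    (he : (graphA n).s e ≠ μ.1) : edgeUnit μ e ν e = 0 := by
  refine level_ext fun p q hpq => ?_
  rw [total_edgeUnit _ _ _ _ hpq, if_neg, map_zero, Matrix.zero_apply]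
  rintro ⟨rfl, rfl, -⟩
  exact he rfl

/-- The combination in `sum_edgeUnit_mem` only involves edges whose range is joined back to the last
but one vertex of μ₀. By `AAdj_detour`, of any two such edges one admits a detour, so all terms
except possibly one are known to lie in `B`, and that one can be solved for. -/
theorem edgeUnit_mem_of_coeff_ne_zero {μ₀ μ ν : (graphA n).Path (originA n hn) (m + 1)}
    {e : AEdge n} (hμ : μ.1 = μ₀.1) (hν : ν.1 = μ₀.1) (he : (graphA n).s e = μ₀.1)
    (hc : (graphA n).cellKernel φ W μ₀.last e μ₀.last e ≠ 0) : edgeUnit μ e ν e ∈ B := by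
  -- Assuming the contrary discards the case in which the detour supplied by `AAdj_detour` belongs
  -- to `e` itself.
  by_contra hbad
  have hback : ∀ f, (graphA n).cellKernel φ W μ₀.last f μ₀.last f ≠ 0 →
      AAdj ((graphA n).r f).1 μ₀.init.1.1 := by
    intro f hf
    obtain ⟨l, hl, -⟩ := cellKernel_ne_zero hf
    obtain ⟨h1, -, h3⟩ := hW.support _ _ _ hl
    have := AAdj_edge l
    rwa [← h3, h1] at this
  refine hbad ?_
  have hrest : ∀ f ∈ Finset.univ.erase e,
      (graphA n).cellKernel φ W μ₀.last f μ₀.last f • edgeUnit μ f ν f ∈ B := by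
    intro f hf
    by_cases hcf : (graphA n).cellKernel φ W μ₀.last f μ₀.last f = 0
    · rw [hcf, zero_smul]
      exact zero_mem _
    refine B.smul_mem ?_ _
    by_cases hsf : (graphA n).s f = μ₀.1
    · have a0 := AAdj_edge μ₀.last
      have a1 := AAdj_edge e
      have a2 := AAdj_edge f
      rw [he] at a1
      rw [hsf] at a2
      rw [μ₀.r_last, μ₀.s_last] at a0
      obtain ⟨w, hw, h1, h2 | h2⟩ := AAdj_detour a0 a1 a2 (hback e hc) (hback f hcf)
        fun h => (Finset.mem_erase.1 hf).1 (graphA_edge_ext (hsf.trans he.symm) h.symm)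
      · exact absurd (edgeUnit_mem_of_detour hpos hW hn hstep hU hμ hν he hw h1 h2) hbad
      · exact edgeUnit_mem_of_detour hpos hW hn hstep hU hμ hν hsf hw h1 h2
    · rw [edgeUnit_eq_zero hpos hW hn hstep hU (by rwa [hμ])]
      exact zero_mem _
  have h1 := sum_edgeUnit_mem hpos hW hn hstep hU hμ hν
  rw [← Finset.add_sum_erase _ _ (Finset.mem_univ e)] at h1
  have h2 := sub_mem h1 (sum_mem hrest)
  rw [add_sub_cancel_right] at h2
  have := B.smul_mem h2 ((graphA n).cellKernel φ W μ₀.last e μ₀.last e)⁻¹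
  rwa [smul_smul, inv_mul_cancel₀ hc, one_smul] at this

/-- Type I for the edge that leads back provides a nonzero cell on it. Either this triangle passes
through the end of μ₀, so that the diagonal coefficient is nonzero, or its middle vertex is a
detour. -/
theorem edgeUnit_mem_of_back {μ₀ μ ν : (graphA n).Path (originA n hn) (m + 1)}
    {e : AEdge n} (hμ : μ.1 = μ₀.1) (hν : ν.1 = μ₀.1) (he : (graphA n).s e = μ₀.1)
    (hback : AAdj ((graphA n).r e).1 μ₀.init.1.1) : edgeUnit μ e ν e ∈ B := by
  have h1 := hW.sum_mul_conj (edgeA hback) (edgeA hback)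
  rw [if_pos rfl] at h1
  have hne : (quantumInt n 2 : ℂ) * ((φ ((graphA n).s (edgeA hback)) : ℂ) *
      (φ ((graphA n).r (edgeA hback)) : ℂ)) ≠ 0 := by
    exact_mod_cast (mul_pos (quantumInt_two_pos hn) (mul_pos (hpos _) (hpos _))).ne'
  rw [← h1] at hne
  obtain ⟨b, -, h2⟩ := Finset.exists_ne_zero_of_sum_ne_zero hne
  obtain ⟨c, -, h2⟩ := Finset.exists_ne_zero_of_sum_ne_zero h2
  have h3 := left_ne_zero_of_mul h2
  obtain ⟨h4, h5, h6⟩ := hW.support _ _ _ h3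
  change μ₀.init.1 = (graphA n).s b at h4
  change (graphA n).r c = (graphA n).r e at h6
  by_cases hw : (graphA n).r b = μ₀.1
  · have hb : b = μ₀.last := graphA_edge_ext h4.symm (hw.trans μ₀.r_last.symm)
    have hc : c = e := graphA_edge_ext (h5.symm.trans (hw.trans he.symm)) h6
    subst hb hc
    refine edgeUnit_mem_of_coeff_ne_zero hpos hW hn hstep hU hμ hν he ?_
    rw [cellKernel_graphA_eq hpos hW h3]
    exact mul_ne_zero (mul_ne_zero (edgeWeight_ne_zero hpos hW _) h3) ((map_ne_zero _).2 h3)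
  · have a1 := AAdj_edge b
    have a2 := AAdj_edge c
    rw [← h4] at a1
    rw [← h5, h6] at a2
    exact edgeUnit_mem_of_detour hpos hW hn hstep hU hμ hν he hw a1 a2

/-- The included matrix unit (μ, ν) is the sum of all (μ e, ν e). By `AAdj_back` at most one of
these edges is not joined back to the last but one vertex of μ, so its term is the difference of
elements of `B`. -/
theorem edgeUnit_mem {μ ν : (graphA n).Path (originA n hn) (m + 1)}
    {e : AEdge n} (hν : ν.1 = μ.1) (he : (graphA n).s e = μ.1) : edgeUnit μ e ν e ∈ B := by
  by_contra hbad
  refine hbad ?_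
  have hrest : ∀ f ∈ Finset.univ.erase e, edgeUnit μ f ν f ∈ B := by
    intro f hf
    by_cases hsf : (graphA n).s f = μ.1
    · by_cases hbf : AAdj ((graphA n).r f).1 μ.init.1.1
      · exact edgeUnit_mem_of_back hpos hW hn hstep hU rfl hν hsf hbf
      by_cases hbe : AAdj ((graphA n).r e).1 μ.init.1.1
      · exact absurd (edgeUnit_mem_of_back hpos hW hn hstep hU rfl hν he hbe) hbad
      have a0 := AAdj_edge μ.last
      have a1 := AAdj_edge e
      have a2 := AAdj_edge f
      rw [he] at a1
      rw [hsf] at a2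
      rw [μ.r_last, μ.s_last] at a0
      exact absurd (graphA_edge_ext (hsf.trans he.symm)
        (Subtype.ext (AAdj_back a0 a2 a1 hbf hbe))) (Finset.mem_erase.1 hf).1
    · rw [edgeUnit_eq_zero hpos hW hn hstep hU hsf]
      exact zero_mem _
  have h1 := hstep (matUnit μ ν)
  rw [levelStep_matUnit hν.symm, ← Finset.add_sum_erase _ _ (Finset.mem_univ e)] at h1
  have h2 := sub_mem h1 (sum_mem hrest)
  rwa [add_sub_cancel_right] at h2

theorem eq_top_of_step_of_hecke : B = ⊤ := by
  refine eq_top_of_edgeUnit_mem fun p q hpq => ?_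
  by_cases h : p.init.1 = q.init.1
  · have h1 : q.last = p.last := graphA_edge_ext h.symm
      (q.r_last.trans (hpq.symm.trans p.r_last.symm))
    rw [h1]
    exact edgeUnit_mem hpos hW hn hstep hU h.symm rfl
  · exact exists_mem_of_ne hpos hW hn hstep hU rfl rfl h
      (p.r_last.trans (hpq.trans q.r_last.symm))

end step

theorem ofLevelHom_mem_of_subsingleton (hn : 4 ≤ n) {k : ℕ}
    (hk : ∀ p q : (graphA n).Path (originA n hn) k, p = q)
    (S : Subalgebra ℂ ((graphA n).PathAlgebra (originA n hn)))
    (a : (graphA n).Level (originA n hn) k) :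
    (graphA n).ofLevelHom (originA n hn) k a ∈ S := by
  have h : ∃ c : ℂ, a = c • 1 := by
    by_cases hp : Nonempty ((graphA n).Path (originA n hn) k)
    · obtain ⟨p⟩ := hp
      refine ⟨total a p p, level_ext fun r s _ => ?_⟩
      rw [total_smul_apply, total_one_apply, if_pos (hk r s), mul_one, hk r p, hk s p]
    · exact ⟨0, level_ext fun r => absurd ⟨r⟩ hp⟩
  obtain ⟨c, rfl⟩ := h
  rw [map_smul, map_one]
  exact S.smul_mem (one_mem _) c

/-- The levels of `A(𝒜)` are generated by the canonical operators that they contain. -/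
theorem ofLevelHom_mem_initialAlgebra (hn : 4 ≤ n) (k : ℕ)
    (a : (graphA n).Level (originA n hn) k) :
    (graphA n).ofLevelHom (originA n hn) k a ∈
      initialAlgebra ((graphA n).heckeOp (originA n hn) φ W) (k - 1) := by
  -- The truncated `k - 1` is harmless: the origin has a single outgoing edge, so levels 0 and 1
  -- consist of scalars and need no generators.
  induction k with
  | zero => exact ofLevelHom_mem_of_subsingleton hpos hW hn Path.eq_of_zero _ a
  | succ k ih =>
    rcases k with _ | m
    · refine ofLevelHom_mem_of_subsingleton hpos hW hn (fun p q => ?_) _ a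
      have key : ∀ p : (graphA n).Path (originA n hn) 1, (p.1 : AVertex n).1 = (1, 0) := by
        intro p
        have h := AAdj_edge p.last
        rw [p.r_last, p.s_last, p.init.fst_zero] at h
        simpa [AAdj, originA] using h
      refine Path.ext_succ (Path.eq_of_zero _ _) (graphA_edge_ext ?_ ?_)
      · rw [p.s_last, q.s_last, p.init.fst_zero, q.init.fst_zero]
      · rw [p.r_last, q.r_last]
        exact Subtype.ext ((key p).trans (key q).symm)
    · have h := eq_top_of_step_of_hecke hpos hW hn
        (B := (initialAlgebra ((graphA n).heckeOp (originA n hn) φ W) (m + 1)).comap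
          ((graphA n).ofLevelHom (originA n hn) (m + 2))) (fun a => ?_) ?_
      · have ha : a ∈ (⊤ : Subalgebra ℂ ((graphA n).Level (originA n hn) (m + 2))) :=
          Algebra.mem_top
        rw [← h] at ha
        exact ha
      · change (graphA n).ofLevelHom (originA n hn) (m + 1 + 1) _ ∈
          initialAlgebra ((graphA n).heckeOp (originA n hn) φ W) (m + 1)
        rw [ofLevelHom_step]
        exact initialAlgebra_mono _ (Nat.le_succ m) (ih a)
      · exact gen_mem_initialAlgebra _ (Nat.lt_succ_self m)

end generation

end graphA

namespace EdgeGraph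

theorem star_algebraMap_pathAlgebra {V : Type u} {E : Type v} [DecidableEq V] [Fintype E]
    [DecidableEq E] (G : EdgeGraph V E) (x : V) (c : ℂ) :
    star (algebraMap ℂ (G.PathAlgebra x) c) = algebraMap ℂ (G.PathAlgebra x) (conj c) := by
  rw [← (G.ofLevelHom x 0).commutes, ← (G.ofLevelHom x 0).commutes, star_ofLevelHom]
  congr 1

/-! ### Comparison of the canonical operators of two cell systems -/

section comparison

variable {V₁ E₁ V₂ E₂ : Type*} [Fintype V₁] [DecidableEq V₁] [Fintype E₁] [DecidableEq E₁]
  [Fintype V₂] [DecidableEq V₂] [Fintype E₂] [DecidableEq E₂]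
  {G : EdgeGraph V₁ E₁} {H : EdgeGraph V₂ E₂} {n : ℕ} {φ : V₁ → ℝ} {ψ : V₂ → ℝ}
  {W : E₁ → E₁ → E₁ → ℂ} {X : E₂ → E₂ → E₂ → ℂ}
  (hn : 4 ≤ n) (hφ : G.IsPerronFrobenius n φ) (hW : G.IsCellSystem n φ W)
  (hψ : H.IsPerronFrobenius n ψ) (hX : H.IsCellSystem n ψ X) (x : V₁) (y : V₂)

/-- The pairs of canonical operators of two cell systems. -/
noncomputable def heckePair (G : EdgeGraph V₁ E₁) (H : EdgeGraph V₂ E₂) (φ : V₁ → ℝ)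
    (W : E₁ → E₁ → E₁ → ℂ) (ψ : V₂ → ℝ) (X : E₂ → E₂ → E₂ → ℂ) (x : V₁) (y : V₂) (m : ℕ) :
    G.PathAlgebra x × H.PathAlgebra y :=
  (G.heckeOp x φ W m, H.heckeOp y ψ X m)

theorem map_fst_initialAlgebra (k : ℕ) :
    (initialAlgebra (heckePair G H φ W ψ X x y) k).map (AlgHom.fst ℂ _ _) =
      initialAlgebra (G.heckeOp x φ W) k := by
  rw [initialAlgebra, AlgHom.map_adjoin, ← Set.image_comp]
  rfl

theorem map_snd_initialAlgebra (k : ℕ) :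
    (initialAlgebra (heckePair G H φ W ψ X x y) k).map (AlgHom.snd ℂ _ _) =
      initialAlgebra (H.heckeOp y ψ X) k := by
  rw [initialAlgebra, AlgHom.map_adjoin, ← Set.image_comp]
  rfl

theorem exists_mem_adjoin_heckePair
    (hgen : Algebra.adjoin ℂ (Set.range (G.heckeOp x φ W)) = ⊤) (a : G.PathAlgebra x) :
    ∃ z ∈ Algebra.adjoin ℂ (Set.range (heckePair G H φ W ψ X x y)), z.1 = a := by
  have h : (Algebra.adjoin ℂ (Set.range (heckePair G H φ W ψ X x y))).map
      (AlgHom.fst ℂ _ _) = ⊤ := by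
    rw [AlgHom.map_adjoin, ← Set.range_comp, ← hgen]
    rfl
  have ha : a ∈ (⊤ : Subalgebra ℂ (G.PathAlgebra x)) := Algebra.mem_top
  rw [← h] at ha
  obtain ⟨z, hz, rfl⟩ := ha
  exact ⟨z, hz, rfl⟩

include hW hX

theorem star_mem_adjoin_heckePair {z : G.PathAlgebra x × H.PathAlgebra y}
    (hz : z ∈ Algebra.adjoin ℂ (Set.range (heckePair G H φ W ψ X x y))) :
    star z ∈ Algebra.adjoin ℂ (Set.range (heckePair G H φ W ψ X x y)) := by
  induction hz using Algebra.adjoin_induction with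
  | mem z hz =>
    obtain ⟨m, rfl⟩ := hz
    have h : star (heckePair G H φ W ψ X x y m) = heckePair G H φ W ψ X x y m :=
      Prod.ext (hW.star_heckeOp m) (hX.star_heckeOp m)
    rw [h]
    exact Algebra.subset_adjoin ⟨m, rfl⟩
  | algebraMap c =>
    have h : star (algebraMap ℂ (G.PathAlgebra x × H.PathAlgebra y) c) =
        algebraMap ℂ (G.PathAlgebra x × H.PathAlgebra y) (conj c) :=
      Prod.ext (star_algebraMap_pathAlgebra G x c) (star_algebraMap_pathAlgebra H y c)
    rw [h]
    exact algebraMap_mem _ _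
  | add z w _ _ hz hw =>
    rw [star_add]
    exact add_mem hz hw
  | mul z w _ _ hz hw =>
    rw [star_mul]
    exact mul_mem hw hz

include hn hφ hψ

/-- The Markov traces agree on words in the canonical operators. -/
theorem trace_fst_eq_trace_snd {z : G.PathAlgebra x × H.PathAlgebra y}
    (hz : z ∈ Algebra.adjoin ℂ (Set.range (heckePair G H φ W ψ X x y))) :
    hφ.trace hn x z.1 = hψ.trace hn y z.2 := by
  -- The difference of the two traces is regarded as one tracial functional on the product algebra.
  -- It vanishes at 1, and both parts have the same Markov constant.
  have h := markov_trace_eq_zero (g := heckePair G H φ W ψ X x y) (δ := (quantumInt n 2 : ℂ))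
    (η := (quantumInt n 2 : ℂ) / (quantumInt n 3 : ℂ))
    (fun k => Prod.ext (hW.heckeOp_mul_self hφ.pos k) (hX.heckeOp_mul_self hψ.pos k))
    (fun k => Prod.ext (hW.heckeOp_braid hφ.pos k) (hX.heckeOp_braid hψ.pos k))
    (fun i j hij => Prod.ext (hW.heckeOp_commute i j hij).eq (hX.heckeOp_commute i j hij).eq)
    ((hφ.trace hn x).comp (LinearMap.fst ℂ _ _) - (hψ.trace hn y).comp (LinearMap.snd ℂ _ _))
    (fun z w => ?_) (fun k z hz => ?_) ?_ hz
  · exact sub_eq_zero.1 h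
  · change hφ.trace hn x (z.1 * w.1) - hψ.trace hn y (z.2 * w.2) =
      hφ.trace hn x (w.1 * z.1) - hψ.trace hn y (w.2 * z.2)
    rw [hφ.trace_mul_comm, hψ.trace_mul_comm]
  · have h1 : z.1 ∈ initialAlgebra (G.heckeOp x φ W) k := by
      rw [← map_fst_initialAlgebra (H := H) (ψ := ψ) (X := X) x y]
      exact ⟨z, hz, rfl⟩
    have h2 : z.2 ∈ initialAlgebra (H.heckeOp y ψ X) k := by
      rw [← map_snd_initialAlgebra (G := G) (φ := φ) (W := W) x y]
      exact ⟨z, hz, rfl⟩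
    change hφ.trace hn x (z.1 * G.heckeOp x φ W k) - hψ.trace hn y (z.2 * H.heckeOp y ψ X k) =
      _ * (hφ.trace hn x z.1 - hψ.trace hn y z.2)
    rw [hW.trace_mul_heckeOp hφ hn k h1, hX.trace_mul_heckeOp hψ hn k h2]
    ring
  · change hφ.trace hn x 1 - hψ.trace hn y 1 = 0
    rw [hφ.trace_one, hψ.trace_one, sub_self]

/-- The elements star z * z of the subalgebra have equal traces in both coordinates, and both traces
are faithful. -/
theorem fst_eq_zero_iff {z : G.PathAlgebra x × H.PathAlgebra y}
    (hz : z ∈ Algebra.adjoin ℂ (Set.range (heckePair G H φ W ψ X x y))) :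
    z.1 = 0 ↔ z.2 = 0 := by
  have h := trace_fst_eq_trace_snd hn hφ hW hψ hX x y
    (mul_mem (star_mem_adjoin_heckePair hW hX x y hz) hz)
  change hφ.trace hn x (star z.1 * z.1) = hψ.trace hn y (star z.2 * z.2) at h
  constructor
  · intro h0
    refine hψ.trace_faithful hn ?_
    rw [← h, h0, mul_zero, map_zero]
  · intro h0
    refine hφ.trace_faithful hn ?_
    rw [h, h0, mul_zero, map_zero]

variable (hgen : Algebra.adjoin ℂ (Set.range (G.heckeOp x φ W)) = ⊤)
include hgen

/-- If the canonical operators of the first cell system generate its path algebra, they can be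
mapped to those of the second. -/
theorem exists_starAlgHom :
    ∃ π : G.PathAlgebra x →⋆ₐ[ℂ] H.PathAlgebra y,
      ∀ z ∈ Algebra.adjoin ℂ (Set.range (heckePair G H φ W ψ X x y)), π z.1 = z.2 := by
  let S := Algebra.adjoin ℂ (Set.range (heckePair G H φ W ψ X x y))
  let f : S →ₐ[ℂ] G.PathAlgebra x := (AlgHom.fst ℂ _ _).comp S.val
  -- The generated subalgebra is the graph of the homomorphism sought: the first projection is
  -- injective by `fst_eq_zero_iff` and surjective because the canonical operators generate.
  have hf : Function.Bijective f := by
    constructor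
    · rw [injective_iff_map_eq_zero]
      intro z hz
      exact Subtype.ext (Prod.ext hz ((fst_eq_zero_iff hn hφ hW hψ hX x y z.2).1 hz))
    · intro a
      obtain ⟨z, hz, rfl⟩ := exists_mem_adjoin_heckePair (H := H) (ψ := ψ) (X := X) x y hgen a
      exact ⟨⟨z, hz⟩, rfl⟩
  let π : G.PathAlgebra x →ₐ[ℂ] H.PathAlgebra y :=
    ((AlgHom.snd ℂ _ _).comp S.val).comp (AlgEquiv.ofBijective f hf).symm.toAlgHom
  have hπ : ∀ z ∈ S, π z.1 = z.2 := by
    intro z hz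
    have h : (AlgEquiv.ofBijective f hf).symm z.1 = ⟨z, hz⟩ := by
      rw [AlgEquiv.symm_apply_eq]
      rfl
    change ((AlgEquiv.ofBijective f hf).symm z.1).1.2 = z.2
    rw [h]
  refine ⟨{ π with map_star' := fun a => ?_ }, hπ⟩
  obtain ⟨z, hz, rfl⟩ := exists_mem_adjoin_heckePair (H := H) (ψ := ψ) (X := X) x y hgen a
  change π (star z).1 = star (π z.1)
  rw [hπ z hz, hπ _ (star_mem_adjoin_heckePair hW hX x y hz)]
  rfl

end comparison

/-! ### Existence, uniqueness and range of the homomorphism -/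

section homomorphism

variable {V₁ E₁ V₂ E₂ : Type*} [Fintype V₁] [DecidableEq V₁] [Fintype E₁] [DecidableEq E₁]
  [Fintype V₂] [DecidableEq V₂] [Fintype E₂] [DecidableEq E₂]
  {G : EdgeGraph V₁ E₁} {H : EdgeGraph V₂ E₂} {n : ℕ} {φ : V₁ → ℝ} {ψ : V₂ → ℝ}
  {W : E₁ → E₁ → E₁ → ℂ} {X : E₂ → E₂ → E₂ → ℂ} {x : V₁} {y : V₂}

theorem adjoin_heckeOp_eq_top
    (hgen : ∀ k a, G.ofLevelHom x k a ∈ initialAlgebra (G.heckeOp x φ W) (k - 1)) :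
    Algebra.adjoin ℂ (Set.range (G.heckeOp x φ W)) = ⊤ := by
  refine Algebra.eq_top_iff.2 fun z => ?_
  obtain ⟨k, a, rfl⟩ := G.exists_ofLevelHom x z
  exact Algebra.adjoin_mono (Set.image_subset_range _ _) (hgen k a)

theorem initialAlgebra_heckeOp_pred_le (k : ℕ) :
    initialAlgebra (H.heckeOp y ψ X) (k - 1) ≤ (H.ofLevelHom y k).range := by
  rcases k with _ | k
  · rw [initialAlgebra_zero]
    exact bot_le
  · exact initialAlgebra_heckeOp_le k

/-- Level k of the source is generated by its first k - 1 operators, and their images lie in level k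
of the target. -/
theorem exists_map_ofLevelHom
    (hgen : ∀ k a, G.ofLevelHom x k a ∈ initialAlgebra (G.heckeOp x φ W) (k - 1))
    (π : G.PathAlgebra x →ₐ[ℂ] H.PathAlgebra y)
    (hπ : ∀ m, π (G.heckeOp x φ W m) = H.heckeOp y ψ X m) (k : ℕ) (a : G.Level x k) :
    ∃ b, H.ofLevelHom y k b = π (G.ofLevelHom x k a) := by
  have h : (initialAlgebra (G.heckeOp x φ W) (k - 1)).map π =
      initialAlgebra (H.heckeOp y ψ X) (k - 1) := by
    rw [initialAlgebra, AlgHom.map_adjoin, ← Set.image_comp, initialAlgebra]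
    congr 1
    exact Set.image_congr fun m _ => hπ m
  have h1 : π (G.ofLevelHom x k a) ∈ initialAlgebra (H.heckeOp y ψ X) (k - 1) := by
    rw [← h]
    exact ⟨_, hgen k a, rfl⟩
  exact initialAlgebra_heckeOp_pred_le k h1

/-- If the levels of the path algebra of `G` are generated by the canonical operators, there is
exactly one homomorphism to the path algebra of `H` that preserves the canonical operators. -/
theorem exists_unique_hom (hn : 4 ≤ n) (hφ : G.IsPerronFrobenius n φ)
    (hW : G.IsCellSystem n φ W) (hψ : H.IsPerronFrobenius n ψ) (hX : H.IsCellSystem n ψ X)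
    (hgen : ∀ k a, G.ofLevelHom x k a ∈ initialAlgebra (G.heckeOp x φ W) (k - 1)) :
    ∃ π : G.PathAlgebra x →⋆ₐ[ℂ] H.PathAlgebra y,
      (∀ m, π (G.heckeOp x φ W m) = H.heckeOp y ψ X m) ∧
      Function.Injective π ∧
      (∀ k a, ∃ b, π (G.ofLevel x k a) = H.ofLevel y k b) ∧
      π.toAlgHom.range = Algebra.adjoin ℂ (Set.range (H.heckeOp y ψ X)) ∧
      ∀ π' : G.PathAlgebra x →ₐ[ℂ] H.PathAlgebra y,
        (∀ m, π' (G.heckeOp x φ W m) = H.heckeOp y ψ X m) → π' = π.toAlgHom := by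
  have htop := adjoin_heckeOp_eq_top hgen
  obtain ⟨π, hπ⟩ := exists_starAlgHom hn hφ hW hψ hX x y htop
  have h1 : ∀ m, π (G.heckeOp x φ W m) = H.heckeOp y ψ X m := fun m =>
    hπ (heckePair G H φ W ψ X x y m) (Algebra.subset_adjoin ⟨m, rfl⟩)
  refine ⟨π, h1, ?_, fun k a => ?_, ?_, fun π' hπ' => ?_⟩
  · rw [injective_iff_map_eq_zero]
    intro a ha
    obtain ⟨z, hz, rfl⟩ := exists_mem_adjoin_heckePair (H := H) (ψ := ψ) (X := X) x y htop a
    rw [hπ z hz] at ha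
    exact (fst_eq_zero_iff hn hφ hW hψ hX x y hz).2 ha
  · obtain ⟨b, hb⟩ := exists_map_ofLevelHom hgen π.toAlgHom h1 k a
    exact ⟨b, hb.symm⟩
  · rw [← Algebra.map_top, ← htop, AlgHom.map_adjoin, ← Set.range_comp]
    congr 1
    exact congrArg Set.range (funext h1)
  · refine AlgHom.ext_of_adjoin_eq_top htop ?_
    rintro _ ⟨m, rfl⟩
    exact (hπ' m).trans (h1 m).symm

end homomorphism

end EdgeGraph

/-! ### Normal integer matrices -/

section integerMatrices

variable {ι κ : Type*} [Fintype ι] [Fintype κ]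

/-- A version of the Fuglede-Putnam theorem. -/
theorem Matrix.transpose_mul_eq_of_normal {M : Matrix ι ι ℤ} {N : Matrix κ κ ℤ} {X : Matrix ι κ ℤ}
    (hM : Commute Mᵀ M) (hN : Commute Nᵀ N) (h : M * X = X * N) : Mᵀ * X = X * Nᵀ := by
  have hT : Xᵀ * Mᵀ = Nᵀ * Xᵀ := by rw [← transpose_mul, h, transpose_mul]
  -- The squared Frobenius norm of Mᵀ X - X Nᵀ expands into four traces. Normality and the
  -- intertwining relation bring all of them to the same value, so they cancel.
  have h1 : (Xᵀ * M * (Mᵀ * X)).trace = (Xᵀ * X * (N * Nᵀ)).trace := by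
    rw [show Xᵀ * M * (Mᵀ * X) = Xᵀ * Mᵀ * (M * X) by
      simp only [← Matrix.mul_assoc]; rw [Matrix.mul_assoc Xᵀ, ← hM.eq, ← Matrix.mul_assoc],
      hT, h, Matrix.mul_assoc, trace_mul_comm]
    simp only [Matrix.mul_assoc]
  have h2 : (Xᵀ * M * (X * Nᵀ)).trace = (Xᵀ * X * (N * Nᵀ)).trace := by
    rw [show Xᵀ * M * (X * Nᵀ) = Xᵀ * (M * X) * Nᵀ by simp only [Matrix.mul_assoc], h]
    simp only [Matrix.mul_assoc]
  have h3 : (N * Xᵀ * (Mᵀ * X)).trace = (Xᵀ * X * (N * Nᵀ)).trace := by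
    rw [show N * Xᵀ * (Mᵀ * X) = N * (Xᵀ * Mᵀ) * X by simp only [Matrix.mul_assoc], hT,
      trace_mul_comm (Xᵀ * X)]
    simp only [Matrix.mul_assoc]
  have h4 : (N * Xᵀ * (X * Nᵀ)).trace = (Xᵀ * X * (N * Nᵀ)).trace := by
    rw [← hN.eq, Matrix.mul_assoc, trace_mul_comm]
    simp only [Matrix.mul_assoc]
  have h0 : ((Mᵀ * X - X * Nᵀ)ᴴ * (Mᵀ * X - X * Nᵀ)).trace = 0 := by
    rw [conjTranspose_eq_transpose_of_trivial, transpose_sub, transpose_mul, transpose_mul,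
      transpose_transpose, transpose_transpose, Matrix.sub_mul, Matrix.mul_sub, Matrix.mul_sub,
      trace_sub, trace_sub, trace_sub, h1, h2, h3, h4]
    ring
  exact sub_eq_zero.1 (trace_conjTranspose_mul_self_eq_zero_iff.1 h0)

/-- A nonnegative integer matrix is normal if one of its two squares dominates the other. -/
theorem Matrix.commute_transpose_of_le {M : Matrix ι ι ℤ} (h0 : ∀ i j, 0 ≤ M i j)
    (h : ∀ i j, (M * Mᵀ) i j ≤ (Mᵀ * M) i j) : Commute Mᵀ M := by
  have hP : ∀ i j, 0 ≤ (M * Mᵀ) i j := fun i j =>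
    Finset.sum_nonneg fun k _ => mul_nonneg (h0 i k) (h0 j k)
  -- By cyclicity of the trace the two squares have equal Frobenius norms. Entrywise domination of
  -- nonnegative entries then leaves only equality.
  have htr : ∑ i, ∑ j, (M * Mᵀ) i j * (M * Mᵀ) i j = ∑ i, ∑ j, (Mᵀ * M) i j * (Mᵀ * M) i j := by
    have h1 : ∀ P : Matrix ι ι ℤ, Pᵀ = P → ∑ i, ∑ j, P i j * P i j = (P * P).trace := by
      intro P hP
      exact Finset.sum_congr rfl fun i _ => Finset.sum_congr rfl fun j _ =>
        congrArg (P i j * ·) (congrFun (congrFun hP j) i)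
    rw [h1 _ (by rw [transpose_mul, transpose_transpose]),
      h1 _ (by rw [transpose_mul, transpose_transpose]), Matrix.mul_assoc, trace_mul_comm]
    simp only [Matrix.mul_assoc]
  have hle : ∀ i j, (M * Mᵀ) i j * (M * Mᵀ) i j ≤ (Mᵀ * M) i j * (Mᵀ * M) i j := fun i j =>
    mul_self_le_mul_self (hP i j) (h i j)
  refine Matrix.ext fun i j => ?_
  have h2 := (Finset.sum_eq_sum_iff_of_le
    (fun i _ => Finset.sum_le_sum fun j _ => hle i j)).1 htr i (Finset.mem_univ i)
  have h3 := (Finset.sum_eq_sum_iff_of_le (fun j _ => hle i j)).1 h2 j (Finset.mem_univ j)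
  exact ((mul_self_inj (hP i j) ((hP i j).trans (h i j))).1 h3).symm

end integerMatrices

/-! ### Polynomials in two commuting matrices -/

section evalCommuting

variable {ι : Type*} [Fintype ι] [DecidableEq ι] {M N : Matrix ι ι ℤ}

open scoped IsMulCommutative in
/-- Evaluation at two commuting matrices is a ring homomorphism. -/
theorem exists_evalCommuting_hom (h : Commute M N) :
    ∃ f : MvPolynomial (Fin 2) ℤ →+* Matrix ι ι ℤ, f (MvPolynomial.X 0) = M ∧
      f (MvPolynomial.X 1) = N ∧ ∀ p, f p = evalCommuting p M N := by
  have hcomm : ∀ a ∈ ({M, N} : Set (Matrix ι ι ℤ)), ∀ b ∈ ({M, N} : Set (Matrix ι ι ℤ)),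
      a * b = b * a := by
    rintro a (rfl | rfl) b (rfl | rfl)
    exacts [rfl, h.eq, h.eq.symm, rfl]
  -- Polynomial evaluation needs a commutative target, which is the subring generated by the two
  -- matrices.
  have := Algebra.isMulCommutative_adjoin ℤ hcomm
  let m : Fin 2 → Algebra.adjoin ℤ ({M, N} : Set (Matrix ι ι ℤ)) :=
    ![⟨M, Algebra.subset_adjoin (by simp)⟩, ⟨N, Algebra.subset_adjoin (by simp)⟩]
  refine ⟨(((Algebra.adjoin ℤ ({M, N} : Set (Matrix ι ι ℤ))).val.comp
    (MvPolynomial.aeval m) : MvPolynomial (Fin 2) ℤ →ₐ[ℤ] Matrix ι ι ℤ) :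
      MvPolynomial (Fin 2) ℤ →+* Matrix ι ι ℤ), ?_, ?_, fun p => ?_⟩
  · change ((MvPolynomial.aeval m (MvPolynomial.X 0) : Algebra.adjoin ℤ _) : Matrix ι ι ℤ) = M
    rw [MvPolynomial.aeval_X]
    rfl
  · change ((MvPolynomial.aeval m (MvPolynomial.X 1) : Algebra.adjoin ℤ _) : Matrix ι ι ℤ) = N
    rw [MvPolynomial.aeval_X]
    rfl
  · change ((MvPolynomial.aeval m p : Algebra.adjoin ℤ _) : Matrix ι ι ℤ) = _
    rw [MvPolynomial.aeval_def, MvPolynomial.eval₂_eq', evalCommuting,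
      AddSubmonoidClass.coe_finsetSum]
    refine Finset.sum_congr rfl fun d _ => ?_
    rw [Fin.prod_univ_two, ← Algebra.smul_def]
    rfl

/-- Multiplication by `M` and `N` acts on the family `c` as multiplication by x and y acts on the
polynomials, so the recursion that defines `polyS` can be followed. It only calls on vertices one
step below the boundary, hence the bound `a + b + 4 ≤ n`. -/
theorem eq_evalCommuting_polyS_mulVec (h : Commute M N) (n : ℕ) (c : ℕ → ℕ → ι → ℤ)
    (hM : ∀ a b, a + b + 4 ≤ n → M *ᵥ c a b = c (a + 1) b + (if a = 0 then 0 else c (a - 1) (b + 1))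
      + if b = 0 then 0 else c a (b - 1))
    (hN : ∀ a b, a + b + 4 ≤ n → N *ᵥ c a b = (if a = 0 then 0 else c (a - 1) b)
      + (if b = 0 then 0 else c (a + 1) (b - 1)) + c a (b + 1)) (a b : ℕ) (hab : a + b + 3 ≤ n) :
    c a b = evalCommuting (polyS a b) M N *ᵥ c 0 0 := by
  obtain ⟨f, f0, f1, hf⟩ := exists_evalCommuting_hom h
  rw [← hf]
  induction a, b using polyS.induct with
  | case1 => rw [polyS, map_one, Matrix.one_mulVec]
  | case2 ih =>
    have h1 := hN 0 0 (by omega)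
    simp only [if_true, zero_add] at h1
    rw [polyS, map_mul, f1, ← Matrix.mulVec_mulVec, ← ih (by omega), h1]
  | case3 b ih1 ih2 =>
    have h1 := hN 0 (b + 1) (by omega)
    simp only [if_true, zero_add, Nat.add_one_ne_zero, if_false, Nat.add_sub_cancel] at h1
    rw [polyS, map_sub, map_mul, f1, Matrix.sub_mulVec, ← Matrix.mulVec_mulVec, ← ih1 (by omega),
      ← ih2 (by omega), h1]
    abel
  | case4 ih =>
    have h1 := hM 0 0 (by omega)
    simp only [if_true, zero_add, add_zero] at h1
    rw [polyS, map_mul, f0, ← Matrix.mulVec_mulVec, ← ih (by omega), h1]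
  | case5 b ih1 ih2 =>
    have h1 := hM 0 (b + 1) (by omega)
    simp only [if_true, zero_add, add_zero, Nat.add_one_ne_zero, if_false, Nat.add_sub_cancel] at h1
    rw [polyS, map_sub, map_mul, f0, Matrix.sub_mulVec, ← Matrix.mulVec_mulVec, ← ih1 (by omega),
      ← ih2 (by omega), h1]
    abel
  | case6 a ih1 ih2 =>
    have h1 := hM (a + 1) 0 (by omega)
    simp only [if_true, zero_add, add_zero, Nat.add_one_ne_zero, if_false, Nat.add_sub_cancel] at h1
    rw [polyS, map_sub, map_mul, f0, Matrix.sub_mulVec, ← Matrix.mulVec_mulVec, ← ih1 (by omega),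
      ← ih2 (by omega), h1]
    abel
  | case7 a b ih1 ih2 ih3 =>
    have h1 := hM (a + 1) (b + 1) (by omega)
    simp only [Nat.add_one_ne_zero, if_false, Nat.add_sub_cancel] at h1
    rw [polyS, map_sub, map_sub, map_mul, f0, Matrix.sub_mulVec, Matrix.sub_mulVec,
      ← Matrix.mulVec_mulVec, ← ih1 (by omega), ← ih2 (by omega), ← ih3 (by omega), h1]
    abel

end evalCommuting

namespace EdgeGraph

/-! ### Normality of the adjacency matrix -/

section normality

variable {V : Type u} {E : Type v} [Fintype V] [DecidableEq V] [Fintype E] [DecidableEq E]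
  {G : EdgeGraph V E} {n : ℕ} {φ : V → ℝ} {W : E → E → E → ℂ}

theorem adjMat_apply (i j : V) : G.adjMat i j = ∑ e, if G.s e = i ∧ G.r e = j then 1 else 0 := by
  rw [adjMat, Matrix.of_apply, Fintype.card_subtype, Finset.sum_boole]

/-- The pairs of edges that start at `i` and `j` and have a common range. -/
abbrev Cospan (G : EdgeGraph V E) (i j : V) : Type v :=
  {x : E × E // (G.s x.1 = i ∧ G.s x.2 = j) ∧ G.r x.1 = G.r x.2}

/-- The pairs of edges that end at `i` and `j` and have a common source. -/
abbrev Span (G : EdgeGraph V E) (i j : V) : Type v :=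
  {y : E × E // (G.r y.1 = i ∧ G.r y.2 = j) ∧ G.s y.1 = G.s y.2}

theorem adjMat_mul_transpose_apply (i j : V) :
    (G.adjMat * G.adjMatᵀ) i j = Fintype.card (G.Cospan i j) := by
  rw [Fintype.card_subtype, ← Finset.sum_boole, Fintype.sum_prod_type, Matrix.mul_apply]
  simp only [Matrix.transpose_apply, adjMat_apply, Finset.sum_mul_sum]
  rw [Finset.sum_comm]
  refine Finset.sum_congr rfl fun e _ => ?_
  rw [Finset.sum_comm]
  refine Finset.sum_congr rfl fun f _ => ?_
  rw [Finset.sum_eq_single (G.r e)]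
  · split_ifs <;> grind
  · intro k _ hk
    rw [if_neg (fun h => hk h.2.symm), zero_mul]
  · simp

theorem adjMat_transpose_mul_apply (i j : V) :
    (G.adjMatᵀ * G.adjMat) i j = Fintype.card (G.Span i j) := by
  rw [Fintype.card_subtype, ← Finset.sum_boole, Fintype.sum_prod_type, Matrix.mul_apply]
  simp only [Matrix.transpose_apply, adjMat_apply, Finset.sum_mul_sum]
  rw [Finset.sum_comm]
  refine Finset.sum_congr rfl fun e _ => ?_
  rw [Finset.sum_comm]
  refine Finset.sum_congr rfl fun f _ => ?_
  rw [Finset.sum_eq_single (G.s e)]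
  · split_ifs <;> grind
  · intro k _ hk
    rw [if_neg (fun h => hk h.1.symm), zero_mul]
  · simp

/-- The matrix that assigns to a cospan the span opposite to it in a pair of triangles. -/
noncomputable def cellMatrix (G : EdgeGraph V E) (W : E → E → E → ℂ) (i j : V) :
    Matrix (G.Span i j) (G.Cospan i j) ℂ :=
  Matrix.of fun y x => ∑ b, W x.1.1 b y.1.1 * conj (W x.1.2 b y.1.2)

/-- Type II for a frame made of two cospans is a Gram identity: the four triangles around the inner
vertex pair up into two entries of `cellMatrix`, and the inner vertex is the source of the span. -/
theorem IsCellSystem.sum_span {i j : V} (hW : G.IsCellSystem n φ W) (x x' : G.Cospan i j) :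
    ∑ y : G.Span i j, conj (G.cellMatrix W i j y x') *
        (((φ (G.s y.1.1))⁻¹ : ℂ) * G.cellMatrix W i j y x) =
      (if x.1.1 = x.1.2 ∧ x'.1.2 = x'.1.1 then
        ((φ i * φ (G.r x.1.1) * φ (G.r x'.1.1) : ℝ) : ℂ) else 0) +
      (if x' = x then ((φ i * φ (G.r x.1.1) * φ j : ℝ) : ℂ) else 0) := by
  have h := hW.typeII x.1.1 x.1.2 x'.1.2 x'.1.1 (x.2.1.1.trans x'.2.1.1.symm)
    (x.2.1.2.trans x'.2.1.2.symm) x.2.2 x'.2.2.symm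
  have h2 : (if x' = x then ((φ i * φ (G.r x.1.1) * φ j : ℝ) : ℂ) else 0) =
      if x.1.1 = x'.1.1 ∧ x.1.2 = x'.1.2 then
        ((φ (G.s x.1.1) * φ (G.r x.1.1) * φ (G.s x.1.2) : ℝ) : ℂ) else 0 := by
    rw [x.2.1.1, x.2.1.2]
    refine if_congr ?_ rfl rfl
    rw [Subtype.ext_iff, Prod.ext_iff]
    exact ⟨fun h => ⟨h.1.symm, h.2.symm⟩, fun h => ⟨h.1.symm, h.2.symm⟩⟩
  rw [h2]
  rw [x.2.1.1] at h ⊢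
  refine Eq.trans ?_ h
  let f : E → E → E → E → ℂ := fun b b' c c' => ((φ (G.r b))⁻¹ : ℂ) *
    (W x.1.1 b c * conj (W x'.1.1 b' c) * W x'.1.2 b' c' * conj (W x.1.2 b c'))
  have hf : ∀ b b' c c', f b b' c c' ≠ 0 →
      W x.1.1 b c ≠ 0 ∧ W x.1.2 b c' ≠ 0 := by
    intro b b' c c' h0
    constructor <;> intro h1 <;> exact h0 (by simp [f, h1])
  have h3 : ∀ y : G.Span i j, conj (G.cellMatrix W i j y x') *
      (((φ (G.s y.1.1))⁻¹ : ℂ) * G.cellMatrix W i j y x) =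
        ∑ b, ∑ b', f b b' y.1.1 y.1.2 := by
    intro y
    simp only [cellMatrix, Matrix.of_apply, map_sum, map_mul, Complex.conj_conj, Finset.mul_sum,
      Finset.sum_mul]
    refine Finset.sum_congr rfl fun b _ => Finset.sum_congr rfl fun b' _ => ?_
    by_cases h0 : W x.1.1 b y.1.1 = 0
    · simp [f, h0]
    · simp only [f]
      rw [(hW.support _ _ _ h0).2.1]
      ring
  rw [Finset.sum_congr rfl fun y _ => h3 y,
    ← Finset.sum_subtype (Finset.univ.filter fun y : E × E =>
      (G.r y.1 = i ∧ G.r y.2 = j) ∧ G.s y.1 = G.s y.2) (by simp)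
      (fun y : E × E => ∑ b, ∑ b', f b b' y.1 y.2),
    Finset.sum_filter_of_ne, Fintype.sum_prod_type]
  · exact sum_reindex_four _
  · intro y _ hy
    obtain ⟨b, -, hb⟩ := Finset.exists_ne_zero_of_sum_ne_zero hy
    obtain ⟨b', -, hb'⟩ := Finset.exists_ne_zero_of_sum_ne_zero hb
    obtain ⟨h4, h5⟩ := hf _ _ _ _ hb'
    obtain ⟨h6, h7, h8⟩ := hW.support _ _ _ h4
    obtain ⟨h6', h7', h8'⟩ := hW.support _ _ _ h5
    exact ⟨⟨h8.trans x.2.1.1, h8'.trans x.2.1.2⟩, h7.symm.trans h7'⟩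

open scoped ComplexOrder in
-- The right-hand side of the Gram identity is a positive diagonal matrix plus a positive
-- semidefinite one of rank at most one, hence invertible. It factors through the space spanned by
-- the spans, which must be at least as large.
theorem IsCellSystem.card_cospan_le (hpos : ∀ i, 0 < φ i) (hW : G.IsCellSystem n φ W) (i j : V) :
    Fintype.card (G.Cospan i j) ≤ Fintype.card (G.Span i j) := by
  let d : G.Span i j → ℂ := fun y => (φ (G.s y.1.1) : ℂ)⁻¹
  let u : G.Cospan i j → ℂ := fun x => if x.1.1 = x.1.2 then (φ (G.r x.1.1) : ℂ) else 0
  let K : Matrix (G.Cospan i j) (G.Cospan i j) ℂ :=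
    Matrix.diagonal (fun x => ((φ i * φ (G.r x.1.1) * φ j : ℝ) : ℂ)) +
      (φ i : ℂ) • Matrix.vecMulVec u (star u)
  have hK : (G.cellMatrix W i j)ᴴ * (Matrix.diagonal d * G.cellMatrix W i j) = K := by
    refine Matrix.ext fun x' x => ?_
    rw [Matrix.mul_apply]
    simp only [Matrix.conjTranspose_apply, Matrix.diagonal_mul]
    refine (hW.sum_span x x').trans ?_
    rw [add_comm]
    change _ = (Matrix.diagonal _ + _ : Matrix _ _ ℂ) x' x
    rw [Matrix.add_apply, Matrix.diagonal_apply, Matrix.smul_apply,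
      Matrix.vecMulVec_apply]
    congr 1
    · by_cases h : x' = x
      · rw [h]
      · rw [if_neg h, if_neg h]
    · simp only [u, Pi.star_apply, smul_eq_mul]
      by_cases h : x.1.1 = x.1.2
      · by_cases h' : x'.1.1 = x'.1.2
        · rw [if_pos ⟨h, h'.symm⟩, if_pos h, if_pos h']
          simp
          ring
        · rw [if_neg (fun h0 => h' h0.2.symm), if_neg h', zero_mul, mul_zero]
      · rw [if_neg (fun h0 => h h0.1), if_neg h, star_zero, mul_zero, mul_zero]
  have hpd : K.PosDef := by
    refine Matrix.PosDef.add_posSemidef (Matrix.PosDef.diagonal fun x => ?_)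
      ((Matrix.posSemidef_vecMulVec_self_star u).smul ?_)
    · exact Complex.zero_lt_real.2 (mul_pos (mul_pos (hpos _) (hpos _)) (hpos _))
    · exact Complex.zero_le_real.2 (hpos i).le
  calc Fintype.card (G.Cospan i j) = K.rank := (Matrix.rank_of_isUnit K hpd.isUnit).symm
    _ ≤ (G.cellMatrix W i j)ᴴ.rank := by
      rw [← hK]
      exact Matrix.rank_mul_le_left _ _
    _ ≤ Fintype.card (G.Span i j) := Matrix.rank_le_card_width _

/-- The adjacency matrix of a graph with a cell system is normal. -/
theorem IsCellSystem.commute_adjMat (hpos : ∀ i, 0 < φ i) (hW : G.IsCellSystem n φ W) :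
    Commute G.adjMatᵀ G.adjMat := by
  refine Matrix.commute_transpose_of_le (fun i j => Int.natCast_nonneg _) fun i j => ?_
  rw [adjMat_mul_transpose_apply, adjMat_transpose_mul_apply]
  exact_mod_cast hW.card_cospan_le hpos i j

end normality

end EdgeGraph

/-! ### Columns of an intertwiner -/

section graphA

variable {n : ℕ}

theorem graphA_adjMat_apply (l m : AVertex n) :
    (graphA n).adjMat l m = if AAdj l.1 m.1 then 1 else 0 := by
  rw [EdgeGraph.adjMat_apply]
  split_ifs with h
  · rw [Finset.sum_eq_single (edgeA h), if_pos ⟨rfl, rfl⟩]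
    · intro e _ he
      exact if_neg fun h' => he (graphA_edge_ext h'.1 h'.2)
    · simp
  · refine Finset.sum_eq_zero fun e _ => if_neg ?_
    rintro ⟨rfl, rfl⟩
    exact h e.2

variable {ι : Type*} [Fintype ι] [DecidableEq ι]

/-- The columns of a matrix indexed by the vertices of `𝒜⁽ⁿ⁾`, extended by zero. -/
def colA (T : Matrix ι (AVertex n) ℤ) (a b : ℕ) : ι → ℤ :=
  if h : a + b + 3 ≤ n then T.col ⟨(a, b), h⟩ else 0

theorem sum_ite_eq_colA (T : Matrix ι (AVertex n) ℤ) (a b : ℕ) (j : ι) :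
    ∑ m : AVertex n, T j m * (if m.1 = (a, b) then 1 else 0) = colA T a b j := by
  rw [colA]
  split_ifs with h
  · rw [Finset.sum_eq_single ⟨(a, b), h⟩]
    · simp [Matrix.col]
    · intro m _ hm
      rw [if_neg (fun h' => hm (Subtype.ext h')), mul_zero]
    · simp
  · refine Finset.sum_eq_zero fun m _ => ?_
    rw [if_neg, mul_zero]
    intro h'
    have := m.2
    rw [h'] at this
    exact h this

theorem mulVec_colA_of_out {T : Matrix ι (AVertex n) ℤ} {M : Matrix ι ι ℤ}
    (h : M * T = T * (graphA n).adjMatᵀ) (a b : ℕ) (hab : a + b + 3 ≤ n) :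
    M *ᵥ colA T a b = colA T (a + 1) b + (if a = 0 then 0 else colA T (a - 1) (b + 1)) +
      if b = 0 then 0 else colA T a (b - 1) := by
  funext j
  have h1 : (M *ᵥ colA T a b) j = (M * T) j ⟨(a, b), hab⟩ := by
    rw [colA, dif_pos hab]
    rfl
  have h2 : ∀ m : AVertex n, (graphA n).adjMat ⟨(a, b), hab⟩ m =
      (if m.1 = (a + 1, b) then 1 else 0) +
      (if a = 0 then 0 else if m.1 = (a - 1, b + 1) then 1 else 0) +
      (if b = 0 then 0 else if m.1 = (a, b - 1) then 1 else 0) := by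
    rintro ⟨⟨m1, m2⟩, hm⟩
    rw [graphA_adjMat_apply]
    simp only [AAdj, Prod.mk.injEq]
    split_ifs <;> omega
  rw [h1, h, Matrix.mul_apply]
  simp only [Matrix.transpose_apply, h2, mul_add, Finset.sum_add_distrib, sum_ite_eq_colA,
    Pi.add_apply]
  congr 1
  · congr 1
    split_ifs
    · simp
    · exact sum_ite_eq_colA T _ _ _
  · split_ifs
    · simp
    · exact sum_ite_eq_colA T _ _ _

theorem mulVec_colA_of_in {T : Matrix ι (AVertex n) ℤ} {N : Matrix ι ι ℤ}
    (h : N * T = T * (graphA n).adjMat) (a b : ℕ) (hab : a + b + 3 ≤ n) :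
    N *ᵥ colA T a b = (if a = 0 then 0 else colA T (a - 1) b) +
      (if b = 0 then 0 else colA T (a + 1) (b - 1)) + colA T a (b + 1) := by
  funext j
  have h1 : (N *ᵥ colA T a b) j = (N * T) j ⟨(a, b), hab⟩ := by
    rw [colA, dif_pos hab]
    rfl
  have h2 : ∀ m : AVertex n, (graphA n).adjMat m ⟨(a, b), hab⟩ =
      (if a = 0 then 0 else if m.1 = (a - 1, b) then 1 else 0) +
      (if b = 0 then 0 else if m.1 = (a + 1, b - 1) then 1 else 0) +
      (if m.1 = (a, b + 1) then 1 else 0) := by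
    rintro ⟨⟨m1, m2⟩, hm⟩
    rw [graphA_adjMat_apply]
    simp only [AAdj, Prod.mk.injEq]
    split_ifs <;> omega
  rw [h1, h, Matrix.mul_apply]
  simp only [h2, mul_add, Finset.sum_add_distrib, sum_ite_eq_colA, Pi.add_apply]
  congr 2
  · split_ifs
    · simp
    · exact sum_ite_eq_colA T _ _ _
  · split_ifs
    · simp
    · exact sum_ite_eq_colA T _ _ _

/-- The columns of an intertwiner are determined by the column of the origin. -/
theorem col_eq_evalCommuting_polyS (hn : 4 ≤ n) {T : Matrix ι (AVertex n) ℤ} {N : Matrix ι ι ℤ}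
    (hN : Commute Nᵀ N) (hA : Commute (graphA n).adjMatᵀ (graphA n).adjMat)
    (h : T * (graphA n).adjMat = N * T) (l : AVertex n) :
    T.col l = evalCommuting (polyS l.1.1 l.1.2) Nᵀ N *ᵥ T.col (originA n hn) := by
  -- The given relation is the recursion for y only; the one for x needs the transposed relation,
  -- which normality of both graphs supplies.
  have h' := Matrix.transpose_mul_eq_of_normal hN hA h.symm
  have h1 := eq_evalCommuting_polyS_mulVec hN n (colA T)
    (fun a b hab => mulVec_colA_of_out h' a b (by omega))
    (fun a b hab => mulVec_colA_of_in h.symm a b (by omega)) l.1.1 l.1.2 l.2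
  rw [colA, dif_pos l.2, colA, dif_pos (by omega)] at h1
  exact h1

end graphA

namespace EdgeGraph

/-! ### Nonvanishing of rows and columns -/

section rowsAndColumns

variable {V₁ E₁ V₂ E₂ : Type*} [Fintype V₁] [DecidableEq V₁] [Fintype E₁] [DecidableEq E₁]
  [Fintype V₂] [DecidableEq V₂] [Fintype E₂] [DecidableEq E₂]
  {G : EdgeGraph V₁ E₁} {H : EdgeGraph V₂ E₂}

theorem one_le_adjMat (e : E₁) : 1 ≤ G.adjMat (G.s e) (G.r e) := by
  rw [adjMat, Matrix.of_apply]
  exact_mod_cast Fintype.card_pos_iff.2 ⟨(⟨e, rfl, rfl⟩ : {f : E₁ // G.s f = G.s e ∧ G.r f = G.r e})⟩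

theorem adjMat_nonneg (i j : V₁) : 0 ≤ G.adjMat i j := Int.natCast_nonneg _

variable {T : Matrix V₂ V₁ ℤ} (h0 : ∀ j l, 0 ≤ T j l) (h : T * G.adjMat = H.adjMat * T)
include h0 h

/-- An entry of the intertwining relation becomes a vanishing sum of nonnegative terms. Zero columns
thus spread backwards along edges and, by the companion lemma, zero rows spread forwards. -/
theorem eq_zero_of_col_range_eq_zero {e : E₁} (hT : ∀ j, T j (G.r e) = 0) (j : V₂) :
    T j (G.s e) = 0 := by
  have h1 : (T * G.adjMat) j (G.r e) = 0 := by
    rw [h, Matrix.mul_apply]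
    exact Finset.sum_eq_zero fun i _ => by rw [hT, mul_zero]
  rw [Matrix.mul_apply, Finset.sum_eq_zero_iff_of_nonneg
    fun l _ => mul_nonneg (h0 j l) (adjMat_nonneg l _)] at h1
  have h2 := one_le_adjMat (G := G) e
  exact (mul_eq_zero.1 (h1 _ (Finset.mem_univ _))).resolve_right (by omega)

theorem eq_zero_of_row_source_eq_zero {e : E₂} (hT : ∀ l, T (H.s e) l = 0) (l : V₁) :
    T (H.r e) l = 0 := by
  have h1 : (H.adjMat * T) (H.s e) l = 0 := by
    rw [← h, Matrix.mul_apply]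
    exact Finset.sum_eq_zero fun i _ => by rw [hT, zero_mul]
  rw [Matrix.mul_apply, Finset.sum_eq_zero_iff_of_nonneg
    fun i _ => mul_nonneg (adjMat_nonneg _ i) (h0 i l)] at h1
  have h2 := one_le_adjMat (G := H) e
  exact (mul_eq_zero.1 (h1 _ (Finset.mem_univ _))).resolve_left (by omega)

theorem col_ne_zero_of_path {x : V₁} (hx : ∃ j, T j x ≠ 0) :
    ∀ {k : ℕ} (p : G.Path x k), ∃ j, T j p.1 ≠ 0
  | 0, p => by rwa [p.fst_zero]
  | k + 1, p => by
    obtain ⟨j, hj⟩ := col_ne_zero_of_path hx p.init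
    by_contra! h1
    rw [← p.r_last] at h1
    exact hj (eq_zero_of_col_range_eq_zero h0 h h1 j)

theorem row_ne_zero_of_isConnected (hH : H.IsConnected) {y : V₂} (hy : ∃ l, T y l ≠ 0) (j : V₂) :
    ∃ l, T j l ≠ 0 := by
  by_contra! h1
  have h2 : ∀ i, Relation.ReflTransGen (fun a b => ∃ e, H.s e = a ∧ H.r e = b) j i →
      ∀ l, T i l = 0 := by
    intro i hi
    induction hi with
    | refl => exact h1
    | tail _ he ih =>
      obtain ⟨e, rfl, rfl⟩ := he
      exact eq_zero_of_row_source_eq_zero h0 h ih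
  obtain ⟨l, hl⟩ := hy
  exact hl (h2 y (hH j y) l)

end rowsAndColumns

end EdgeGraph

/-! ### Multiplicities of blocks -/

theorem Matrix.exists_nat_trace_eq {ι : Type*} [Fintype ι] [DecidableEq ι] {P : Matrix ι ι ℂ}
    (h : IsIdempotentElem P) : ∃ m : ℕ, P.trace = m := by
  have h1 : IsIdempotentElem (Matrix.toLin' P) := by
    rw [IsIdempotentElem, Module.End.mul_eq_comp, ← Matrix.toLin'_mul, h.eq]
  exact ⟨_, by rw [← Matrix.trace_toLin'_eq, (LinearMap.IsIdempotentElem.isProj_range _ h1).trace]⟩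

/-- A tracial functional on a matrix algebra is a multiple of the trace. -/
theorem Matrix.eq_mul_trace_of_tracial {ι : Type*} [Fintype ι] [DecidableEq ι]
    (t : Matrix ι ι ℂ →ₗ[ℂ] ℂ) (ht : ∀ A B, t (A * B) = t (B * A)) (p : ι) (A : Matrix ι ι ℂ) :
    t A = t (Matrix.single p p 1) * A.trace := by
  have h : t = t (Matrix.single p p 1) • Matrix.traceLinearMap ι ℂ ℂ := by
    refine Matrix.ext_linearMap ℂ fun i j => LinearMap.ext_ring ?_
    simp only [LinearMap.comp_apply, Matrix.singleLinearMap_apply, LinearMap.smul_apply,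
      Matrix.traceLinearMap_apply, smul_eq_mul]
    by_cases hij : i = j
    · subst hij
      rw [Matrix.trace_single_eq_same, mul_one]
      have h1 := ht (Matrix.single i p 1) (Matrix.single p i 1)
      rwa [Matrix.single_mul_single_same, Matrix.single_mul_single_same, mul_one] at h1
    · rw [Matrix.trace_single_eq_of_ne _ _ _ hij, mul_zero]
      have h1 := ht (Matrix.single i i 1) (Matrix.single i j 1)
      rwa [Matrix.single_mul_single_same, Matrix.single_mul_single_of_ne _ _ _ _ (Ne.symm hij),
        mul_one, map_zero] at h1
  conv_lhs => rw [h]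
  rfl

namespace EdgeGraph

section multiplicities

variable {V : Type u} {E : Type v} [Fintype V] [DecidableEq V] [Fintype E] [DecidableEq E]
  {G : EdgeGraph V E} {x : V} {k : ℕ}

theorem level_eq_sum_single (a : G.Level x k) : a = ∑ v, Pi.single v (a v) := by
  funext w
  rw [Finset.sum_apply, Finset.sum_eq_single w]
  · rw [Pi.single_eq_same]
  · intro v _ hv
    rw [Pi.single_eq_of_ne hv.symm]
  · simp

/-- A tracial functional on a level that is a natural number on every idempotent is a combination
of the block traces with natural coefficients. -/
theorem exists_multiplicity (t : G.Level x k →ₗ[ℂ] ℂ) (ht : ∀ a b, t (a * b) = t (b * a))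
    (hnat : ∀ a, IsIdempotentElem a → ∃ m : ℕ, t a = m) :
    ∃ m : V → ℕ, ∀ a, t a = ∑ v, (m v : ℂ) * (a v).trace := by
  have h : ∀ v, ∃ m : ℕ, ∀ A, t (Pi.single v A) = m * A.trace := by
    intro v
    rcases isEmpty_or_nonempty (G.PathTo x k v) with hv | ⟨⟨p⟩⟩
    -- A block without paths has size zero and is invisible to `t`, so any multiplicity would do.
    -- Later statements about multiplicities therefore ask for a path.
    · refine ⟨0, fun A => ?_⟩
      rw [Subsingleton.elim A 0, Pi.single_zero, map_zero, Matrix.trace_zero, mul_zero]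
    · obtain ⟨m, hm⟩ := hnat (Pi.single v (Matrix.single p p 1)) (by
        rw [IsIdempotentElem, ← Pi.single_mul, Matrix.single_mul_single_same, mul_one])
      refine ⟨m, fun A => ?_⟩
      rw [← hm]
      refine Matrix.eq_mul_trace_of_tracial (t ∘ₗ LinearMap.single ℂ
        (fun w => Matrix (G.PathTo x k w) (G.PathTo x k w) ℂ) v) (fun A B => ?_) p A
      simp only [LinearMap.comp_apply, LinearMap.single_apply, Pi.single_mul]
      exact ht _ _
  choose m hm using h
  refine ⟨m, fun a => ?_⟩
  conv_lhs => rw [level_eq_sum_single a, map_sum]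
  exact Finset.sum_congr rfl fun v _ => hm v (a v)

theorem trace_one_level_zero (j : V) :
    ((1 : G.Level x 0) j).trace = if x = j then 1 else 0 := by
  rw [Pi.one_apply, Matrix.trace_one]
  split_ifs with h
  · rw [Fintype.card_eq_one_iff.2 ⟨⟨⟨⟩, h⟩, fun _ => rfl⟩, Nat.cast_one]
  · rw [Fintype.card_eq_zero_iff.2 ⟨fun p => h p.2⟩, Nat.cast_zero]

theorem eq_of_sum_mul_trace_eq {c d : V → ℂ}
    (h : ∀ a : G.Level x k, ∑ v, c v * (a v).trace = ∑ v, d v * (a v).trace) {v : V}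
    (hv : Nonempty (G.PathTo x k v)) : c v = d v := by
  obtain ⟨p⟩ := hv
  have h1 : ∀ f : V → ℂ, ∑ w, f w * ((Pi.single v (Matrix.single p p 1) : G.Level x k) w).trace =
      f v := by
    intro f
    rw [Finset.sum_eq_single v]
    · rw [Pi.single_eq_same, Matrix.trace_single_eq_same, mul_one]
    · intro w _ hw
      rw [Pi.single_eq_of_ne hw, Matrix.trace_zero, mul_zero]
    · simp
  rw [← h1 c, h, h1]

end multiplicities

/-! ### Relations between the multiplicities at different levels -/

section branching

variable {V₁ E₁ V₂ E₂ : Type*} [Fintype V₁] [DecidableEq V₁] [Fintype E₁] [DecidableEq E₁]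
  [Fintype V₂] [DecidableEq V₂] [Fintype E₂] [DecidableEq E₂]
  {G : EdgeGraph V₁ E₁} {H : EdgeGraph V₂ E₂} {n : ℕ} {φ : V₁ → ℝ} {ψ : V₂ → ℝ}
  {W : E₁ → E₁ → E₁ → ℂ} {X : E₂ → E₂ → E₂ → ℂ} {x : V₁} {y : V₂}

theorem exists_levelHom (hn : 4 ≤ n) (hψ : H.IsPerronFrobenius n ψ)
    (π : G.PathAlgebra x →ₐ[ℂ] H.PathAlgebra y)
    (hπ : ∀ k a, ∃ b, H.ofLevelHom y k b = π (G.ofLevelHom x k a)) (k : ℕ) :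
    ∃ ρ : G.Level x k →ₐ[ℂ] H.Level y k, ∀ a, H.ofLevelHom y k (ρ a) = π (G.ofLevelHom x k a) := by
  let f := AlgEquiv.ofInjective (H.ofLevelHom y k) (hψ.ofLevelHom_injective hn)
  refine ⟨f.symm.toAlgHom.comp ((π.comp (G.ofLevelHom x k)).codRestrict (H.ofLevelHom y k).range
    (hπ k)), fun a => ?_⟩
  exact congrArg Subtype.val (f.apply_symm_apply ⟨π (G.ofLevelHom x k a), hπ k a⟩)

theorem sum_out_trace (a : G.Level x k) (c : V₁ → ℂ) :
    ∑ v, c v * ∑ e, (if G.s e = v then (a (G.r e)).trace else 0) =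
      ∑ w, (∑ v, c v * (G.adjMat v w : ℂ)) * (a w).trace := by
  have h : ∀ v, ∑ e, (if G.s e = v then (a (G.r e)).trace else 0) =
      ∑ w, (G.adjMat v w : ℂ) * (a w).trace := by
    intro v
    simp only [adjMat_apply, Int.cast_sum, Int.cast_ite, Int.cast_one, Int.cast_zero,
      Finset.sum_mul, ite_mul, one_mul, zero_mul]
    rw [Finset.sum_comm]
    refine Finset.sum_congr rfl fun e _ => ?_
    by_cases he : G.s e = v
    · simp [he]
    · simp [he]
  simp only [h, Finset.mul_sum, Finset.sum_mul, mul_assoc]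
  exact Finset.sum_comm

/-- The multiplicities of a homomorphism of path algebras that preserves the levels and the
canonical operators. -/
theorem exists_branching (hn : 4 ≤ n) (hφ : G.IsPerronFrobenius n φ)
    (hW : G.IsCellSystem n φ W) (hψ : H.IsPerronFrobenius n ψ) (hX : H.IsCellSystem n ψ X)
    (π : G.PathAlgebra x →ₐ[ℂ] H.PathAlgebra y)
    (hlevel : ∀ k a, ∃ b, H.ofLevelHom y k b = π (G.ofLevelHom x k a))
    (hπ : ∀ m, π (G.heckeOp x φ W m) = H.heckeOp y ψ X m) :
    ∃ m : ℕ → V₂ → V₁ → ℕ, (∀ j, m 0 j x = if y = j then 1 else 0) ∧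
      (∀ k j w, Nonempty (G.PathTo x k w) →
        ∑ v, m (k + 2) j v * G.adjMat v w = ∑ i, H.adjMat j i * m k i w) ∧
      ∀ k j v, Nonempty (G.PathTo x k v) → m (k + 3) j v = m k j v := by
  choose ρ hρ using exists_levelHom hn hψ π hlevel
  have hinj : ∀ k, Function.Injective (H.ofLevelHom y k) := fun k => hψ.ofLevelHom_injective hn
  have hstep : ∀ k a, ρ (k + 1) (G.levelStep x k a) = H.levelStep y k (ρ k a) := fun k a =>
    hinj _ (by rw [hρ, ofLevelHom_step, ofLevelHom_step, hρ])
  have hhecke : ∀ k, ρ (k + 2) (G.heckeLevel x φ W k) = H.heckeLevel y ψ X k := fun k =>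
    hinj _ ((hρ _ _).trans (hπ k))
  have hm : ∀ k j, ∃ m : V₁ → ℕ, ∀ a, (ρ k a j).trace = ∑ v, (m v : ℂ) * (a v).trace := by
    intro k j
    refine exists_multiplicity ((Matrix.traceLinearMap _ ℂ ℂ ∘ₗ LinearMap.proj j) ∘ₗ
      (ρ k).toLinearMap) (fun a b => ?_) (fun a ha => ?_)
    · change (ρ k (a * b) j).trace = (ρ k (b * a) j).trace
      rw [map_mul, map_mul, Pi.mul_apply, Matrix.trace_mul_comm, Pi.mul_apply]
    · exact Matrix.exists_nat_trace_eq (P := ρ k a j) (congrFun (ha.map (ρ k)) j)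
  choose m hm using hm
  have h2 : (quantumInt n 2 : ℂ) ≠ 0 := by exact_mod_cast (quantumInt_two_pos hn).ne'
  have h3 : (quantumInt n 3 : ℂ) ≠ 0 := by exact_mod_cast (quantumInt_three_pos hn).ne'
  refine ⟨m, fun j => ?_, fun k j w hw => ?_, fun k j v hv => ?_⟩
  · have h := hm 0 j 1
    rw [map_one] at h
    simp only [trace_one_level_zero, mul_ite, mul_one, mul_zero, Finset.sum_ite_eq,
      Finset.mem_univ, if_true] at h
    exact_mod_cast h.symm
  · have h : ((∑ v, m (k + 2) j v * G.adjMat v w : ℤ) : ℂ) =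
        ((∑ i, H.adjMat j i * m k i w : ℤ) : ℂ) := by
      push_cast
      refine eq_of_sum_mul_trace_eq (c := fun w => ∑ v, (m (k + 2) j v : ℂ) * (G.adjMat v w : ℂ))
        (d := fun w => ∑ i, (H.adjMat j i : ℂ) * (m k i w : ℂ)) (fun a => ?_) hw
      -- The block trace of a U_{k+1} is computed in the target and, through the multiplicities, in
      -- the source. Both values carry the factor [2], and comparison of the coefficients of the
      -- block traces of `a` gives the relation.
      have h4 := hm (k + 2) j (G.levelStep x (k + 1) (G.levelStep x k a) * G.heckeLevel x φ W k)
      rw [map_mul, hstep, hstep, hhecke, hX.trace_block_mul_heckeLevel hψ.pos] at h4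
      simp only [hW.trace_block_mul_heckeLevel hφ.pos, mul_left_comm _ (quantumInt n 2 : ℂ),
        ← Finset.mul_sum] at h4
      rw [← sum_out_trace, ← mul_left_cancel₀ h2 h4]
      have h5 := sum_out_trace (ρ k a) (Pi.single j 1)
      simp only [Pi.single_apply, ite_mul, one_mul, zero_mul, Finset.sum_ite_eq',
        Finset.mem_univ, if_true] at h5
      rw [h5]
      simp only [hm, Finset.mul_sum, Finset.sum_mul, mul_assoc]
      exact Finset.sum_comm
    exact_mod_cast h
  · have h : (m (k + 3) j v : ℂ) = m k j v := by
      refine eq_of_sum_mul_trace_eq (c := fun v => (m (k + 3) j v : ℂ))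
        (d := fun v => (m k j v : ℂ)) (fun a => ?_) hv
      -- The triangle operator multiplies block traces by [2][3] on both sides, which links the
      -- multiplicities at levels k + 3 and k.
      have h4 := hm (k + 3) j (G.levelStep x (k + 2) (G.levelStep x (k + 1) (G.levelStep x k a)) *
        (G.levelStep x (k + 2) (G.heckeLevel x φ W k) * G.heckeLevel x φ W (k + 1) *
          G.levelStep x (k + 2) (G.heckeLevel x φ W k) -
          G.levelStep x (k + 2) (G.heckeLevel x φ W k)))
      rw [map_mul, map_sub, map_mul, map_mul, hstep, hstep, hstep, hstep, hhecke, hhecke,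
        hX.trace_block_mul_braid hψ] at h4
      simp only [hW.trace_block_mul_braid hφ,
        mul_left_comm _ ((quantumInt n 2 : ℂ) * (quantumInt n 3 : ℂ)), ← Finset.mul_sum] at h4
      rw [← mul_left_cancel₀ (mul_ne_zero h2 h3) h4, hm]
    exact_mod_cast h

end branching

end EdgeGraph

/-! ### The intertwiner and the main theorem -/

section graphA

variable {V E : Type*} [Fintype V] [DecidableEq V] [Fintype E] [DecidableEq E]
  {G : EdgeGraph V E} {n : ℕ} {pt : V} {φA : AVertex n → ℝ}
  {WA : AEdge n → AEdge n → AEdge n → ℂ} {φ : V → ℝ} {W : E → E → E → ℂ}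

theorem nonempty_pathTo_height (hn : 4 ≤ n) (l : AVertex n) (t : ℕ) :
    Nonempty ((graphA n).PathTo (originA n hn) (l.1.1 + 2 * l.1.2 + 3 * t) l) :=
  (nonempty_pathTo_graphA hn _ l).2 ⟨t, rfl⟩

/-- The multiplicities define a nonnegative intertwiner of the adjacency matrices. -/
theorem exists_intertwiner (hn : 4 ≤ n) (hφA : (graphA n).IsPerronFrobenius n φA)
    (hWA : (graphA n).IsCellSystem n φA WA) (hφ : G.IsPerronFrobenius n φ)
    (hW : G.IsCellSystem n φ W)
    (π : (graphA n).PathAlgebra (originA n hn) →ₐ[ℂ] G.PathAlgebra pt)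
    (hlevel : ∀ k a, ∃ b, G.ofLevelHom pt k b =
      π ((graphA n).ofLevelHom (originA n hn) k a))
    (hπ : ∀ m, π ((graphA n).heckeOp (originA n hn) φA WA m) = G.heckeOp pt φ W m) :
    ∃ T : Matrix V (AVertex n) ℤ, (∀ j l, 0 ≤ T j l) ∧
      T * (graphA n).adjMat = G.adjMat * T ∧ T *ᵥ Pi.single (originA n hn) 1 = Pi.single pt 1 := by
  obtain ⟨m, h0, h2, h3⟩ := EdgeGraph.exists_branching hn hφA hWA hφ hW π hlevel hπ
  -- The level λ₁ + 2 λ₂ is the first one that contains paths to (λ₁, λ₂); the others lie in steps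
  -- of 3 above it and give the same multiplicity.
  refine ⟨Matrix.of fun j l => (m (l.1.1 + 2 * l.1.2) j l : ℤ), fun j l => Int.natCast_nonneg _,
    ?_, ?_⟩
  · refine Matrix.ext fun j w => ?_
    rw [Matrix.mul_apply, Matrix.mul_apply]
    refine Eq.trans ?_ (h2 _ j w (nonempty_pathTo_height hn w 0))
    refine Finset.sum_congr rfl fun v _ => ?_
    rw [graphA_adjMat_apply]
    split_ifs with h
    · congr 2
      rw [Matrix.of_apply, Nat.cast_inj]
      -- Two levels above the first level of `w` is the first level of its predecessor `v`, or three
      -- levels above that; in the second case the periodicity applies.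
      have h4 : w.1.1 + 2 * w.1.2 + 2 = v.1.1 + 2 * v.1.2 + 3 ∨
          w.1.1 + 2 * w.1.2 + 2 = v.1.1 + 2 * v.1.2 := by
        simp only [AAdj, Prod.ext_iff] at h
        omega
      rcases h4 with h4 | h4
      · rw [h4]
        exact (h3 _ j v (nonempty_pathTo_height hn v 0)).symm
      · rw [h4]
    · rw [mul_zero, mul_zero]
  · funext j
    rw [Matrix.mulVec_single_one, Pi.single_apply]
    change (m 0 j (originA n hn) : ℤ) = _
    rw [h0]
    simp only [eq_comm (a := j), Nat.cast_ite, Nat.cast_one, Nat.cast_zero]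

end graphA

theorem mainTheorem6 {V E : Type*} [Fintype V] [DecidableEq V] [Fintype E] [DecidableEq E]
    (n : ℕ) (hn : 4 ≤ n)
    (φA : AVertex n → ℝ) (WA : AEdge n → AEdge n → AEdge n → ℂ)
    (hφA : (graphA n).IsPerronFrobenius n φA) (hWA : (graphA n).IsCellSystem n φA WA)
    (G : EdgeGraph V E) (hG : G.IsConnected) (pt : V)
    (φ : V → ℝ) (W : E → E → E → ℂ)
    (hφ : G.IsPerronFrobenius n φ) (hW : G.IsCellSystem n φ W) :
    (∃ π : (graphA n).PathAlgebra (originA n hn) →⋆ₐ[ℂ] G.PathAlgebra pt,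
      (∀ m, π ((graphA n).heckeOp (originA n hn) φA WA m) = G.heckeOp pt φ W m) ∧
      Function.Injective π ∧
      (∀ k a, ∃ b, π ((graphA n).ofLevel (originA n hn) k a) = G.ofLevel pt k b) ∧
      π.toAlgHom.range = Algebra.adjoin ℂ (Set.range (G.heckeOp pt φ W)) ∧
      ∀ π' : (graphA n).PathAlgebra (originA n hn) →ₐ[ℂ] G.PathAlgebra pt,
        (∀ m, π' ((graphA n).heckeOp (originA n hn) φA WA m) = G.heckeOp pt φ W m) →
          π' = π.toAlgHom) ∧
    Commute G.adjMatᵀ G.adjMat ∧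
    ∃ T : Matrix V (AVertex n) ℤ,
      (∀ j l, 0 ≤ T j l) ∧
      T * (graphA n).adjMat = G.adjMat * T ∧
      (∀ j, ∃ l, T j l ≠ 0) ∧
      (∀ l, ∃ j, T j l ≠ 0) ∧
      T *ᵥ Pi.single (originA n hn) 1 = Pi.single pt 1 ∧
      (∀ l : AVertex n, T.col l =
        evalCommuting (polyS l.1.1 l.1.2) G.adjMatᵀ G.adjMat *ᵥ Pi.single pt 1) ∧
      ∀ T' : Matrix V (AVertex n) ℤ,
        T' * (graphA n).adjMat = G.adjMat * T' →
        T' *ᵥ Pi.single (originA n hn) 1 = Pi.single pt 1 → T' = T := by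
  obtain ⟨π, h1, h2, h3, h4, h5⟩ := EdgeGraph.exists_unique_hom (y := pt) hn hφA hWA hφ hW
    (ofLevelHom_mem_initialAlgebra hφA.pos hWA hn)
  have hG' := hW.commute_adjMat hφ.pos
  have hA := hWA.commute_adjMat hφA.pos
  obtain ⟨T, hT0, hT, hTpt⟩ := exists_intertwiner hn hφA hWA hφ hW π.toAlgHom
    (fun k a => (h3 k a).imp fun _ hb => hb.symm) h1
  have hcol : ∀ T' : Matrix V (AVertex n) ℤ, T' * (graphA n).adjMat = G.adjMat * T' →
      T' *ᵥ Pi.single (originA n hn) 1 = Pi.single pt 1 → ∀ l : AVertex n, T'.col l =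
        evalCommuting (polyS l.1.1 l.1.2) G.adjMatᵀ G.adjMat *ᵥ Pi.single pt 1 := by
    intro T' hT' hpt l
    rw [← hpt, Matrix.mulVec_single_one]
    exact col_eq_evalCommuting_polyS hn hG' hA hT' l
  have hone : T pt (originA n hn) ≠ 0 := by
    have h := congrFun hTpt pt
    rw [Matrix.mulVec_single_one, Pi.single_eq_same] at h
    change T pt (originA n hn) = 1 at h
    rw [h]
    exact one_ne_zero
  refine ⟨⟨π, h1, h2, h3, h4, h5⟩, hG', T, hT0, hT, ?_, fun l => ?_, hTpt, hcol T hT hTpt,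
    fun T' hT' hpt => ?_⟩
  · exact EdgeGraph.row_ne_zero_of_isConnected hT0 hT hG ⟨_, hone⟩
  · obtain ⟨p⟩ := nonempty_pathTo_height hn l 0
    exact EdgeGraph.col_ne_zero_of_path hT0 hT ⟨pt, hone⟩ ⟨l, p⟩
  · refine Matrix.ext fun j l => ?_
    exact congrFun ((hcol T' hT' hpt l).trans (hcol T hT hTpt l).symm) j
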